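/- Let $X$ be a paracompact Hausdorff space and let $H$ be a separable infinite-dimensional complex Hilbert space. **Conventions.** The classifying space $|\mathcal C|$ of a topological category $\mathcal C$ is the geometric realization of its nerve; a partially ordered space is a topological category with one morphism $p\to q$ whenever $p\le q$. For an open covering $U=\{U_a\}_{a\in\Sigma}$ of $X$ let $X_U$ be the topological category of pairs $(x,\sigma)$, where $\sigma\subset\Sigma$ is finite and non-empty and $x\in U_\sigma=\bigcap_{a\in\sigma}U_a$; the space of objects is $\bigsqcup_\sigma U_\sigma$, and $(x,\sigma)\le(y,\tau)$ iff $x=y$ and $\tau\subset\sigma$. Let $|\mathrm{pr}|\colon|X_U|\to X$ be induced by $(x,\sigma)\mapsto x$. Given numbers $\varepsilon_a$, put $\varepsilon_\sigma=\min_{a\in\sigma}\varepsilon_a$. For a self-adjoint operator $A$ and $\varepsilon>0$, the pair $(A,\varepsilon)$ is an *enhanced operator* if $\pm\varepsilon\notin\sigma(A)$ and $[-\varepsilon,\varepsilon]$ is disjoint from the essential spectrum of $A$ (so the spectral projection $P_{[-\varepsilon,\varepsilon]}(A)$ has finite rank). Let $\hat{\mathcal F}$ be either the space of bounded self-adjoint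 Fredholm operators in $H$ with the norm topology, or the space of all closed densely defined self-adjoint Fredholm operators in $H$ with the Riesz topology (the norm topology on the bounded transforms $A(1+A^2)^{-1/2}$). Let $\hat{\mathcal E}$ be the space of enhanced operators $(A,\varepsilon)$, $A\in\hat{\mathcal F}$, with the topology given by the topology of $\hat{\mathcal F}$ and the discrete topology on the parameters $\varepsilon$, ordered by $(A,\varepsilon)\le(A',\varepsilon')$ iff $A=A'$ and $\varepsilon\le\varepsilon'$; let $|\hat\varphi|\colon|\hat{\mathcal E}|\to\hat{\mathcal F}$ be induced by $(A,\varepsilon)\mapsto A$. Let $\hat{\mathcal S}$ be the topological category of finite-dimensional subspaces of $H$, in which morphisms $V\to V'$ are orthogonal decompositions $V'=U_-\oplus V\oplus U_+$, and let $\hat\pi\colon\hat{\mathcal E}\to\hat{\mathcal S}$ be the functor $(A,\varepsilon)\mapsto\operatorname{Im}P_{[-\varepsilon,\varepsilon]}(A)$, taking $(A,\varepsilon)\le(A,\varepsilon')$ to the decomposition with $U_-=\operatorname{Im}P_{[-\varepsilon',-\varepsilon]}(A)$, $U_+=\operatorname{Im}P_{[\varepsilon,\varepsilon']}(A)$. **Theorem.**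 (1) Let $\mathbb A\colon X\to\hat{\mathcal F}$, $x\mapsto A_x$, be continuous. Consider all choices of an open covering $U=\{U_a\}$ of $X$ and numbers $\boldsymbol\varepsilon=(\varepsilon_a)$ such that $(A_z,\varepsilon_a)$ is an enhanced operator for all $z\in U_a$, and of a homotopy inverse $s\colon X\to|X_U|$ of $|\mathrm{pr}|$. Let $\mathbb A_{U,\boldsymbol\varepsilon}\colon X_U\to\hat{\mathcal E}$ be the functor $(x,\sigma)\mapsto(A_x,\varepsilon_\sigma)$. Then the map $|\mathbb A_{U,\boldsymbol\varepsilon}|\circ s\colon X\to|\hat{\mathcal E}|$ is continuous and its homotopy class does not depend on the choices of $U$, $\boldsymbol\varepsilon$ and $s$. If $|\mathrm{pr}|\circ s=\mathrm{id}_X$, this map is a lift of $\mathbb A$: $|\hat\varphi|\circ|\mathbb A_{U,\boldsymbol\varepsilon}|\circ s=\mathbb A$. Consequently the homotopy class of the index map $|\hat\pi|\circ|\mathbb A_{U,\boldsymbol\varepsilon}|\circ s\colon X\to|\hat{\mathcal S}|$ (the analytic index of the family) does not depend on the choices. This holds for both versions of $\hat{\mathcal F}$. (2) Let $\mathbb H$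 be a locally trivial Hilbert bundle over $X$ with fibers $H_x$ isomorphic to $H$ (with transition maps $(x,v)\mapsto(x,g(x)v)$ continuous), and let $\hat{\mathcal S}(\mathbb H)$ be the topological category of finite-dimensional subspaces of the fibers, with the morphisms inside each fiber as in $\hat{\mathcal S}$. Let $A_x$, $x\in X$, be self-adjoint Fredholm operators (bounded or not) in $H_x$. Call $\varepsilon$ *adapted* over $S\subset X$ if for $x\in S$ the pair $(A_x,\varepsilon)$ is enhanced, and the subspace $V_x=\operatorname{Im}P_{[-\varepsilon,\varepsilon]}(A_x)$ and the operator $V_x\to V_x$ induced by $A_x$ depend continuously on $x\in S$. Suppose that $A_x$, $x\in X$, is a Fredholm family, i.e. every point of $X$ has a neighborhood over which some $\varepsilon$ is adapted. For an open covering $U$ and numbers $\varepsilon_a$ adapted over $U_a$, let $\mathbb A_{U,\boldsymbol\varepsilon}\colon X_U\to\hat{\mathcal S}(\mathbb H)$ be the functor $(x,\sigma)\mapsto\operatorname{Im}P_{[-\varepsilon_\sigma,\varepsilon_\sigma]}(A_x)$, with the morphisms defined as for $\hat\pi$. Then, for homotopy inverses $s$ of $|\mathrm{pr}|$, the map $|\mathbb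 A_{U,\boldsymbol\varepsilon}|\circ s\colon X\to|\hat{\mathcal S}(\mathbb H)|$ is continuous and its homotopy class does not depend on the choices of $U$, $\boldsymbol\varepsilon$ and $s$. (3) For $\mathbb H$ as in (2), let $\mathcal S(\mathbb H)$ be the topological category of pairs $(E_1,E_2)$ of finite-dimensional subspaces of the same fiber $H_x$; a morphism $(E_1,E_2)\to(E_1',E_2')$ (inside one fiber) consists of subspaces $F_1,F_2$ with $E_i\oplus F_i=E_i'$ (orthogonal sums) and an isometry of $F_1$ onto $F_2$. Let $B_x$, $x\in X$, be bounded Fredholm operators in $H_x$, not necessarily self-adjoint. Call $\varepsilon>0$ *adapted* over $S\subset X$ if for $x\in S$ the interval $[0,\varepsilon]$ is disjoint from the essential spectrum of $|B_x|=(B_x^*B_x)^{1/2}$, $\varepsilon\notin\sigma(|B_x|)$, and the subspaces $E_1(x)=\operatorname{Im}P_{[0,\varepsilon]}(|B_x|)$, $E_2(x)=\operatorname{Im}P_{[0,\varepsilon]}(|B_x^*|)$ and the operator $E_1(x)\to E_2(x)$ induced by $B_x$ depend continuously on $x\in S$. Suppose that every point of $X$ has a neighborhood over which some $\varepsilon$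 is adapted. For an open covering $U$ and numbers $\varepsilon_a$ adapted over $U_a$ let $\mathbb B_{U,\boldsymbol\varepsilon}\colon X_U\to\mathcal S(\mathbb H)$ be the functor taking $(x,\sigma)$ to $(\operatorname{Im}P_{[0,\varepsilon_\sigma]}(|B_x|),\operatorname{Im}P_{[0,\varepsilon_\sigma]}(|B_x^*|))$ and taking $(x,\sigma)\le(x,\tau)$ to $F_1=\operatorname{Im}P_{[\varepsilon_\sigma,\varepsilon_\tau]}(|B_x|)$, $F_2=\operatorname{Im}P_{[\varepsilon_\sigma,\varepsilon_\tau]}(|B_x^*|)$ with the isometry induced by the partial isometry of the polar decomposition of $B_x$. Then, for homotopy inverses $s$ of $|\mathrm{pr}|$, the map $|\mathbb B_{U,\boldsymbol\varepsilon}|\circ s\colon X\to|\mathcal S(\mathbb H)|$ is continuous and its homotopy class does not depend on the choices of $U$, $\boldsymbol\varepsilon$ and $s$. -/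

import Mathlib

open CategoryTheory TopologicalSpace

noncomputable section

namespace AnalyticIndex

universe u v w

/-! ## Homotopies -/

/-- Two maps are continuous and homotopic. -/
def HomotopicMaps {Y Z : Type*} [TopologicalSpace Y] [TopologicalSpace Z] (f g : Y → Z) : Prop :=
  ∃ (hf : Continuous f) (hg : Continuous g), ContinuousMap.Homotopic ⟨f, hf⟩ ⟨g, hg⟩

/-- `s` is a homotopy inverse of `p`. -/
def IsHomotopyInverse {Y Z : Type*} [TopologicalSpace Y] [TopologicalSpace Z]
    (p : Y → Z) (s : Z → Y) : Prop :=
  Continuous p ∧ Continuous s ∧ HomotopicMaps (p ∘ s) id ∧ HomotopicMaps (s ∘ p) id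

/-! ## Classifying spaces of topological categories

A topological category is a category with a topology on its set of objects and a topology on its
set `Arrow C` of all morphisms. -/

/-- The set of `n`-simplices of the nerve: the diagrams `c₀ ⟶ c₁ ⟶ ⋯ ⟶ cₙ`. -/
def Nerve (C : Type u) [Category.{v} C] (n : ℕ) : Type (max u v) := Fin (n + 1) ⥤ C

/-- The space of `n`-simplices of the nerve has the topology of a subspace of the product of the
spaces of objects and of morphisms, by recording the objects `cᵢ` and the morphisms
`cᵢ ⟶ cᵢ₊₁`. -/
instance Nerve.instTopologicalSpace (C : Type u) [Category.{v} C] [TopologicalSpace C]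
    [TopologicalSpace (Arrow C)] (n : ℕ) : TopologicalSpace (Nerve C n) :=
  TopologicalSpace.induced (fun (F : Fin (n + 1) ⥤ C) (i : Fin (n + 1)) => F.obj i)
      inferInstance ⊓
    TopologicalSpace.induced
      (fun (F : Fin (n + 1) ⥤ C) (i : Fin n) =>
        Arrow.mk (F.map (homOfLE (Fin.castSucc_le_succ i)))) inferInstance

/-- Points of the disjoint union of the products (space of `n`-simplices) `× Δⁿ`. -/
abbrev PreRealization (C : Type u) [Category.{v} C] : Type (max u v) :=
  Σ n : ℕ, Nerve C n × stdSimplex ℝ (Fin (n + 1))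

/-- The generating identifications `(θ^* F, t) ∼ (F, θ_* t)` for nondecreasing maps `θ`. -/
def RealizationRel (C : Type u) [Category.{v} C] (p q : PreRealization C) : Prop :=
  ∃ θ : Fin (p.1 + 1) →o Fin (q.1 + 1),
    p.2.1 = (θ.monotone.functor ⋙ q.2.1 : Fin (p.1 + 1) ⥤ C) ∧
      q.2.2 = stdSimplex.map θ p.2.2

/-- The classifying space `|C|` of a topological category `C`, i.e. the geometric realization of
its nerve, with the quotient topology. -/
def Realization (C : Type u) [Category.{v} C] : Type (max u v) := Quot (RealizationRel C)

instance Realization.instTopologicalSpace (C : Type u) [Category.{v} C] [TopologicalSpace C]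
    [TopologicalSpace (Arrow C)] : TopologicalSpace (Realization C) :=
  inferInstanceAs (TopologicalSpace (Quot (RealizationRel C)))

/-- The map of classifying spaces `|Φ| : |C| → |D|` induced by a functor `Φ`. -/
def Realization.map {C : Type*} [Category* C] {D : Type*} [Category* D] (Φ : C ⥤ D) :
    Realization C → Realization D :=
  Quot.map (fun p => ⟨p.1, ((p.2.1 : Fin (p.1 + 1) ⥤ C) ⋙ Φ : Fin (p.1 + 1) ⥤ D), p.2.2⟩) <| by
    rintro ⟨m, F, t⟩ ⟨n, G, t'⟩ ⟨θ, h₁, h₂⟩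
    exact ⟨θ, congrArg (fun K : Fin (m + 1) ⥤ C => K ⋙ Φ) h₁, h₂⟩

/-- Let `Y` be a space, considered as a topological category with only identity morphisms, so that
`|Y| = Y`. A functor `C ⥤ Y` is a map `f` on objects which takes equal values at the ends of
every morphism; this is the induced map `|C| → |Y| = Y`. -/
def Realization.toSpace {C : Type*} [Category* C] {Y : Type*} (f : C → Y)
    (hf : ∀ c d : C, (c ⟶ d) → f c = f d) : Realization C → Y :=
  Quot.lift (fun p => f ((p.2.1 : Fin (p.1 + 1) ⥤ C).obj 0)) <| by
    rintro ⟨m, F, t⟩ ⟨n, G, t'⟩ ⟨θ, h₁, -⟩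
    refine (congrArg (fun K : Fin (m + 1) ⥤ C => f (K.obj 0)) h₁).trans ?_
    exact (hf _ _ ((G : Fin (n + 1) ⥤ C).map (homOfLE (Fin.zero_le (θ 0))))).symm

/-- The topology on the morphisms of a preordered space, considered as a topological category with
a single morphism `p ⟶ q` if `p ≤ q`: the set of morphisms is a subspace of the set of pairs of
objects. -/
@[reducible] def preorderArrowTopology (P : Type u) [Preorder P] [TopologicalSpace P] :
    TopologicalSpace (Arrow P) :=
  TopologicalSpace.induced (fun f => (f.left, f.right)) inferInstance

/-! ## The topological category of a covering -/

/-- The objects of the topological category `X_U` defined by a covering `U`: the pairs `(x, σ)`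
such that `σ` is a nonempty finite set of indices and `x ∈ U a` for every `a ∈ σ`. -/
structure CoverObj {X : Type u} [TopologicalSpace X] {ι : Type v} (U : ι → Opens X) where
  pt : X
  idx : Finset ι
  nonempty : idx.Nonempty
  mem : ∀ a ∈ idx, pt ∈ U a

namespace CoverObj

variable {X : Type u} [TopologicalSpace X] {ι : Type v} {U : ι → Opens X}

/-- `(x, σ) ≤ (y, τ)` if `x = y` and `τ ⊆ σ`. -/
instance : Preorder (CoverObj U) where
  le p q := p.pt = q.pt ∧ q.idx ⊆ p.idx
  le_refl _ := ⟨rfl, subset_rfl⟩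
  le_trans _ _ _ h₁ h₂ := ⟨h₁.1.trans h₂.1, h₂.2.trans h₁.2⟩

/-- The topology of the disjoint union over all `σ` of the intersections `⋂ a ∈ σ, U a`. -/
instance : TopologicalSpace (CoverObj U) :=
  TopologicalSpace.induced CoverObj.pt inferInstance ⊓ TopologicalSpace.induced CoverObj.idx ⊥

instance : TopologicalSpace (Arrow (CoverObj U)) := preorderArrowTopology _

variable (U) in
/-- The map `|pr| : |X_U| → X` induced by the functor `(x, σ) ↦ x`. -/
def pr : Realization (CoverObj U) → X :=
  Realization.toSpace CoverObj.pt fun _ _ f => (leOfHom f).1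

/-- `ε_σ = min {ε_a | a ∈ σ}`, where `σ` is the set of indices of an object of `X_U`. -/
def minEps (ε : ι → ℝ) (p : CoverObj U) : ℝ := p.idx.inf' p.nonempty ε

lemma minEps_mem (ε : ι → ℝ) (p : CoverObj U) : ∃ a ∈ p.idx, minEps ε p = ε a :=
  p.idx.exists_mem_eq_inf' p.nonempty ε

lemma minEps_mono (ε : ι → ℝ) {p q : CoverObj U} (h : p ≤ q) : minEps ε p ≤ minEps ε q :=
  Finset.inf'_mono _ h.2 _

end CoverObj

/-! ## Spectral notions for closed operators -/

section Operators

variable {H : Type u} [NormedAddCommGroup H] [InnerProductSpace ℂ H]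

/-- The operator `A - z`, with the same domain as `A`. -/
def shifted (A : H →ₗ.[ℂ] H) (z : ℂ) : A.domain →ₗ[ℂ] H := A.toFun - z • A.domain.subtype

/-- A (closed, densely defined) operator is Fredholm if its kernel is finite dimensional and its
range is closed and has finite codimension. -/
structure IsFredholm {D : Submodule ℂ H} (T : D →ₗ[ℂ] H) : Prop where
  finite_ker : FiniteDimensional ℂ (LinearMap.ker T)
  isClosed_range : IsClosed (LinearMap.range T : Set H)
  finite_coker : FiniteDimensional ℂ (H ⧸ LinearMap.range T)

/-- The spectrum `σ(A)` of a closed operator: `z ∉ σ(A)` if `A - z` maps the domain of `A`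
bijectively onto `H` (the inverse is bounded by the closed graph theorem). -/
def opSpectrum (A : H →ₗ.[ℂ] H) : Set ℂ := {z | ¬ Function.Bijective (shifted A z)}

/-- The essential spectrum of a closed operator. -/
def essSpectrum (A : H →ₗ.[ℂ] H) : Set ℂ := {z | ¬ IsFredholm (shifted A z)}

/-- The space of solutions of `A v = μ v`. -/
def eig (A : H →ₗ.[ℂ] H) (μ : ℝ) : Submodule ℂ H :=
  (LinearMap.ker (shifted A μ)).map A.domain.subtype

/-- The spectral subspace `Im P_{[a, b]}(A)` of a self-adjoint operator `A`, for intervals `[a, b]`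
disjoint from the essential spectrum of `A`: in this case the part of the spectrum of `A` in
`[a, b]` consists of finitely many eigenvalues of finite multiplicity, and the image of the
spectral projection `P_{[a, b]}(A)` is the sum of the corresponding eigenspaces. -/
def specSub (A : H →ₗ.[ℂ] H) (a b : ℝ) : Submodule ℂ H := ⨆ μ ∈ Set.Icc a b, eig A μ

/-- The spectral projection `P_{[a, b]}(A)`, for intervals `[a, b]` disjoint from the essential
spectrum of `A` (in which case `specSub A a b` is finite dimensional and hence closed). -/
def specProj [CompleteSpace H] (A : H →ₗ.[ℂ] H) (a b : ℝ) : H →L[ℂ] H :=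
  (specSub A a b).topologicalClosure.starProjection

/-- `(A, ε)` is an enhanced operator: `ε > 0`, the numbers `ε, -ε` do not belong to the spectrum
of `A`, and the interval `[-ε, ε]` is disjoint from the essential spectrum of `A`. For
self-adjoint `A` the last two conditions mean that `ε, -ε ∉ σ(A)` and that the spectral
projection `P_{[-ε, ε]}(A)` has finite rank. -/
structure IsEnhanced (A : H →ₗ.[ℂ] H) (ε : ℝ) : Prop where
  pos : 0 < ε
  notMem : (ε : ℂ) ∉ opSpectrum A
  neg_notMem : ((-ε : ℝ) : ℂ) ∉ opSpectrum A
  notMem_ess : ∀ μ ∈ Set.Icc (-ε) ε, (μ : ℂ) ∉ essSpectrum A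

lemma mem_eig {A : H →ₗ.[ℂ] H} {μ : ℝ} {v : H} :
    v ∈ eig A μ ↔ ∃ h : v ∈ A.domain, A ⟨v, h⟩ = (μ : ℂ) • v := by
  simp only [eig, Submodule.mem_map, LinearMap.mem_ker, shifted, LinearMap.sub_apply,
    LinearMap.smul_apply, sub_eq_zero]
  constructor
  · rintro ⟨⟨x, hx⟩, h, rfl⟩
    exact ⟨hx, h⟩
  · rintro ⟨h, h'⟩
    exact ⟨⟨v, h⟩, h', rfl⟩

lemma eig_eq_bot {A : H →ₗ.[ℂ] H} {μ : ℝ} (h : (μ : ℂ) ∉ opSpectrum A) : eig A μ = ⊥ := by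
  simp only [opSpectrum, Set.mem_ofPred_eq, not_not] at h
  rw [eig, LinearMap.ker_eq_bot.2 h.1, Submodule.map_bot]

lemma eig_le_specSub {A : H →ₗ.[ℂ] H} {a b μ : ℝ} (h : μ ∈ Set.Icc a b) :
    eig A μ ≤ specSub A a b :=
  le_iSup₂_of_le μ h le_rfl

lemma specSub_mono {A : H →ₗ.[ℂ] H} {a b a' b' : ℝ} (h : Set.Icc a b ⊆ Set.Icc a' b') :
    specSub A a b ≤ specSub A a' b' :=
  iSup₂_le fun _ hμ => eig_le_specSub (h hμ)

lemma specSub_sup {A : H →ₗ.[ℂ] H} {a b c : ℝ} (hab : a ≤ b) (hbc : b ≤ c) :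
    specSub A a b ⊔ specSub A b c = specSub A a c := by
  refine le_antisymm (sup_le (specSub_mono (Set.Icc_subset_Icc_right hbc))
    (specSub_mono (Set.Icc_subset_Icc_left hab))) (iSup₂_le fun μ hμ => ?_)
  rcases le_total μ b with h | h
  · exact le_sup_of_le_left (eig_le_specSub ⟨hμ.1, h⟩)
  · exact le_sup_of_le_right (eig_le_specSub ⟨h, hμ.2⟩)

lemma specSub_self {A : H →ₗ.[ℂ] H} {a : ℝ} (h : (a : ℂ) ∉ opSpectrum A) :
    specSub A a a = ⊥ := by
  simp [specSub, Set.Icc_self, eig_eq_bot h]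

lemma eig_isOrtho {A : H →ₗ.[ℂ] H} (hA : A.IsFormalAdjoint A) {μ ν : ℝ} (h : μ ≠ ν) :
    eig A μ ⟂ eig A ν := by
  rw [Submodule.isOrtho_iff_inner_eq]
  intro x hx y hy
  obtain ⟨hx, hx'⟩ := mem_eig.1 hx
  obtain ⟨hy, hy'⟩ := mem_eig.1 hy
  have := hA ⟨x, hx⟩ ⟨y, hy⟩
  rw [hx', hy', inner_smul_left, inner_smul_right] at this
  simp only [Complex.conj_ofReal] at this
  have h2 : ((μ : ℂ) - ν) * inner ℂ x y = 0 := by linear_combination this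
  rcases mul_eq_zero.1 h2 with h3 | h3
  · exact absurd (by exact_mod_cast sub_eq_zero.1 h3) h
  · exact h3

/-- Spectral subspaces of adjacent intervals are orthogonal if the common end is not in the
spectrum. -/
lemma specSub_isOrtho {A : H →ₗ.[ℂ] H} (hA : A.IsFormalAdjoint A) {a b b' c : ℝ} (hb : b ≤ b')
    (h : eig A b = ⊥) : specSub A a b ⟂ specSub A b' c := by
  simp only [specSub, Submodule.isOrtho_iSup_left, Submodule.isOrtho_iSup_right]
  intro ν hν μ hμ
  by_cases hμν : μ = ν
  · have : μ = b := le_antisymm hμ.2 (hb.trans (hμν ▸ hν.1))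
    rw [this, h]
    exact Submodule.isOrtho_bot_left
  · exact eig_isOrtho hA hμν

/-- A point outside of the essential spectrum is not a limit of eigenvalues. -/
lemma exists_gap [CompleteSpace H] {A : H →ₗ.[ℂ] H} (hA : A.IsFormalAdjoint A) (hc : A.IsClosed)
    {μ : ℝ} (hμ : (μ : ℂ) ∉ essSpectrum A) :
    ∃ c > 0, ∀ ν : ℝ, ν ≠ μ → |ν - μ| < c → eig A ν = ⊥ := by
  simp only [essSpectrum, Set.mem_ofPred_eq, not_not] at hμ
  have : CompleteSpace A.graph := IsClosed.completeSpace_coe (hs := hc)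
  have : CompleteSpace (LinearMap.range (shifted A μ)) :=
    IsClosed.completeSpace_coe (hs := hμ.isClosed_range)
  let f₀ : (H × H) →L[ℂ] H :=
    ContinuousLinearMap.snd ℂ H H - (μ : ℂ) • ContinuousLinearMap.fst ℂ H H
  have key : ∀ x : A.graph, (f₀ ∘L A.graph.subtypeL) x ∈ LinearMap.range (shifted A μ) := by
    rintro ⟨x, hx⟩
    obtain ⟨y, hy₁, hy₂⟩ := (LinearPMap.mem_graph_iff A).1 hx
    exact ⟨y, by simp [f₀, shifted, ← hy₁, ← hy₂]⟩
  let f : A.graph →L[ℂ] LinearMap.range (shifted A μ) :=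
    (f₀ ∘L A.graph.subtypeL).codRestrict _ key
  have hf : Function.Surjective f := by
    rintro ⟨_, y, rfl⟩
    refine ⟨⟨(y, A y), A.mem_graph y⟩, Subtype.ext ?_⟩
    change A y - (μ : ℂ) • (y : H) = shifted A μ y
    rfl
  obtain ⟨C, hC, hf⟩ := f.exists_preimage_norm_le hf
  refine ⟨1 / C, by positivity, fun ν hν hlt => ?_⟩
  rw [eq_bot_iff]
  intro v hv
  by_contra hv0
  obtain ⟨hvd, hv'⟩ := mem_eig.1 hv
  have hmem : shifted A μ ⟨v, hvd⟩ ∈ LinearMap.range (shifted A μ) := ⟨_, rfl⟩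
  have hval : shifted A μ ⟨v, hvd⟩ = ((ν - μ : ℝ) : ℂ) • v := by
    have : A.toFun ⟨v, hvd⟩ = (ν : ℂ) • v := hv'
    simp [shifted, this, sub_smul]
  obtain ⟨⟨⟨x, y⟩, hx⟩, hfx, hnx⟩ := hf ⟨_, hmem⟩
  obtain ⟨⟨x', hxd⟩, hx₁, hx₂⟩ := (LinearPMap.mem_graph_iff A).1 hx
  simp only at hx₁ hx₂
  subst hx₁
  have h1 : y - (μ : ℂ) • x' = ((ν - μ : ℝ) : ℂ) • v := by
    have := congrArg Subtype.val hfx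
    simpa [f, f₀, hval] using this
  have h2 : ‖x'‖ ≤ C * (|ν - μ| * ‖v‖) := by
    have h3 : ‖x'‖ ≤ ‖(⟨(x', y), hx⟩ : A.graph)‖ := by
      exact norm_fst_le (x', y)
    refine h3.trans (hnx.trans (le_of_eq ?_))
    congr 1
    change ‖shifted A μ ⟨v, hvd⟩‖ = _
    rw [hval, norm_smul, Complex.norm_real, Real.norm_eq_abs]
  have h3 : v - x' ∈ eig A μ := by
    refine mem_eig.2 ⟨A.domain.sub_mem hvd hxd, ?_⟩
    have h4 : (⟨v - x', A.domain.sub_mem hvd hxd⟩ : A.domain) = ⟨v, hvd⟩ - ⟨x', hxd⟩ := rfl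
    rw [h4, LinearPMap.map_sub, hv', hx₂]
    push_cast at h1
    rw [sub_smul] at h1
    rw [smul_sub]
    rw [sub_eq_iff_eq_add.1 h1]
    abel
  have h4 : inner ℂ v (v - x') = 0 :=
    (Submodule.isOrtho_iff_inner_eq.1 (eig_isOrtho hA hν)) v hv _ h3
  have h5 : (‖v‖ ^ 2 : ℝ) ≤ ‖v‖ * ‖x'‖ := by
    rw [inner_sub_right, sub_eq_zero] at h4
    have := norm_inner_le_norm (𝕜 := ℂ) v x'
    rw [← h4, inner_self_eq_norm_sq_to_K] at this
    simpa using this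
  have hvpos : 0 < ‖v‖ := norm_pos_iff.2 hv0
  have h6 : ‖v‖ ≤ ‖x'‖ := by nlinarith
  have h7 : |ν - μ| * C < 1 := by rwa [lt_div_iff₀ hC] at hlt
  nlinarith

lemma finite_specSub [CompleteSpace H] {A : H →ₗ.[ℂ] H} (hA : A.IsFormalAdjoint A)
    (hc : A.IsClosed) {a b : ℝ} (hess : ∀ μ ∈ Set.Icc a b, (μ : ℂ) ∉ essSpectrum A) :
    FiniteDimensional ℂ (specSub A a b) := by
  have hfin : ({μ | μ ∈ Set.Icc a b ∧ eig A μ ≠ ⊥} : Set ℝ).Finite := by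
    by_contra hinf
    obtain ⟨μ, hμ, hacc⟩ := Set.Infinite.exists_accPt_of_subset_isCompact hinf
      (isCompact_Icc (a := a) (b := b)) (fun x hx => hx.1)
    obtain ⟨c, hc0, hgap⟩ := exists_gap hA hc (hess μ hμ)
    rw [accPt_iff_nhds] at hacc
    obtain ⟨ν, ⟨hν₁, hν₂⟩, hν₃⟩ := hacc (Metric.ball μ c) (Metric.ball_mem_nhds _ hc0)
    exact hν₂.2 (hgap ν hν₃ (by simpa [Real.dist_eq] using hν₁))
  have hle : specSub A a b ≤ ⨆ μ ∈ hfin.toFinset, eig A μ := by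
    refine iSup₂_le fun μ hμ => ?_
    by_cases h : eig A μ = ⊥
    · rw [h]; exact bot_le
    · exact le_iSup₂_of_le μ (by simpa using ⟨hμ, h⟩) le_rfl
  have hfd : FiniteDimensional ℂ (⨆ μ ∈ hfin.toFinset, eig A μ : Submodule ℂ H) := by
    rw [iSup_subtype']
    have : ∀ μ : {μ // μ ∈ hfin.toFinset}, FiniteDimensional ℂ (eig A μ) := by
      rintro ⟨μ, hμ⟩
      have hμ' : μ ∈ Set.Icc a b := ((Set.Finite.mem_toFinset hfin).1 hμ).1
      have h := hess μ hμ'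
      simp only [essSpectrum, Set.mem_ofPred_eq, not_not] at h
      have := h.finite_ker
      rw [eig]
      infer_instance
    exact Submodule.finiteDimensional_iSup _
  exact Submodule.finiteDimensional_of_le hle

/-- The domain of a self-adjoint operator is dense, and `⟨A x, y⟩ = ⟨x, A y⟩`. -/
lemma formalAdjoint_of_isSelfAdjoint [CompleteSpace H] {A : H →ₗ.[ℂ] H} (hA : IsSelfAdjoint A) :
    A.IsFormalAdjoint A := by
  have h := LinearPMap.adjoint_isFormalAdjoint (T := A) hA.dense_domain
  rwa [LinearPMap.isSelfAdjoint_def.1 hA] at h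

/-- A bounded operator, considered as an operator with domain `H`. -/
def ofBounded (T : H →L[ℂ] H) : H →ₗ.[ℂ] H := (T : H →ₗ[ℂ] H).toPMap ⊤

lemma isSelfAdjoint_ofBounded [CompleteSpace H] {T : H →L[ℂ] H} (hT : IsSelfAdjoint T) :
    IsSelfAdjoint (ofBounded T) := by
  rw [LinearPMap.isSelfAdjoint_def, ofBounded,
    ContinuousLinearMap.toPMap_adjoint_eq_adjoint_toPMap_of_dense T (p := ⊤) (by simp)]
  rw [ContinuousLinearMap.isSelfAdjoint_iff'.1 hT]

end Operators

/-! ## The category of finite dimensional subspaces -/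

section Subspaces

variable {H : Type u} [NormedAddCommGroup H] [InnerProductSpace ℂ H]

variable (H) in
/-- The finite dimensional subspaces of `H`; these are the objects of the category `Ŝ`. -/
@[ext] structure FinSub where
  carrier : Submodule ℂ H
  finite : FiniteDimensional ℂ carrier

attribute [instance] FinSub.finite

/-- The topology on finite dimensional subspaces is the norm topology on the orthogonal projections
onto them. -/
instance : TopologicalSpace (FinSub H) :=
  TopologicalSpace.induced (fun V => V.carrier.starProjection) inferInstance

/-- Morphisms `V ⟶ V'` of `Ŝ` are the orthogonal decompositions `V' = U₋ ⊕ V ⊕ U₊`. -/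
@[ext] structure FinSub.Hom (V V' : FinSub H) where
  neg : FinSub H
  pos : FinSub H
  neg_ortho : neg.carrier ⟂ V.carrier
  pos_ortho : V.carrier ⟂ pos.carrier
  neg_pos_ortho : neg.carrier ⟂ pos.carrier
  sup_eq : neg.carrier ⊔ V.carrier ⊔ pos.carrier = V'.carrier

/-- The zero subspace. -/
def FinSub.zero : FinSub H := ⟨⊥, inferInstance⟩

/-- The sum of two finite dimensional subspaces. -/
def FinSub.add (V W : FinSub H) : FinSub H := ⟨V.carrier ⊔ W.carrier, inferInstance⟩

lemma FinSub.Hom.neg_le {V V' : FinSub H} (f : FinSub.Hom V V') : f.neg.carrier ≤ V'.carrier :=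
  f.sup_eq ▸ le_sup_of_le_left le_sup_left

lemma FinSub.Hom.src_le {V V' : FinSub H} (f : FinSub.Hom V V') : V.carrier ≤ V'.carrier :=
  f.sup_eq ▸ le_sup_of_le_left le_sup_right

lemma FinSub.Hom.pos_le {V V' : FinSub H} (f : FinSub.Hom V V') : f.pos.carrier ≤ V'.carrier :=
  f.sup_eq ▸ le_sup_right

/-- The category `Ŝ`. The composition adds the negative parts and adds the positive parts. -/
instance : Category (FinSub H) where
  Hom := FinSub.Hom
  id V :=
    { neg := .zero
      pos := .zero
      neg_ortho := Submodule.isOrtho_bot_left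
      pos_ortho := Submodule.isOrtho_bot_right
      neg_pos_ortho := Submodule.isOrtho_bot_left
      sup_eq := by simp [FinSub.zero] }
  comp {V V' V''} f g :=
    { neg := f.neg.add g.neg
      pos := f.pos.add g.pos
      neg_ortho := Submodule.isOrtho_sup_left.2 ⟨f.neg_ortho, g.neg_ortho.mono_right f.src_le⟩
      pos_ortho := Submodule.isOrtho_sup_right.2 ⟨f.pos_ortho, g.pos_ortho.mono_left f.src_le⟩
      neg_pos_ortho := Submodule.isOrtho_sup_left.2
        ⟨Submodule.isOrtho_sup_right.2 ⟨f.neg_pos_ortho, g.pos_ortho.mono_left f.neg_le⟩,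
          Submodule.isOrtho_sup_right.2 ⟨g.neg_ortho.mono_right f.pos_le, g.neg_pos_ortho⟩⟩
      sup_eq := by
        rw [← g.sup_eq, ← f.sup_eq]
        simp only [FinSub.add]
        ac_rfl }
  id_comp f := FinSub.Hom.ext (FinSub.ext (bot_sup_eq _)) (FinSub.ext (bot_sup_eq _))
  comp_id f := FinSub.Hom.ext (FinSub.ext (sup_bot_eq _)) (FinSub.ext (sup_bot_eq _))
  assoc f g h := FinSub.Hom.ext (FinSub.ext (sup_assoc _ _ _)) (FinSub.ext (sup_assoc _ _ _))

/-- The topology on the morphisms of `Ŝ`: the source, the target, the negative part and the positive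
part depend continuously on a morphism. -/
instance : TopologicalSpace (Arrow (FinSub H)) :=
  TopologicalSpace.induced
    (fun f => ((f.left, f.right), (FinSub.Hom.neg f.hom, FinSub.Hom.pos f.hom))) inferInstance

/-- An isometric isomorphism `H → K` takes subspaces of `H` to subspaces of `K`. -/
def FinSub.mapObj {K : Type v} [NormedAddCommGroup K] [InnerProductSpace ℂ K]
    (e : H ≃ₗᵢ[ℂ] K) (V : FinSub H) : FinSub K :=
  ⟨V.carrier.map (e.toLinearEquiv : H →ₗ[ℂ] K), inferInstance⟩

lemma isOrtho_map_isometry {K : Type v} [NormedAddCommGroup K] [InnerProductSpace ℂ K]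
    (e : H ≃ₗᵢ[ℂ] K) {V W : Submodule ℂ H} (h : V ⟂ W) :
    V.map (e.toLinearEquiv : H →ₗ[ℂ] K) ⟂ W.map (e.toLinearEquiv : H →ₗ[ℂ] K) := by
  rw [Submodule.isOrtho_iff_inner_eq] at h ⊢
  rintro _ ⟨x, hx, rfl⟩ _ ⟨y, hy, rfl⟩
  simpa using h x hx y hy

/-- The functor on finite dimensional subspaces induced by an isometric isomorphism. -/
def FinSub.mapIso {K : Type v} [NormedAddCommGroup K] [InnerProductSpace ℂ K]
    (e : H ≃ₗᵢ[ℂ] K) : FinSub H ⥤ FinSub K where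
  obj := FinSub.mapObj e
  map {V V'} f :=
    { neg := FinSub.mapObj e (FinSub.Hom.neg f)
      pos := FinSub.mapObj e (FinSub.Hom.pos f)
      neg_ortho := isOrtho_map_isometry e (FinSub.Hom.neg_ortho f)
      pos_ortho := isOrtho_map_isometry e (FinSub.Hom.pos_ortho f)
      neg_pos_ortho := isOrtho_map_isometry e (FinSub.Hom.neg_pos_ortho f)
      sup_eq := by
        simp only [FinSub.mapObj, ← Submodule.map_sup]
        rw [FinSub.Hom.sup_eq f] }
  map_id V := FinSub.Hom.ext (FinSub.ext (Submodule.map_bot _)) (FinSub.ext (Submodule.map_bot _))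
  map_comp f g := FinSub.Hom.ext (FinSub.ext (Submodule.map_sup _ _ _))
    (FinSub.ext (Submodule.map_sup _ _ _))

variable [CompleteSpace H]

/-- The object `Im P_{[-ε, ε]}(A)` of `Ŝ` defined by an enhanced operator `(A, ε)`. -/
def specObj (A : H →ₗ.[ℂ] H) (hA : IsSelfAdjoint A) {ε : ℝ} (h : IsEnhanced A ε) : FinSub H :=
  ⟨specSub A (-ε) ε, finite_specSub (formalAdjoint_of_isSelfAdjoint hA) hA.isClosed h.notMem_ess⟩

/-- The morphism of `Ŝ` corresponding to `(A, ε) ≤ (A, ε')`, i.e. the decomposition of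
`Im P_{[-ε', ε']}(A)` into the sum of `Im P_{[-ε', -ε]}(A)`, `Im P_{[-ε, ε]}(A)` and
`Im P_{[ε, ε']}(A)`. -/
def specHom (A : H →ₗ.[ℂ] H) (hA : IsSelfAdjoint A) {ε ε' : ℝ} (h : IsEnhanced A ε)
    (h' : IsEnhanced A ε') (hle : ε ≤ ε') : specObj A hA h ⟶ specObj A hA h' :=
  have hs := formalAdjoint_of_isSelfAdjoint hA
  FinSub.Hom.mk
    ⟨specSub A (-ε') (-ε), finite_specSub hs hA.isClosed fun μ hμ =>
      h'.notMem_ess μ ⟨hμ.1, by linarith [hμ.2, h.pos]⟩⟩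
    ⟨specSub A ε ε', finite_specSub hs hA.isClosed fun μ hμ =>
      h'.notMem_ess μ ⟨by linarith [hμ.1, h.pos], hμ.2⟩⟩
    (specSub_isOrtho hs le_rfl (eig_eq_bot h.neg_notMem))
    (specSub_isOrtho hs le_rfl (eig_eq_bot h.notMem))
    (specSub_isOrtho hs (by linarith [h.pos]) (eig_eq_bot h.neg_notMem))
    (by
      have h0 := h.pos
      change specSub A (-ε') (-ε) ⊔ specSub A (-ε) ε ⊔ specSub A ε ε' = specSub A (-ε') ε'
      rw [specSub_sup (by linarith) (by linarith), specSub_sup (by linarith) hle])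

lemma specHom_refl (A : H →ₗ.[ℂ] H) (hA : IsSelfAdjoint A) {ε : ℝ} (h : IsEnhanced A ε) :
    specHom A hA h h le_rfl = 𝟙 (specObj A hA h) :=
  FinSub.Hom.ext (FinSub.ext (specSub_self h.neg_notMem)) (FinSub.ext (specSub_self h.notMem))

lemma specHom_trans (A : H →ₗ.[ℂ] H) (hA : IsSelfAdjoint A) {ε ε' ε'' : ℝ} (h : IsEnhanced A ε)
    (h' : IsEnhanced A ε') (h'' : IsEnhanced A ε'') (hle : ε ≤ ε') (hle' : ε' ≤ ε'') :
    specHom A hA h h'' (hle.trans hle') = specHom A hA h h' hle ≫ specHom A hA h' h'' hle' :=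
  FinSub.Hom.ext
    (FinSub.ext (((sup_comm _ _).trans
      (specSub_sup (neg_le_neg hle') (neg_le_neg hle))).symm))
    (FinSub.ext (specSub_sup hle hle').symm)

end Subspaces

/-! ## Families of operators in a fixed Hilbert space -/

section FixedSpace

variable {H : Type u} [NormedAddCommGroup H] [InnerProductSpace ℂ H] [CompleteSpace H]

variable (H) in
/-- The space of bounded self-adjoint Fredholm operators in `H`. -/
structure BoundedSAFredholm where
  op : H →L[ℂ] H
  isSelfAdjoint : IsSelfAdjoint op
  isFredholm : op.IsFredholm

/-- The norm topology. -/
instance : TopologicalSpace (BoundedSAFredholm H) :=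
  TopologicalSpace.induced BoundedSAFredholm.op inferInstance

/-- A bounded self-adjoint Fredholm operator, considered as an operator with domain `H`. -/
def BoundedSAFredholm.toPMap (A : BoundedSAFredholm H) : H →ₗ.[ℂ] H := ofBounded A.op

lemma BoundedSAFredholm.isSelfAdjoint_toPMap (A : BoundedSAFredholm H) :
    IsSelfAdjoint A.toPMap := isSelfAdjoint_ofBounded A.isSelfAdjoint

variable (H) in
/-- The space of self-adjoint Fredholm operators in `H`, bounded or not. Self-adjoint operators are
densely defined and closed. -/
structure SAFredholm where
  toPMap : H →ₗ.[ℂ] H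
  isSelfAdjoint : IsSelfAdjoint toPMap
  isFredholm : IsFredholm toPMap.toFun

/-- `T` is the bounded transform `A (1 + A²)^{-1/2}` of a self-adjoint operator `A`, i.e. `T` is a
self-adjoint contraction such that `A = T (1 - T²)^{-1/2}`; the last equality means that the graph
of `A` consists of the pairs `((1 - T²)^{1/2} v, T v)`. -/
structure IsBoundedTransform (A : H →ₗ.[ℂ] H) (T : H →L[ℂ] H) : Prop where
  isSelfAdjoint : IsSelfAdjoint T
  norm_le : ‖T‖ ≤ 1
  mem_graph_iff : ∀ p : H × H, p ∈ A.graph ↔ ∃ v, p = (CFC.sqrt (1 - T * T) v, T v)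

open Classical in
/-- The bounded transform of a self-adjoint operator. Every self-adjoint operator has a unique
bounded transform; the other operators are given the value `0`. -/
def boundedTransform (A : H →ₗ.[ℂ] H) : H →L[ℂ] H :=
  if h : ∃ T, IsBoundedTransform A T then h.choose else 0

/-- The Riesz topology, i.e. the norm topology on the bounded transforms. -/
instance : TopologicalSpace (SAFredholm H) :=
  TopologicalSpace.induced (fun A => boundedTransform A.toPMap) inferInstance

variable {T : Type v} (op : T → (H →ₗ.[ℂ] H))

/-- The set of enhanced operators `(A, ε)`, where the operator `A` belongs to a given space `T` of
operators (`op` takes a point of `T` to the corresponding operator). -/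
structure EnhancedObj where
  pt : T
  eps : ℝ
  isEnhanced : IsEnhanced (op pt) eps

namespace EnhancedObj

variable {op}

/-- `(A, ε) ≤ (A', ε')` if `A = A'` and `ε ≤ ε'`. -/
instance : Preorder (EnhancedObj op) where
  le p q := p.pt = q.pt ∧ p.eps ≤ q.eps
  le_refl _ := ⟨rfl, le_rfl⟩
  le_trans _ _ _ h₁ h₂ := ⟨h₁.1.trans h₂.1, h₁.2.trans h₂.2⟩

/-- The topology defined by the topology of `T` and the discrete topology on the parameters `ε`. -/
instance [TopologicalSpace T] : TopologicalSpace (EnhancedObj op) :=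
  TopologicalSpace.induced EnhancedObj.pt inferInstance ⊓ TopologicalSpace.induced EnhancedObj.eps ⊥

instance [TopologicalSpace T] : TopologicalSpace (Arrow (EnhancedObj op)) :=
  preorderArrowTopology _

variable (op) in
/-- The map of classifying spaces induced by the forgetting functor `(A, ε) ↦ A`. -/
def forget : Realization (EnhancedObj op) → T :=
  Realization.toSpace EnhancedObj.pt fun _ _ f => (leOfHom f).1

/-- The morphism `Im P_{[-ε, ε]}(A) ⟶ Im P_{[-ε', ε']}(A')` corresponding to
`(A, ε) ≤ (A', ε')`, i.e. to `A = A'` and `ε ≤ ε'`. -/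
def spectralHom (hsa : ∀ t, IsSelfAdjoint (op t)) {t t' : T} (ht : t = t') {ε ε' : ℝ}
    (h : IsEnhanced (op t) ε) (h' : IsEnhanced (op t') ε') (hle : ε ≤ ε') :
    specObj (op t) (hsa t) h ⟶ specObj (op t') (hsa t') h' :=
  match t', ht, h' with
  | _, rfl, h' => specHom (op t) (hsa t) h h' hle

/-- The functor `(A, ε) ↦ Im P_{[-ε, ε]}(A)` to the category of finite dimensional subspaces. -/
def spectral (hsa : ∀ t, IsSelfAdjoint (op t)) : EnhancedObj op ⥤ FinSub H where
  obj p := specObj (op p.pt) (hsa p.pt) p.isEnhanced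
  map {p q} f := spectralHom hsa (leOfHom f).1 p.isEnhanced q.isEnhanced (leOfHom f).2
  map_id p := specHom_refl _ (hsa p.pt) p.isEnhanced
  map_comp {p q r} f g := by
    obtain ⟨t, ε, hp⟩ := p
    obtain ⟨t', ε', hq⟩ := q
    obtain ⟨t'', ε'', hr⟩ := r
    obtain ⟨h₁, h₁'⟩ : t = t' ∧ ε ≤ ε' := leOfHom f
    obtain ⟨h₂, h₂'⟩ : t' = t'' ∧ ε' ≤ ε'' := leOfHom g
    subst h₁ h₂
    exact specHom_trans _ (hsa t) hp hq hr h₁' h₂'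

end EnhancedObj

/-- The functor `𝔸_{U, ε} : X_U ⥤ Ê`, `(x, σ) ↦ (A_x, ε_σ)`. -/
def enhancing {X : Type w} [TopologicalSpace X] {ι : Type*} (A : X → T) (U : ι → Opens X)
    (ε : ι → ℝ) (h : ∀ a, ∀ z ∈ U a, IsEnhanced (op (A z)) (ε a)) :
    CoverObj U ⥤ EnhancedObj op :=
  Monotone.functor (f := fun p => (⟨A p.pt, p.minEps ε, by
      obtain ⟨a, ha, hε⟩ := p.minEps_mem ε
      rw [hε]
      exact h a _ (p.mem a ha)⟩ : EnhancedObj op))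
    fun _ _ hpq => ⟨congrArg A hpq.1, CoverObj.minEps_mono ε hpq⟩

end FixedSpace

/-! ## Hilbert bundles -/

section Bundles

variable {X : Type w} [TopologicalSpace X] (E : X → Type u) [∀ x, NormedAddCommGroup (E x)]
  [∀ x, InnerProductSpace ℂ (E x)] (F : Type v) [NormedAddCommGroup F] [InnerProductSpace ℂ F]

/-- A locally trivial Hilbert bundle with fibers `E x` and with the model fiber `F`, given by an
atlas of local trivializations. A local trivialization over an open set `base i` is a family of
isometric isomorphisms `triv i x : E x → F`, of which only the ones with `x ∈ base i` matter. The
transition maps `(x, v) ↦ (x, t_j(x) t_i(x)⁻¹ v)` are required to be continuous. -/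
structure HilbertBundle where
  ι : Type w
  base : ι → Opens X
  cover : ∀ x, ∃ i, x ∈ base i
  triv : ι → ∀ x, E x ≃ₗᵢ[ℂ] F
  continuousOn_transition : ∀ i j,
    ContinuousOn (fun p : X × F => triv j p.1 ((triv i p.1).symm p.2))
      {p | p.1 ∈ base i ∧ p.1 ∈ base j}

variable {E F} (𝓗 : HilbertBundle E F)

/-- The bounded operators `T x` in the fibers depend continuously on `x ∈ S`, in the norm topology
after the identification of the fibers with `F` by any local trivialization. -/
def HilbertBundle.ContinuousFamilyOn (S : Set X) (T : ∀ x, E x →L[ℂ] E x) : Prop :=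
  ∀ i, ContinuousOn
    (fun x => (𝓗.triv i x : E x →L[ℂ] F) ∘L T x ∘L ((𝓗.triv i x).symm : F →L[ℂ] E x))
    (S ∩ 𝓗.base i)

/-- The category `Ŝ(ℍ)`: its objects are the finite dimensional subspaces of the fibers of `ℍ`.
There are no morphisms between subspaces of different fibers, and the morphisms between subspaces
of the same fiber are the same as before. -/
def SubspaceBundle (_ : HilbertBundle E F) : Type (max w u) := Σ x, FinSub (E x)

instance : Category (SubspaceBundle 𝓗) := inferInstanceAs (Category (Σ x, FinSub (E x)))

/-- The inclusion into `Ŝ(ℍ)` of the category of finite dimensional subspaces of the fiber over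
`x`. -/
def SubspaceBundle.fiber (x : X) : FinSub (E x) ⥤ SubspaceBundle 𝓗 :=
  Sigma.incl (C := fun x => FinSub (E x)) x

/-- The topology on the set of objects of `Ŝ(ℍ)`, glued from the products of open subsets of `X` and
the space of subspaces of `F` by means of local trivializations. -/
instance : TopologicalSpace (SubspaceBundle 𝓗) :=
  ⨆ i : 𝓗.ι, TopologicalSpace.coinduced
    (fun p : 𝓗.base i × FinSub F =>
      (SubspaceBundle.fiber 𝓗 p.1).obj ((FinSub.mapIso (𝓗.triv i p.1).symm).obj p.2))
    inferInstance

/-- The topology on the set of morphisms of `Ŝ(ℍ)`, glued in the same way. -/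
instance : TopologicalSpace (Arrow (SubspaceBundle 𝓗)) :=
  ⨆ i : 𝓗.ι, TopologicalSpace.coinduced
    (fun p : 𝓗.base i × Arrow (FinSub F) =>
      (SubspaceBundle.fiber 𝓗 p.1).mapArrow.obj
        ((FinSub.mapIso (𝓗.triv i p.1).symm).mapArrow.obj p.2))
    inferInstance

section SelfAdjoint

variable [∀ x, CompleteSpace (E x)] (A : ∀ x, E x →ₗ.[ℂ] E x)

/-- The number `ε` is adapted to the family `A` over `S`: for every `x ∈ S` the pair `(A x, ε)` is
an enhanced operator, the subspaces `V x = Im P_{[-ε, ε]}(A x)` depend continuously on `x ∈ S`,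
and the operators `V x → V x` induced by `A x` (or, what is the same, the operators
`A x ∘ P_{[-ε, ε]}(A x)`) depend continuously on `x ∈ S`. -/
structure IsAdaptedOn (S : Set X) (ε : ℝ) : Prop where
  isEnhanced : ∀ x ∈ S, IsEnhanced (A x) ε
  continuous_subspace : 𝓗.ContinuousFamilyOn S fun x => specProj (A x) (-ε) ε
  continuous_operator : ∃ T : ∀ x, E x →L[ℂ] E x, 𝓗.ContinuousFamilyOn S T ∧
    ∀ x ∈ S, ∀ v, ∃ h : specProj (A x) (-ε) ε v ∈ (A x).domain,
      T x v = A x ⟨specProj (A x) (-ε) ε v, h⟩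

/-- A Fredholm family of self-adjoint operators in the fibers of a Hilbert bundle. -/
structure IsFredholmFamily : Prop where
  isSelfAdjoint : ∀ x, IsSelfAdjoint (A x)
  isFredholm : ∀ x, IsFredholm (A x).toFun
  exists_adapted : ∀ x, ∃ ε : ℝ, ∃ U : Opens X, x ∈ U ∧ IsAdaptedOn 𝓗 A U ε

variable {A}

/-- The morphism `Im P_{[-ε, ε]}(A x) ⟶ Im P_{[-ε', ε']}(A y)` of `Ŝ(ℍ)` for `x = y` and
`ε ≤ ε'`. -/
def indexHom (hsa : ∀ x, IsSelfAdjoint (A x)) {x y : X} (hxy : x = y) {ε ε' : ℝ}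
    (h : IsEnhanced (A x) ε) (h' : IsEnhanced (A y) ε') (hle : ε ≤ ε') :
    (SubspaceBundle.fiber 𝓗 x).obj (specObj (A x) (hsa x) h) ⟶
      (SubspaceBundle.fiber 𝓗 y).obj (specObj (A y) (hsa y) h') :=
  match y, hxy, h' with
  | _, rfl, h' => (SubspaceBundle.fiber 𝓗 x).map (specHom (A x) (hsa x) h h' hle)

lemma indexHom_trans (hsa : ∀ x, IsSelfAdjoint (A x)) {x y z : X} (hxy : x = y) (hyz : y = z)
    {ε ε' ε'' : ℝ} (h : IsEnhanced (A x) ε) (h' : IsEnhanced (A y) ε') (h'' : IsEnhanced (A z) ε'')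
    (hle : ε ≤ ε') (hle' : ε' ≤ ε'') :
    indexHom 𝓗 hsa (hxy.trans hyz) h h'' (hle.trans hle') =
      indexHom 𝓗 hsa hxy h h' hle ≫ indexHom 𝓗 hsa hyz h' h'' hle' := by
  subst hxy hyz
  exact (congrArg (SubspaceBundle.fiber 𝓗 x).map
    (specHom_trans _ (hsa x) h h' h'' hle hle')).trans ((SubspaceBundle.fiber 𝓗 x).map_comp _ _)

/-- The index functor `𝔸_{U, ε} : X_U ⥤ Ŝ(ℍ)`, `(x, σ) ↦ Im P_{[-ε_σ, ε_σ]}(A_x)`. -/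
def indexFunctor (hsa : ∀ x, IsSelfAdjoint (A x)) {ι : Type*} (U : ι → Opens X) (ε : ι → ℝ)
    (h : ∀ a, ∀ x ∈ U a, IsEnhanced (A x) (ε a)) : CoverObj U ⥤ SubspaceBundle 𝓗 :=
  have hη : ∀ p : CoverObj U, IsEnhanced (A p.pt) (p.minEps ε) := fun p => by
    obtain ⟨a, ha, hε⟩ := p.minEps_mem ε
    rw [hε]
    exact h a _ (p.mem a ha)
  { obj := fun p => (SubspaceBundle.fiber 𝓗 p.pt).obj (specObj (A p.pt) (hsa p.pt) (hη p))
    map := fun {p q} f => indexHom 𝓗 hsa (leOfHom f).1 (hη p) (hη q)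
      (CoverObj.minEps_mono ε (leOfHom f))
    map_id := fun p => (congrArg (SubspaceBundle.fiber 𝓗 p.pt).map
      (specHom_refl _ (hsa p.pt) (hη p))).trans ((SubspaceBundle.fiber 𝓗 p.pt).map_id _)
    map_comp := fun {p q r} f g => by
      have hf := CoverObj.minEps_mono ε (leOfHom f)
      have hg := CoverObj.minEps_mono ε (leOfHom g)
      have h₁ := (leOfHom f).1
      have h₂ := (leOfHom g).1
      have hp := hη p
      have hq := hη q
      have hr := hη r
      change indexHom 𝓗 hsa (h₁.trans h₂) hp hr (hf.trans hg) =
        indexHom 𝓗 hsa h₁ hp hq hf ≫ indexHom 𝓗 hsa h₂ hq hr hg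
      exact indexHom_trans 𝓗 hsa h₁ h₂ hp hq hr hf hg }

end SelfAdjoint

end Bundles

/-! ## General bounded Fredholm operators -/

section Pairs

variable {H : Type u} [NormedAddCommGroup H] [InnerProductSpace ℂ H]

variable (H) in
/-- Pairs of finite dimensional subspaces of `H`; these are the objects of the category `S`. -/
@[ext] structure PairSub where
  fst : FinSub H
  snd : FinSub H

instance : TopologicalSpace (PairSub H) :=
  TopologicalSpace.induced (fun V => (V.fst, V.snd)) inferInstance

/-- Morphisms `(E₁, E₂) ⟶ (E₁', E₂')` of `S` are pairs of subspaces `(F₁, F₂)` such that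
`E₁ ⊕ F₁ = E₁'` and `E₂ ⊕ F₂ = E₂'` (orthogonal sums) together with an isometry `F₁ → F₂` (onto).
The isometry is recorded as its extension `u : H → H` by zero to the orthogonal complement
of `F₁`. -/
@[ext] structure PairSub.Hom (V V' : PairSub H) where
  fst : FinSub H
  snd : FinSub H
  u : H →L[ℂ] H
  fst_ortho : V.fst.carrier ⟂ fst.carrier
  snd_ortho : V.snd.carrier ⟂ snd.carrier
  fst_sup : V.fst.carrier ⊔ fst.carrier = V'.fst.carrier
  snd_sup : V.snd.carrier ⊔ snd.carrier = V'.snd.carrier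
  norm_u : ∀ x ∈ fst.carrier, ‖u x‖ = ‖x‖
  map_u : fst.carrier.map (u : H →ₗ[ℂ] H) = snd.carrier
  u_eq_zero : ∀ x ∈ fst.carrierᗮ, u x = 0

lemma PairSub.Hom.fst_le {V V' : PairSub H} (f : PairSub.Hom V V') :
    f.fst.carrier ≤ V'.fst.carrier := f.fst_sup ▸ le_sup_right

lemma PairSub.Hom.snd_le {V V' : PairSub H} (f : PairSub.Hom V V') :
    f.snd.carrier ≤ V'.snd.carrier := f.snd_sup ▸ le_sup_right

lemma PairSub.Hom.src_fst_le {V V' : PairSub H} (f : PairSub.Hom V V') :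
    V.fst.carrier ≤ V'.fst.carrier := f.fst_sup ▸ le_sup_left

lemma PairSub.Hom.src_snd_le {V V' : PairSub H} (f : PairSub.Hom V V') :
    V.snd.carrier ≤ V'.snd.carrier := f.snd_sup ▸ le_sup_left

lemma PairSub.Hom.u_mem {V V' : PairSub H} (f : PairSub.Hom V V') {x : H}
    (hx : x ∈ f.fst.carrier) : f.u x ∈ f.snd.carrier :=
  f.map_u ▸ Submodule.mem_map_of_mem (f := (f.u : H →ₗ[ℂ] H)) hx

/-- The composition of morphisms of `S`: the direct sums of the corresponding subspaces and of the
isometries. -/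
def PairSub.Hom.comp {V V' V'' : PairSub H} (f : PairSub.Hom V V') (g : PairSub.Hom V' V'') :
    PairSub.Hom V V'' :=
  have h₁ : f.fst.carrier ⟂ g.fst.carrier := g.fst_ortho.mono_left f.fst_le
  have h₂ : f.snd.carrier ⟂ g.snd.carrier := g.snd_ortho.mono_left f.snd_le
  have hf : ∀ y ∈ g.fst.carrier, f.u y = 0 := fun y hy => f.u_eq_zero y (h₁.symm hy)
  have hg : ∀ x ∈ f.fst.carrier, g.u x = 0 := fun x hx => g.u_eq_zero x (h₁ hx)
  { fst := f.fst.add g.fst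
    snd := f.snd.add g.snd
    u := f.u + g.u
    fst_ortho := Submodule.isOrtho_sup_right.2 ⟨f.fst_ortho, g.fst_ortho.mono_left f.src_fst_le⟩
    snd_ortho := Submodule.isOrtho_sup_right.2 ⟨f.snd_ortho, g.snd_ortho.mono_left f.src_snd_le⟩
    fst_sup := by rw [← g.fst_sup, ← f.fst_sup, sup_assoc]; rfl
    snd_sup := by rw [← g.snd_sup, ← f.snd_sup, sup_assoc]; rfl
    norm_u := by
      intro z hz
      obtain ⟨x, hx, y, hy, rfl⟩ := Submodule.mem_sup.1 hz
      have e : (f.u + g.u) (x + y) = f.u x + g.u y := by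
        simp [hf y hy, hg x hx]
      have o₁ : inner ℂ x y = 0 := Submodule.isOrtho_iff_inner_eq.1 h₁ x hx y hy
      have o₂ : inner ℂ (f.u x) (g.u y) = 0 :=
        Submodule.isOrtho_iff_inner_eq.1 h₂ _ (f.u_mem hx) _ (g.u_mem hy)
      have n₁ := norm_add_sq_eq_norm_sq_add_norm_sq_of_inner_eq_zero _ _ o₁
      have n₂ := norm_add_sq_eq_norm_sq_add_norm_sq_of_inner_eq_zero _ _ o₂
      rw [f.norm_u x hx, g.norm_u y hy, ← n₁] at n₂
      rw [e]
      exact (mul_self_inj (norm_nonneg _) (norm_nonneg _)).1 n₂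
    map_u := by
      have e₁ : f.fst.carrier.map ((f.u + g.u : H →L[ℂ] H) : H →ₗ[ℂ] H) = f.snd.carrier := by
        rw [← f.map_u]
        ext z
        simp only [Submodule.mem_map]
        refine exists_congr fun x => and_congr_right fun hx => ?_
        simp [hg x hx]
      have e₂ : g.fst.carrier.map ((f.u + g.u : H →L[ℂ] H) : H →ₗ[ℂ] H) = g.snd.carrier := by
        rw [← g.map_u]
        ext z
        simp only [Submodule.mem_map]
        refine exists_congr fun x => and_congr_right fun hx => ?_
        simp [hf x hx]
      change (f.fst.carrier ⊔ g.fst.carrier).map _ = f.snd.carrier ⊔ g.snd.carrier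
      rw [Submodule.map_sup, e₁, e₂]
    u_eq_zero := fun x hx => by
      have h₁ := f.u_eq_zero x (Submodule.orthogonal_le (le_sup_left : _ ≤ (f.fst.add g.fst).carrier) hx)
      have h₂ := g.u_eq_zero x (Submodule.orthogonal_le (le_sup_right : _ ≤ (f.fst.add g.fst).carrier) hx)
      simp [h₁, h₂] }

/-- The category `S`. -/
instance : Category (PairSub H) where
  Hom := PairSub.Hom
  id V :=
    { fst := .zero
      snd := .zero
      u := 0
      fst_ortho := Submodule.isOrtho_bot_right
      snd_ortho := Submodule.isOrtho_bot_right
      fst_sup := sup_bot_eq _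
      snd_sup := sup_bot_eq _
      norm_u := fun x hx => by
        rw [(Submodule.mem_bot ℂ).1 hx]
        simp
      map_u := Submodule.map_bot _
      u_eq_zero := fun _ _ => rfl }
  comp f g := PairSub.Hom.comp f g
  id_comp f := PairSub.Hom.ext (FinSub.ext (bot_sup_eq _)) (FinSub.ext (bot_sup_eq _)) (zero_add _)
  comp_id f := PairSub.Hom.ext (FinSub.ext (sup_bot_eq _)) (FinSub.ext (sup_bot_eq _)) (add_zero _)
  assoc f g h := PairSub.Hom.ext (FinSub.ext (sup_assoc _ _ _)) (FinSub.ext (sup_assoc _ _ _))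
    (add_assoc _ _ _)

/-- The topology on the morphisms of `S`: the source, the target, the two subspaces and the
isometry depend continuously on a morphism. -/
instance : TopologicalSpace (Arrow (PairSub H)) :=
  TopologicalSpace.induced
    (fun f => ((f.left, f.right),
      (PairSub.Hom.fst f.hom, PairSub.Hom.snd f.hom, PairSub.Hom.u f.hom))) inferInstance

/-- The functor on pairs of finite dimensional subspaces induced by an isometric isomorphism. -/
def PairSub.mapIso {K : Type v} [NormedAddCommGroup K] [InnerProductSpace ℂ K]
    (e : H ≃ₗᵢ[ℂ] K) : PairSub H ⥤ PairSub K where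
  obj V := ⟨V.fst.mapObj e, V.snd.mapObj e⟩
  map {V V'} f :=
    { fst := (PairSub.Hom.fst f).mapObj e
      snd := (PairSub.Hom.snd f).mapObj e
      u := (e : H →L[ℂ] K) ∘L PairSub.Hom.u f ∘L (e.symm : K →L[ℂ] H)
      fst_ortho := isOrtho_map_isometry e (PairSub.Hom.fst_ortho f)
      snd_ortho := isOrtho_map_isometry e (PairSub.Hom.snd_ortho f)
      fst_sup := by
        simp only [FinSub.mapObj, ← Submodule.map_sup]
        rw [PairSub.Hom.fst_sup f]
      snd_sup := by
        simp only [FinSub.mapObj, ← Submodule.map_sup]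
        rw [PairSub.Hom.snd_sup f]
      norm_u := by
        rintro _ ⟨x, hx, rfl⟩
        have := PairSub.Hom.norm_u f x hx
        simpa using this
      map_u := by
        have h := PairSub.Hom.map_u f
        ext z
        simp only [FinSub.mapObj, ← h, Submodule.mem_map]
        constructor
        · rintro ⟨_, ⟨x, hx, rfl⟩, rfl⟩
          exact ⟨_, ⟨x, hx, rfl⟩, by simp⟩
        · rintro ⟨_, ⟨x, hx, rfl⟩, rfl⟩
          exact ⟨_, ⟨x, hx, rfl⟩, by simp⟩
      u_eq_zero := fun y hy => by
        have : PairSub.Hom.u f (e.symm y) = 0 := by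
          refine PairSub.Hom.u_eq_zero f _ ((Submodule.mem_orthogonal _ _).2 fun x hx => ?_)
          have := (Submodule.mem_orthogonal _ _).1 hy (e x) ⟨x, hx, rfl⟩
          rw [← this, ← e.inner_map_map]
          simp
        simp [this] }
  map_id V := PairSub.Hom.ext (FinSub.ext (Submodule.map_bot _)) (FinSub.ext (Submodule.map_bot _))
    (by
      change (e : H →L[ℂ] K) ∘L (0 : H →L[ℂ] H) ∘L (e.symm : K →L[ℂ] H) = 0
      simp)
  map_comp f g := PairSub.Hom.ext (FinSub.ext (Submodule.map_sup _ _ _))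
    (FinSub.ext (Submodule.map_sup _ _ _))
    (by
      change (e : H →L[ℂ] K) ∘L (PairSub.Hom.u f + PairSub.Hom.u g) ∘L (e.symm : K →L[ℂ] H) =
        (e : H →L[ℂ] K) ∘L PairSub.Hom.u f ∘L (e.symm : K →L[ℂ] H) +
          (e : H →L[ℂ] K) ∘L PairSub.Hom.u g ∘L (e.symm : K →L[ℂ] H)
      simp)

end Pairs

section AbsoluteValue

variable {H : Type u} [NormedAddCommGroup H] [InnerProductSpace ℂ H] [CompleteSpace H]

open ContinuousLinearMap (adjoint)

/-- The operator `|B| = (B* B)^{1/2}`. -/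
def absOp (B : H →L[ℂ] H) : H →ₗ.[ℂ] H := ofBounded (CFC.abs B)

/-- `(B, ε)` is an enhanced Fredholm operator: `B` is Fredholm, `ε > 0`, the interval `[0, ε]` is
disjoint from the essential spectrum of `|B|`, and `ε` does not belong to the spectrum
of `|B|`. -/
structure IsEnhancedFredholm (B : H →L[ℂ] H) (ε : ℝ) : Prop where
  isFredholm : B.IsFredholm
  pos : 0 < ε
  notMem : (ε : ℂ) ∉ opSpectrum (absOp B)
  notMem_ess : ∀ μ ∈ Set.Icc 0 ε, (μ : ℂ) ∉ essSpectrum (absOp B)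

lemma isSelfAdjoint_absOp (B : H →L[ℂ] H) : IsSelfAdjoint (absOp B) :=
  isSelfAdjoint_ofBounded (CFC.abs_nonneg B).isSelfAdjoint

lemma mem_eig_absOp {B : H →L[ℂ] H} {μ : ℝ} {v : H} :
    v ∈ eig (absOp B) μ ↔ CFC.abs B v = (μ : ℂ) • v := by
  rw [mem_eig]
  exact ⟨fun ⟨_, h⟩ => h, fun h => ⟨trivial, h⟩⟩

lemma abs_abs_apply (B : H →L[ℂ] H) (v : H) : CFC.abs B (CFC.abs B v) = adjoint B (B v) := by
  have h := congrArg (fun T : H →L[ℂ] H => T v) (CFC.abs_mul_abs B)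
  simpa [ContinuousLinearMap.star_eq_adjoint] using h

lemma inner_abs_left (B : H →L[ℂ] H) (v w : H) :
    inner ℂ (CFC.abs B v) w = inner ℂ v (CFC.abs B w) := by
  have h : adjoint (CFC.abs B) = CFC.abs B :=
    ContinuousLinearMap.isSelfAdjoint_iff'.1 (CFC.abs_nonneg B).isSelfAdjoint
  conv_lhs => rw [← h]
  exact ContinuousLinearMap.adjoint_inner_left _ _ _

lemma norm_abs_apply (B : H →L[ℂ] H) (v : H) : ‖CFC.abs B v‖ = ‖B v‖ := by
  have h : inner ℂ (CFC.abs B v) (CFC.abs B v) = inner ℂ (B v) (B v) := by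
    rw [inner_abs_left, abs_abs_apply, ContinuousLinearMap.adjoint_inner_right]
  rw [inner_self_eq_norm_sq_to_K, inner_self_eq_norm_sq_to_K] at h
  have h' : ‖CFC.abs B v‖ ^ 2 = ‖B v‖ ^ 2 := by exact_mod_cast h
  exact (sq_eq_sq₀ (norm_nonneg _) (norm_nonneg _)).1 h'

lemma mem_eig_absOp_iff {B : H →L[ℂ] H} {μ : ℝ} (hμ : 0 < μ) {v : H} :
    v ∈ eig (absOp B) μ ↔ adjoint B (B v) = ((μ : ℂ) * μ) • v := by
  rw [mem_eig_absOp]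
  constructor
  · intro h
    rw [← abs_abs_apply, h, map_smul, h, smul_smul]
  · intro h
    set w := CFC.abs B v - (μ : ℂ) • v with hw
    have h1 : CFC.abs B w = -((μ : ℂ) • w) := by
      rw [hw, map_sub, map_smul, abs_abs_apply, h, smul_sub, smul_smul]
      abel
    have h2 : 0 ≤ RCLike.re (inner ℂ (CFC.abs B w) w) := by
      have := (ContinuousLinearMap.nonneg_iff_isPositive _).1 (CFC.abs_nonneg B)
      exact this.re_inner_nonneg_left w
    have h3 : RCLike.re (inner ℂ w w) = ‖w‖ ^ 2 := inner_self_eq_norm_sq w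
    rw [h1, inner_neg_left, inner_smul_left, Complex.conj_ofReal] at h2
    change 0 ≤ (-((μ : ℂ) * inner ℂ w w)).re at h2
    change (inner ℂ w w).re = _ at h3
    rw [Complex.neg_re, Complex.re_ofReal_mul, h3] at h2
    have h4 : ‖w‖ ^ 2 = 0 := by nlinarith [sq_nonneg ‖w‖]
    have h5 : w = 0 := by simpa using h4
    exact sub_eq_zero.1 h5

lemma map_eig_absOp {B : H →L[ℂ] H} {μ : ℝ} (hμ : 0 < μ) :
    (eig (absOp B) μ).map (B : H →ₗ[ℂ] H) = eig (absOp (adjoint B)) μ := by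
  have hμ' : (μ : ℂ) * μ ≠ 0 := by
    simp [hμ.ne']
  ext w
  rw [mem_eig_absOp_iff hμ, ContinuousLinearMap.adjoint_adjoint]
  constructor
  · rintro ⟨v, hv, rfl⟩
    have := (mem_eig_absOp_iff hμ).1 hv
    simp [this]
  · intro hw
    refine ⟨((μ : ℂ) * μ)⁻¹ • adjoint B w, ?_, ?_⟩
    · refine Submodule.smul_mem _ _ ((mem_eig_absOp_iff hμ).2 ?_)
      rw [hw, map_smul]
    · simp only [ContinuousLinearMap.coe_coe, map_smul, hw, smul_smul]
      rw [inv_mul_cancel₀ hμ', one_smul]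

lemma map_specSub_absOp {B : H →L[ℂ] H} {a b : ℝ} (ha : 0 < a) :
    (specSub (absOp B) a b).map (B : H →ₗ[ℂ] H) = specSub (absOp (adjoint B)) a b := by
  simp only [specSub, Submodule.map_iSup]
  exact biSup_congr fun μ hμ => map_eig_absOp (ha.trans_le hμ.1)

namespace IsEnhancedFredholm

variable {B : H →L[ℂ] H} {ε ε' ε'' : ℝ}

lemma finite_fst (h : IsEnhancedFredholm B ε) : FiniteDimensional ℂ (specSub (absOp B) 0 ε) :=
  finite_specSub (formalAdjoint_of_isSelfAdjoint (isSelfAdjoint_absOp B))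
    (isSelfAdjoint_absOp B).isClosed h.notMem_ess

lemma finite_snd (h : IsEnhancedFredholm B ε) :
    FiniteDimensional ℂ (specSub (absOp (adjoint B)) 0 ε) := by
  have h1 := h.finite_fst
  have h2 : FiniteDimensional ℂ (LinearMap.range (B : H →ₗ[ℂ] H))ᗮ := by
    have h3 : Module.Finite ℂ (H ⧸ LinearMap.range (B : H →ₗ[ℂ] H)) := h.isFredholm.finite_coker
    refine Module.Finite.of_injective
      ((LinearMap.range (B : H →ₗ[ℂ] H)).mkQ ∘ₗ (LinearMap.range (B : H →ₗ[ℂ] H))ᗮ.subtype) ?_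
    rw [← LinearMap.ker_eq_bot, LinearMap.ker_comp, Submodule.ker_mkQ]
    rw [eq_bot_iff]
    rintro ⟨x, hx⟩ hx'
    have : x ∈ LinearMap.range (B : H →ₗ[ℂ] H) ⊓ (LinearMap.range (B : H →ₗ[ℂ] H))ᗮ := ⟨hx', hx⟩
    rw [Submodule.inf_orthogonal_eq_bot] at this
    exact Subtype.ext ((Submodule.mem_bot ℂ).1 this)
  have hle : specSub (absOp (adjoint B)) 0 ε ≤ (LinearMap.range (B : H →ₗ[ℂ] H))ᗮ ⊔
      (specSub (absOp B) 0 ε).map (B : H →ₗ[ℂ] H) := by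
    refine iSup₂_le fun μ hμ => ?_
    rcases hμ.1.eq_or_lt with h0 | h0
    · refine le_sup_of_le_left fun w hw => ?_
      subst h0
      rw [mem_eig_absOp] at hw
      have h5 : adjoint B w = 0 := by
        rw [← norm_eq_zero, ← norm_abs_apply, hw]
        simp
      rw [Submodule.mem_orthogonal]
      rintro _ ⟨x, rfl⟩
      change inner ℂ (B x) w = 0
      rw [← ContinuousLinearMap.adjoint_inner_right, h5, inner_zero_right]
    · rw [← map_eig_absOp h0]
      exact le_sup_of_le_right (Submodule.map_mono (eig_le_specSub hμ))
  exact Submodule.finiteDimensional_of_le hle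

/-- The object `(Im P_{[0, ε]}(|B|), Im P_{[0, ε]}(|B*|))` of `S`. -/
def obj (h : IsEnhancedFredholm B ε) : PairSub H :=
  ⟨⟨specSub (absOp B) 0 ε, h.finite_fst⟩, ⟨specSub (absOp (adjoint B)) 0 ε, h.finite_snd⟩⟩

/-- The subspace `Im P_{[ε, ε']}(|B|)`. -/
def diffFst (h : IsEnhancedFredholm B ε) (h' : IsEnhancedFredholm B ε') : FinSub H :=
  ⟨specSub (absOp B) ε ε',
    have := h'.finite_fst
    Submodule.finiteDimensional_of_le (specSub_mono (Set.Icc_subset_Icc_left h.pos.le))⟩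

/-- The subspace `Im P_{[ε, ε']}(|B*|)`. -/
def diffSnd (h : IsEnhancedFredholm B ε) (h' : IsEnhancedFredholm B ε') : FinSub H :=
  ⟨specSub (absOp (adjoint B)) ε ε',
    have := h'.finite_snd
    Submodule.finiteDimensional_of_le (specSub_mono (Set.Icc_subset_Icc_left h.pos.le))⟩

end IsEnhancedFredholm

/-- Let `V` be a finite dimensional subspace such that `|B|` induces an invertible operator
`V → V`, and let `B = U |B|` be the polar decomposition of `B`. Then this is the operator which is
equal to `U = B |B|⁻¹` on `V` and to zero on the orthogonal complement of `V`. -/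
def polarPart (B : H →L[ℂ] H) (V : FinSub H) : H →L[ℂ] H :=
  B ∘L V.carrier.subtypeL ∘L
    Ring.inverse (V.carrier.orthogonalProjectionOnto ∘L CFC.abs B ∘L V.carrier.subtypeL) ∘L
      V.carrier.orthogonalProjectionOnto

lemma polarPart_eq_zero (B : H →L[ℂ] H) (V : FinSub H) {x : H} (hx : x ∈ V.carrierᗮ) :
    polarPart B V x = 0 := by
  have : V.carrier.orthogonalProjectionOnto x = 0 :=
    Submodule.orthogonalProjectionOnto_apply_of_mem_orthogonal hx
  simp [polarPart, this]

lemma polarPart_apply {B : H →L[ℂ] H} {V : FinSub H}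
    (hV : ∀ v ∈ V.carrier, CFC.abs B v ∈ V.carrier)
    (hinj : ∀ v ∈ V.carrier, CFC.abs B v = 0 → v = 0) :
    (∀ v ∈ V.carrier, polarPart B V (CFC.abs B v) = B v) ∧
      ∀ x ∈ V.carrier, ∃ v ∈ V.carrier, CFC.abs B v = x := by
  set R : V.carrier →L[ℂ] V.carrier :=
    V.carrier.orthogonalProjectionOnto ∘L CFC.abs B ∘L V.carrier.subtypeL with hR
  have hRv : ∀ v : V.carrier, ((R v : V.carrier) : H) = CFC.abs B v := fun v => by
    simp only [hR, ContinuousLinearMap.comp_apply, Submodule.subtypeL_apply]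
    exact Submodule.starProjection_eq_self_iff.2 (hV v v.2)
  have hRinj : Function.Injective (R : V.carrier →ₗ[ℂ] V.carrier) := by
    rw [← LinearMap.ker_eq_bot, eq_bot_iff]
    intro v hv
    have : CFC.abs B (v : H) = 0 := by
      rw [← hRv]
      exact congrArg Subtype.val hv
    exact Subtype.ext (hinj v v.2 this)
  have hRsurj : Function.Surjective (R : V.carrier →ₗ[ℂ] V.carrier) :=
    LinearMap.injective_iff_surjective.1 hRinj
  have hunit : IsUnit R := ContinuousLinearMap.isUnit_iff_bijective.2 ⟨hRinj, hRsurj⟩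
  refine ⟨fun v hv => ?_, fun x hx => ?_⟩
  · have h1 : V.carrier.orthogonalProjectionOnto (CFC.abs B v) = R ⟨v, hv⟩ := rfl
    have h2 : (Ring.inverse R) (R ⟨v, hv⟩) = ⟨v, hv⟩ := by
      have := congrArg (fun T : V.carrier →L[ℂ] V.carrier => T ⟨v, hv⟩)
        (Ring.inverse_mul_cancel R hunit)
      simpa using this
    simp only [polarPart, ContinuousLinearMap.comp_apply, h1, ← hR, h2, Submodule.subtypeL_apply]
  · obtain ⟨v, hv⟩ := hRsurj ⟨x, hx⟩
    exact ⟨v, v.2, by rw [← hRv]; exact congrArg Subtype.val hv⟩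

namespace IsEnhancedFredholm

variable {B : H →L[ℂ] H} {ε ε' ε'' : ℝ}

lemma polarPart_diffFst (h : IsEnhancedFredholm B ε) (h' : IsEnhancedFredholm B ε') :
    (∀ v ∈ (h.diffFst h').carrier,
        CFC.abs B v ∈ (h.diffFst h').carrier ∧
          polarPart B (h.diffFst h') (CFC.abs B v) = B v) ∧
      ∀ x ∈ (h.diffFst h').carrier, ∃ v ∈ (h.diffFst h').carrier, CFC.abs B v = x := by
  have hV : ∀ v ∈ (h.diffFst h').carrier, CFC.abs B v ∈ (h.diffFst h').carrier := by
    intro v hv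
    change v ∈ specSub (absOp B) ε ε' at hv
    have hle : specSub (absOp B) ε ε' ≤
        (specSub (absOp B) ε ε').comap (CFC.abs B : H →L[ℂ] H).toLinearMap := by
      refine iSup₂_le fun μ hμ w hw => ?_
      have h1 := mem_eig_absOp.1 hw
      change CFC.abs B w ∈ specSub (absOp B) ε ε'
      rw [h1]
      exact Submodule.smul_mem _ _ (eig_le_specSub hμ hw)
    exact hle hv
  have hinj : ∀ v ∈ (h.diffFst h').carrier, CFC.abs B v = 0 → v = 0 := by
    intro v hv hv0
    have h0 : v ∈ eig (absOp B) 0 := mem_eig_absOp.2 (by simp [hv0])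
    have ho : eig (absOp B) 0 ⟂ specSub (absOp B) ε ε' := by
      simp only [specSub, Submodule.isOrtho_iSup_right]
      exact fun μ hμ => eig_isOrtho
        (formalAdjoint_of_isSelfAdjoint (isSelfAdjoint_absOp B)) (h.pos.trans_le hμ.1).ne
    exact inner_self_eq_zero.1 (Submodule.isOrtho_iff_inner_eq.1 ho v h0 v hv)
  have := polarPart_apply hV hinj
  exact ⟨fun v hv => ⟨hV v hv, this.1 v hv⟩, this.2⟩

lemma eig_adjoint_eq_bot (h : IsEnhancedFredholm B ε) : eig (absOp (adjoint B)) ε = ⊥ := by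
  rw [← map_eig_absOp h.pos, eig_eq_bot h.notMem, Submodule.map_bot]

/-- The morphism of `S` corresponding to `(B, ε) ≤ (B, ε')`: the pair of subspaces
`Im P_{[ε, ε']}(|B|)`, `Im P_{[ε, ε']}(|B*|)` together with the isometry between them induced by
the partial isometry `U` from the polar decomposition `B = U |B|`. -/
def hom (h : IsEnhancedFredholm B ε) (h' : IsEnhancedFredholm B ε') (hle : ε ≤ ε') :
    h.obj ⟶ h'.obj :=
  PairSub.Hom.mk (h.diffFst h') (h.diffSnd h') (polarPart B (h.diffFst h'))
    (specSub_isOrtho (formalAdjoint_of_isSelfAdjoint (isSelfAdjoint_absOp B)) le_rfl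
      (eig_eq_bot h.notMem))
    (specSub_isOrtho (formalAdjoint_of_isSelfAdjoint (isSelfAdjoint_absOp (adjoint B))) le_rfl
      h.eig_adjoint_eq_bot)
    (specSub_sup h.pos.le hle)
    (specSub_sup h.pos.le hle)
    (fun x hx => by
      obtain ⟨v, hv, rfl⟩ := (h.polarPart_diffFst h').2 x hx
      rw [((h.polarPart_diffFst h').1 v hv).2, norm_abs_apply])
    (by
      change _ = specSub (absOp (adjoint B)) ε ε'
      rw [← map_specSub_absOp h.pos]
      ext z
      constructor
      · rintro ⟨x, hx, rfl⟩
        obtain ⟨v, hv, rfl⟩ := (h.polarPart_diffFst h').2 x hx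
        exact ⟨v, hv, ((h.polarPart_diffFst h').1 v hv).2.symm⟩
      · rintro ⟨v, hv, rfl⟩
        exact ⟨_, ((h.polarPart_diffFst h').1 v hv).1, ((h.polarPart_diffFst h').1 v hv).2⟩)
    (fun _ hx => polarPart_eq_zero _ _ hx)

lemma hom_refl (h : IsEnhancedFredholm B ε) : h.hom h le_rfl = 𝟙 h.obj := by
  refine PairSub.Hom.ext (FinSub.ext (specSub_self h.notMem)) (FinSub.ext ?_) ?_
  · change specSub (absOp (adjoint B)) ε ε = ⊥
    simp [specSub, Set.Icc_self, h.eig_adjoint_eq_bot]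
  · change polarPart B (h.diffFst h) = 0
    ext x
    refine polarPart_eq_zero _ _ ?_
    change x ∈ (specSub (absOp B) ε ε)ᗮ
    rw [specSub_self h.notMem, Submodule.bot_orthogonal_eq_top]
    trivial

lemma hom_trans (h : IsEnhancedFredholm B ε) (h' : IsEnhancedFredholm B ε')
    (h'' : IsEnhancedFredholm B ε'') (hle : ε ≤ ε') (hle' : ε' ≤ ε'') :
    h.hom h'' (hle.trans hle') = h.hom h' hle ≫ h'.hom h'' hle' := by
  refine PairSub.Hom.ext (FinSub.ext (specSub_sup hle hle').symm)
    (FinSub.ext (specSub_sup hle hle').symm) ?_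
  change polarPart B (h.diffFst h'') = polarPart B (h.diffFst h') + polarPart B (h'.diffFst h'')
  have hs : (h.diffFst h'').carrier = (h.diffFst h').carrier ⊔ (h'.diffFst h'').carrier :=
    (specSub_sup hle hle').symm
  have ho : (h.diffFst h').carrier ⟂ (h'.diffFst h'').carrier :=
    specSub_isOrtho (formalAdjoint_of_isSelfAdjoint (isSelfAdjoint_absOp B)) le_rfl
      (eig_eq_bot h'.notMem)
  have e₁ : ∀ x ∈ (h.diffFst h').carrier, polarPart B (h.diffFst h'') x =
      (polarPart B (h.diffFst h') + polarPart B (h'.diffFst h'')) x := by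
    intro x hx
    rw [add_apply, polarPart_eq_zero B (h'.diffFst h'') (ho hx), add_zero]
    obtain ⟨v, hv, rfl⟩ := (h.polarPart_diffFst h').2 x hx
    have hv' : v ∈ (h.diffFst h'').carrier := hs ▸ Submodule.mem_sup_left hv
    rw [((h.polarPart_diffFst h').1 v hv).2, ((h.polarPart_diffFst h'').1 v hv').2]
  have e₂ : ∀ x ∈ (h'.diffFst h'').carrier, polarPart B (h.diffFst h'') x =
      (polarPart B (h.diffFst h') + polarPart B (h'.diffFst h'')) x := by
    intro x hx
    rw [add_apply, polarPart_eq_zero B (h.diffFst h') (ho.symm hx), zero_add]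
    obtain ⟨v, hv, rfl⟩ := (h'.polarPart_diffFst h'').2 x hx
    have hv' : v ∈ (h.diffFst h'').carrier := hs ▸ Submodule.mem_sup_right hv
    rw [((h'.polarPart_diffFst h'').1 v hv).2, ((h.polarPart_diffFst h'').1 v hv').2]
  have e₃ : ∀ x ∈ (h.diffFst h'').carrierᗮ, polarPart B (h.diffFst h'') x =
      (polarPart B (h.diffFst h') + polarPart B (h'.diffFst h'')) x := by
    intro x hx
    have hx' := hx
    rw [hs, ← Submodule.inf_orthogonal] at hx'
    rw [add_apply, polarPart_eq_zero B _ hx, polarPart_eq_zero B _ hx'.1,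
      polarPart_eq_zero B _ hx'.2, add_zero]
  ext x
  have hx : x ∈ (h.diffFst h'').carrier ⊔ (h.diffFst h'').carrierᗮ := by
    rw [Submodule.sup_orthogonal_of_hasOrthogonalProjection]
    trivial
  obtain ⟨y, hy, z, hz, rfl⟩ := Submodule.mem_sup.1 hx
  rw [hs] at hy
  obtain ⟨y₁, hy₁, y₂, hy₂, rfl⟩ := Submodule.mem_sup.1 hy
  rw [map_add, map_add, map_add, map_add, e₁ _ hy₁, e₂ _ hy₂, e₃ _ hz]

end IsEnhancedFredholm

end AbsoluteValue

section PairBundles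

variable {X : Type w} [TopologicalSpace X] {E : X → Type u} [∀ x, NormedAddCommGroup (E x)]
  [∀ x, InnerProductSpace ℂ (E x)] {F : Type v} [NormedAddCommGroup F] [InnerProductSpace ℂ F]
  (𝓗 : HilbertBundle E F)

/-- The category `S(ℍ)`: its objects are the pairs of finite dimensional subspaces of the same fiber
of `ℍ`. There are no morphisms between pairs in different fibers, and the morphisms between pairs
in the same fiber are the same as before. -/
def PairBundle (_ : HilbertBundle E F) : Type (max w u) := Σ x, PairSub (E x)

instance : Category (PairBundle 𝓗) := inferInstanceAs (Category (Σ x, PairSub (E x)))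

/-- The inclusion into `S(ℍ)` of the category of pairs of subspaces of the fiber over `x`. -/
def PairBundle.fiber (x : X) : PairSub (E x) ⥤ PairBundle 𝓗 :=
  Sigma.incl (C := fun x => PairSub (E x)) x

/-- The topology on the set of objects of `S(ℍ)`, glued by means of local trivializations. -/
instance : TopologicalSpace (PairBundle 𝓗) :=
  ⨆ i : 𝓗.ι, TopologicalSpace.coinduced
    (fun p : 𝓗.base i × PairSub F =>
      (PairBundle.fiber 𝓗 p.1).obj ((PairSub.mapIso (𝓗.triv i p.1).symm).obj p.2))
    inferInstance

/-- The topology on the set of morphisms of `S(ℍ)`, glued in the same way. -/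
instance : TopologicalSpace (Arrow (PairBundle 𝓗)) :=
  ⨆ i : 𝓗.ι, TopologicalSpace.coinduced
    (fun p : 𝓗.base i × Arrow (PairSub F) =>
      (PairBundle.fiber 𝓗 p.1).mapArrow.obj
        ((PairSub.mapIso (𝓗.triv i p.1).symm).mapArrow.obj p.2))
    inferInstance

variable [∀ x, CompleteSpace (E x)] (B : ∀ x, E x →L[ℂ] E x)

/-- The number `ε` is adapted to the family `B` over `S`: for every `x ∈ S` the pair `(B x, ε)` is
an enhanced Fredholm operator, the subspaces `E₁ x = Im P_{[0, ε]}(|B x|)` and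
`E₂ x = Im P_{[0, ε]}(|(B x)*|)` depend continuously on `x ∈ S`, and the operators
`E₁ x → E₂ x` induced by `B x` (or, what is the same, the operators `B x ∘ P_{[0, ε]}(|B x|)`)
depend continuously on `x ∈ S`. -/
structure IsGeneralAdaptedOn (S : Set X) (ε : ℝ) : Prop where
  isEnhanced : ∀ x ∈ S, IsEnhancedFredholm (B x) ε
  continuous_fst : 𝓗.ContinuousFamilyOn S fun x => specProj (absOp (B x)) 0 ε
  continuous_snd : 𝓗.ContinuousFamilyOn S fun x =>
    specProj (absOp (ContinuousLinearMap.adjoint (B x))) 0 ε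
  continuous_operator : 𝓗.ContinuousFamilyOn S fun x => B x ∘L specProj (absOp (B x)) 0 ε

/-- A Fredholm family of bounded operators in the fibers of a Hilbert bundle. -/
structure IsGeneralFredholmFamily : Prop where
  isFredholm : ∀ x, (B x).IsFredholm
  exists_adapted : ∀ x, ∃ ε : ℝ, ∃ U : Opens X, x ∈ U ∧ IsGeneralAdaptedOn 𝓗 B U ε

variable {B}

/-- The morphism of `S(ℍ)` from the pair of subspaces defined by `(B x, ε)` to the pair of subspaces
defined by `(B y, ε')`, for `x = y` and `ε ≤ ε'`. -/
def generalIndexHom {x y : X} (hxy : x = y) {ε ε' : ℝ} (h : IsEnhancedFredholm (B x) ε)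
    (h' : IsEnhancedFredholm (B y) ε') (hle : ε ≤ ε') :
    (PairBundle.fiber 𝓗 x).obj h.obj ⟶ (PairBundle.fiber 𝓗 y).obj h'.obj :=
  match y, hxy, h' with
  | _, rfl, h' => (PairBundle.fiber 𝓗 x).map (h.hom h' hle)

lemma generalIndexHom_trans {x y z : X} (hxy : x = y) (hyz : y = z) {ε ε' ε'' : ℝ}
    (h : IsEnhancedFredholm (B x) ε) (h' : IsEnhancedFredholm (B y) ε')
    (h'' : IsEnhancedFredholm (B z) ε'') (hle : ε ≤ ε') (hle' : ε' ≤ ε'') :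
    generalIndexHom 𝓗 (hxy.trans hyz) h h'' (hle.trans hle') =
      generalIndexHom 𝓗 hxy h h' hle ≫ generalIndexHom 𝓗 hyz h' h'' hle' := by
  subst hxy hyz
  exact (congrArg (PairBundle.fiber 𝓗 x).map (h.hom_trans h' h'' hle hle')).trans
    ((PairBundle.fiber 𝓗 x).map_comp _ _)

/-- The index functor `𝔹_{U, ε} : X_U ⥤ S(ℍ)`, which takes `(x, σ)` to the pair
`(Im P_{[0, ε_σ]}(|B_x|), Im P_{[0, ε_σ]}(|B_x*|))`. -/
def generalIndexFunctor {ι : Type*} (U : ι → Opens X) (ε : ι → ℝ)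
    (h : ∀ a, ∀ x ∈ U a, IsEnhancedFredholm (B x) (ε a)) : CoverObj U ⥤ PairBundle 𝓗 :=
  have hη : ∀ p : CoverObj U, IsEnhancedFredholm (B p.pt) (p.minEps ε) := fun p => by
    obtain ⟨a, ha, hε⟩ := p.minEps_mem ε
    rw [hε]
    exact h a _ (p.mem a ha)
  { obj := fun p => (PairBundle.fiber 𝓗 p.pt).obj (hη p).obj
    map := fun {p q} f => generalIndexHom 𝓗 (leOfHom f).1 (hη p) (hη q)
      (CoverObj.minEps_mono ε (leOfHom f))
    map_id := fun p => (congrArg (PairBundle.fiber 𝓗 p.pt).map (hη p).hom_refl).trans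
      ((PairBundle.fiber 𝓗 p.pt).map_id _)
    map_comp := fun {p q r} f g => by
      have hf := CoverObj.minEps_mono ε (leOfHom f)
      have hg := CoverObj.minEps_mono ε (leOfHom g)
      have h₁ := (leOfHom f).1
      have h₂ := (leOfHom g).1
      have hp := hη p
      have hq := hη q
      have hr := hη r
      change generalIndexHom 𝓗 (h₁.trans h₂) hp hr (hf.trans hg) =
        generalIndexHom 𝓗 h₁ hp hq hf ≫ generalIndexHom 𝓗 h₂ hq hr hg
      exact generalIndexHom_trans 𝓗 h₁ h₂ hp hq hr hf hg }

end PairBundles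

end AnalyticIndex

end

open AnalyticIndex

noncomputable section

namespace AnalyticIndex

open Set Filter Topology

universe u v w u' v'

/-! ## Maps of classifying spaces -/

section Maps

variable {C : Type u} [Category.{v} C] {D : Type u'} [Category.{v'} D]

/-! All parts rest on one comparison. Given coverings `U`, `V` with numbers `ε`, `δ`, the covering
`Sum.elim U V` with the numbers `Sum.elim ε δ` is again an admissible choice, since the conditions
are imposed on every member of a covering separately. Its functor restricts to the functors of `U`
and of `V` along the inclusions of `X_U` and `X_V`. So it is enough that `s` and `t` become
homotopic in the classifying space of the joint covering (`homotopicMaps_map_inl_inr`) and that the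
functors are continuous on objects and on morphisms (`homotopicMaps_of_functor`).

For the first point, a homotopy inverse `s` of `|pr|` is homotopic to every section `r`, because `s
= s ∘ |pr| ∘ r`. Sections come from partitions of unity. If `c₁ < ⋯ < cₖ = m` are the positive
values of `φ` at `x` and `c₀ = 0`, then the superlevel sets of `φ` at the levels `cᵢ` form a simplex
of the nerve, and the numbers `(cᵢ - cᵢ₋₁) / m` are its weights. `IsRep` records this while ignoring
vertices of weight zero; `IsRep.mk_eq` shows that the resulting point depends only on `x` and `φ`;
`IsSubordinateFamily.exists_section` gives continuity. The construction works over any map `Y → X`,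
so applying it to `[0, 1] × X` and a linear path of families yields homotopies. Partitions of unity
for `U` and for `V`, extended by zero, become families for the joint covering, and a linear path
joins them.

For the second point, the parameter `ε_σ` is locally constant on `X_U`, and only spectral subspaces
for fixed intervals have to be controlled. In a fixed space a spectral projection is the indicator
function of an interval applied to the operator, or to its bounded transform, and the ends of the
interval avoid the spectrum (`starProjection_specSub_eq_cfc`, `IsBoundedTransform.isTransform`). In
a Hilbert bundle only the compressions `A P_{[-ε, ε]}` are continuous; the projections onto the
negative and positive parts of a morphism are continuous functions of the difference of two
compressions (`specProj_eq_cfc_sub`). For general operators the isometry between the differences of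
spectral subspaces is `K (K* K)^{-1/2}`, where `K` is the part of `B` on the difference
(`IsEnhancedFredholm.polarPart_eq_cfc`). -/

/-- The point of `|C|` defined by a simplex of the nerve and a point of the standard simplex. -/
def Realization.mk {n : ℕ} (F : Fin (n + 1) ⥤ C) (t : stdSimplex ℝ (Fin (n + 1))) :
    Realization C :=
  Quot.mk _ ⟨n, F, t⟩

lemma Realization.mk_comp {m n : ℕ} (θ : Fin (m + 1) →o Fin (n + 1)) (F : Fin (n + 1) ⥤ C)
    (t : stdSimplex ℝ (Fin (m + 1))) :
    Realization.mk (θ.monotone.functor ⋙ F) t = Realization.mk F (stdSimplex.map θ t) :=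
  Quot.sound ⟨θ, rfl, rfl⟩

lemma Realization.map_mk (Φ : C ⥤ D) {n : ℕ} (F : Fin (n + 1) ⥤ C)
    (t : stdSimplex ℝ (Fin (n + 1))) :
    Realization.map Φ (Realization.mk F t) = Realization.mk (F ⋙ Φ) t := rfl

lemma Realization.exists_mk (x : Realization C) :
    ∃ (n : ℕ) (F : Fin (n + 1) ⥤ C) (t : stdSimplex ℝ (Fin (n + 1))), x = Realization.mk F t := by
  obtain ⟨⟨n, F, t⟩, rfl⟩ := Quot.exists_rep x
  exact ⟨n, F, t, rfl⟩

lemma Realization.map_comp {E : Type*} [Category* E] (Φ : C ⥤ D) (Ψ : D ⥤ E) :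
    Realization.map (Φ ⋙ Ψ) = Realization.map Ψ ∘ Realization.map Φ := by
  funext x
  obtain ⟨n, F, t, rfl⟩ := x.exists_mk
  rfl

variable [TopologicalSpace C] [TopologicalSpace (Arrow C)] [TopologicalSpace D]
  [TopologicalSpace (Arrow D)]

lemma Realization.continuous_mk (n : ℕ) :
    Continuous fun p : Nerve C n × stdSimplex ℝ (Fin (n + 1)) =>
      Realization.mk (p.1 : Fin (n + 1) ⥤ C) p.2 :=
  continuous_quot_mk.comp (continuous_sigmaMk (σ := fun n => Nerve C n × stdSimplex ℝ (Fin (n + 1))))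

lemma Nerve.continuous_rng {Y : Type*} [TopologicalSpace Y] {n : ℕ} {f : Y → Nerve C n}
    (h₁ : ∀ i, Continuous fun y => (f y : Fin (n + 1) ⥤ C).obj i)
    (h₂ : ∀ i : Fin n, Continuous fun y =>
      Arrow.mk ((f y : Fin (n + 1) ⥤ C).map (homOfLE (Fin.castSucc_le_succ i)))) :
    Continuous f :=
  continuous_inf_rng.2 ⟨continuous_induced_rng.2 (continuous_pi h₁),
    continuous_induced_rng.2 (continuous_pi h₂)⟩

lemma Nerve.continuous_obj {n : ℕ} (i : Fin (n + 1)) :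
    Continuous fun F : Nerve C n => (F : Fin (n + 1) ⥤ C).obj i :=
  (continuous_apply i).comp (continuous_iff_le_induced.2 inf_le_left)

lemma Nerve.continuous_map {n : ℕ} (i : Fin n) :
    Continuous fun F : Nerve C n =>
      Arrow.mk ((F : Fin (n + 1) ⥤ C).map (homOfLE (Fin.castSucc_le_succ i))) :=
  (continuous_apply (A := fun _ : Fin n => Arrow C) i).comp
    (f := fun (F : Nerve C n) (i : Fin n) =>
      Arrow.mk ((F : Fin (n + 1) ⥤ C).map (homOfLE (Fin.castSucc_le_succ i))))
    (continuous_iff_le_induced.2 inf_le_right)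

/-- A functor which is continuous on objects and on morphisms induces a continuous map of
classifying spaces. -/
lemma Realization.continuous_map {Φ : C ⥤ D} (h₁ : Continuous Φ.obj)
    (h₂ : Continuous Φ.mapArrow.obj) : Continuous (Realization.map Φ) := by
  refine continuous_quot_lift _ (continuous_quot_mk.comp (continuous_sigma fun n => ?_))
  refine (continuous_sigmaMk (σ := fun n => Nerve D n × stdSimplex ℝ (Fin (n + 1)))).comp ?_
  refine Continuous.prodMk (Nerve.continuous_rng (fun i => ?_) fun i => ?_) continuous_snd
  · exact h₁.comp ((Nerve.continuous_obj i).comp continuous_fst)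
  · exact h₂.comp ((Nerve.continuous_map i).comp continuous_fst)

end Maps

/-! ## Points of `|X_U|` defined by families of functions -/

section Representatives

variable {X : Type u} [TopologicalSpace X] {ι : Type v} {U : ι → Opens X}

lemma CoverObj.ext' {p q : CoverObj U} (h₁ : p.pt = q.pt) (h₂ : p.idx = q.idx) : p = q := by
  cases p; cases q; cases h₁; cases h₂; rfl

lemma Functor.ext_of_obj {J : Type*} [Category* J] {P : Type*} [Preorder P] {F G : J ⥤ P}
    (h : ∀ j, F.obj j = G.obj j) : F = G :=
  CategoryTheory.Functor.hext h fun i j f => by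
    have := h i
    have := h j
    apply Subsingleton.helim
    rw [h i, h j]

/-- The sum of the first weights. -/
def partialSum {n : ℕ} (t : Fin n → ℝ) (k : Fin n) : ℝ := ∑ j ∈ Finset.Iic k, t j

/-- Successive differences of the partial sums give back the weights. The partial sums are the
natural coordinates here, since up to scale they are the values of `φ`. -/
lemma partialSum_injective {n : ℕ} {t t' : Fin n → ℝ} (h : partialSum t = partialSum t') :
    t = t' := by
  funext k
  induction k using WellFoundedLT.induction with
  | ind k ih =>
    have h1 := congrFun h k
    simp only [partialSum] at h1
    rw [← Finset.sum_Iio_add_eq_sum_Iic, ← Finset.sum_Iio_add_eq_sum_Iic] at h1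
    rw [Finset.sum_congr rfl fun j hj => ih j (Finset.mem_Iio.1 hj)] at h1
    linarith

lemma partialSum_last {n : ℕ} (t : stdSimplex ℝ (Fin (n + 1))) :
    partialSum t (Fin.last n) = 1 := by
  rw [partialSum, ← Fin.top_eq_last, Finset.Iic_top]
  exact t.2.2

/-- A simplex `F` of the nerve of `X_U` and a point `t` of the standard simplex represent the point
defined by `x` and the nonnegative finitely supported function `φ` on the set of indices, if the
sets of indices are the superlevel sets of `φ` and the weights are the proportional to the
differences of the successive values of `φ`. -/
structure IsRep (x : X) (φ : ι → ℝ) (m : ℝ) {n : ℕ} (F : Fin (n + 1) ⥤ CoverObj U)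
    (t : stdSimplex ℝ (Fin (n + 1))) : Prop where
  pos : 0 < m
  pt_eq : ∀ k, t k ≠ 0 → (F.obj k).pt = x
  mem_idx : ∀ k, t k ≠ 0 → ∀ a, a ∈ (F.obj k).idx ↔ m * partialSum t k ≤ φ a
  exists_value : ∀ k, t k ≠ 0 → ∃ a, φ a = m * partialSum t k
  value : ∀ a, 0 < φ a → ∃ k, t k ≠ 0 ∧ φ a = m * partialSum t k

/-- Vertices of weight zero are degenerate: the simplex may be restricted to the support of `t`. The
conditions of `IsRep` concern only the support, and the partial sums at its vertices do not change.
-/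
lemma IsRep.exists_pos {x : X} {φ : ι → ℝ} {m : ℝ} {n : ℕ} {F : Fin (n + 1) ⥤ CoverObj U}
    {t : stdSimplex ℝ (Fin (n + 1))} (h : IsRep x φ m F t) :
    ∃ (n' : ℕ) (F' : Fin (n' + 1) ⥤ CoverObj U) (t' : stdSimplex ℝ (Fin (n' + 1))),
      IsRep x φ m F' t' ∧ (∀ k, 0 < t' k) ∧ Realization.mk F t = Realization.mk F' t' := by
  classical
  set S : Finset (Fin (n + 1)) := Finset.univ.filter fun k => t k ≠ 0 with hS
  have hmem : ∀ k, k ∈ S ↔ t k ≠ 0 := by simp [hS]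
  have hne : S.Nonempty := by
    by_contra h0
    rw [Finset.not_nonempty_iff_eq_empty] at h0
    have h1 : ∀ k, t k = 0 := fun k => by
      by_contra hk
      simpa [h0] using (hmem k).2 hk
    have h2 : ∑ k, t k = 1 := t.2.2
    simp [h1] at h2
  obtain ⟨n', hn'⟩ : ∃ n', S.card = n' + 1 :=
    ⟨S.card - 1, (Nat.succ_pred_eq_of_pos hne.card_pos).symm⟩
  set θ := S.orderEmbOfFin hn' with hθ
  have hθmem : ∀ i, t (θ i) ≠ 0 := fun i => (hmem _).1 (S.orderEmbOfFin_mem hn' i)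
  have hθsurj : ∀ k, t k ≠ 0 → ∃ i, θ i = k := fun k hk => by
    have : k ∈ Set.range θ := by
      rw [hθ, Finset.range_orderEmbOfFin]
      exact (hmem k).2 hk
    exact this
  -- Weights off the range of `θ` vanish. This is applied to the whole vertex set (total weight), to
  -- initial segments (partial sums) and to singletons (pushforward of the weights).
  have hsum : ∀ A : Finset (Fin (n + 1)),
      ∑ i ∈ Finset.univ.filter (fun i => θ i ∈ A), t (θ i) = ∑ k ∈ A, t k := by
    intro A
    refine (Finset.sum_map _ θ.toEmbedding (fun k => t k)).symm.trans ?_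
    refine Finset.sum_subset ?_ ?_
    · intro k hk
      simp only [Finset.mem_map, Finset.mem_filter] at hk
      obtain ⟨i, hi, rfl⟩ := hk
      exact hi.2
    · intro k hk hk'
      by_contra h0
      obtain ⟨i, rfl⟩ := hθsurj k h0
      exact hk' (Finset.mem_map.2 ⟨i, by simpa using hk, rfl⟩)
  let t' : stdSimplex ℝ (Fin (n' + 1)) := ⟨fun i => t (θ i), fun i => t.2.1 _, by
    have := hsum Finset.univ
    simpa using this.trans t.2.2⟩
  have ht' : ∀ i, t' i = t (θ i) := fun i => rfl
  have hps : ∀ i, partialSum t' i = partialSum t (θ i) := fun i => by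
    rw [partialSum, partialSum, ← hsum]
    refine Finset.sum_congr ?_ fun _ _ => rfl
    ext j
    simp
  refine ⟨n', (OrderHomClass.toOrderHom θ).monotone.functor ⋙ F, t', ⟨h.pos, fun i _ => h.pt_eq _ (hθmem i),
    fun i _ a => ?_, fun i _ => ?_, fun a ha => ?_⟩, fun i => (t.2.1 _).lt_of_ne' (hθmem i), ?_⟩
  · rw [hps]
    exact h.mem_idx _ (hθmem i) a
  · rw [hps]
    exact h.exists_value _ (hθmem i)
  · obtain ⟨k, hk, e⟩ := h.value a ha
    obtain ⟨i, rfl⟩ := hθsurj k hk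
    exact ⟨i, hk, by rw [hps, e]⟩
  · rw [Realization.mk_comp]
    congr 1
    refine stdSimplex.ext (funext fun k => ?_)
    rw [stdSimplex.map_coe, FunOnFinite.linearMap_apply_apply]
    have := hsum {k}
    simp only [Finset.mem_singleton, Finset.sum_singleton] at this
    exact this.symm

/-- The point of `|X_U|` is determined by `x` and `φ`. -/
lemma IsRep.mk_eq {x : X} {φ : ι → ℝ} {m m' : ℝ} {n n' : ℕ} {F : Fin (n + 1) ⥤ CoverObj U}
    {t : stdSimplex ℝ (Fin (n + 1))} {F' : Fin (n' + 1) ⥤ CoverObj U}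
    {t' : stdSimplex ℝ (Fin (n' + 1))} (h : IsRep x φ m F t) (h' : IsRep x φ m' F' t') :
    Realization.mk F t = Realization.mk F' t' := by
  classical
  obtain ⟨n, F, t, h, ht, e⟩ := h.exists_pos
  obtain ⟨n', F', t', h', ht', e'⟩ := h'.exists_pos
  rw [e, e']
  clear e e'
  have mono : ∀ {n : ℕ} {m : ℝ} {t : stdSimplex ℝ (Fin (n + 1))}, 0 < m → (∀ k, 0 < t k) →
      StrictMono fun k => m * partialSum t k := by
    intro n m t hm ht i j hij
    refine mul_lt_mul_of_pos_left ?_ hm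
    refine Finset.sum_lt_sum_of_subset (i := j) (Finset.Iic_subset_Iic.2 hij.le) (by simp)
      (by simpa using hij) (ht j) fun k _ _ => (ht k).le
  -- A scaled partial sum is a positive value of `φ`, hence it also occurs among the scaled partial
  -- sums of the other representative.
  have val : ∀ {n n' : ℕ} {m m' : ℝ} {F : Fin (n + 1) ⥤ CoverObj U}
      {t : stdSimplex ℝ (Fin (n + 1))} {F' : Fin (n' + 1) ⥤ CoverObj U}
      {t' : stdSimplex ℝ (Fin (n' + 1))}, IsRep x φ m F t → IsRep x φ m' F' t' →
      (∀ k, 0 < t k) → (∀ k, 0 < t' k) →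
      ∀ k, ∃ k', m' * partialSum t' k' = m * partialSum t k := by
    intro n n' m m' F t F' t' h h' ht ht' k
    obtain ⟨a, ha⟩ := h.exists_value k (ht k).ne'
    have : 0 < φ a := by
      rw [ha]
      refine mul_pos h.pos (Finset.sum_pos (fun k _ => ht k) ⟨k, by simp⟩)
    obtain ⟨k', -, hk'⟩ := h'.value a this
    exact ⟨k', by rw [← hk', ha]⟩
  have m₁ := mono h.pos ht
  have m₂ := mono h'.pos ht'
  -- Both sequences enumerate the set of positive values of `φ` in increasing order, so they have
  -- the same length and the same terms.
  have hD : Finset.univ.image (fun k => m * partialSum t k) =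
      Finset.univ.image (fun k => m' * partialSum t' k) := by
    ext d
    simp only [Finset.mem_image, Finset.mem_univ, true_and]
    constructor
    · rintro ⟨k, rfl⟩
      exact val h h' ht ht' k
    · rintro ⟨k, rfl⟩
      exact val h' h ht' ht k
  have hcard := congrArg Finset.card hD
  rw [Finset.card_image_of_injective _ m₁.injective, Finset.card_image_of_injective _ m₂.injective]
    at hcard
  simp only [Finset.card_univ, Fintype.card_fin, add_left_inj] at hcard
  subst hcard
  have hc : (Finset.univ.image (fun k => m * partialSum t k)).card = n + 1 := by
    rw [Finset.card_image_of_injective _ m₁.injective]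
    simp
  have e₁ := Finset.orderEmbOfFin_unique hc (f := fun k => m * partialSum t k)
    (fun k => Finset.mem_image_of_mem _ (Finset.mem_univ k)) m₁
  have e₂ := Finset.orderEmbOfFin_unique hc (f := fun k => m' * partialSum t' k)
    (fun k => by rw [hD]; exact Finset.mem_image_of_mem _ (Finset.mem_univ k)) m₂
  have e₃ : ∀ k, m * partialSum t k = m' * partialSum t' k := fun k =>
    congrFun (e₁.trans e₂.symm) k
  -- The weights add up to `1`, so the last term of each sequence is the scale itself.
  have hm : m = m' := by
    have := e₃ (Fin.last n)
    rwa [partialSum_last, partialSum_last, mul_one, mul_one] at this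
  subst hm
  have htt : t = t' := by
    refine stdSimplex.ext (partialSum_injective (funext fun k => ?_))
    exact mul_left_cancel₀ h.pos.ne' (e₃ k)
  subst htt
  have hF : F = F' := by
    refine Functor.ext_of_obj fun k => CoverObj.ext' ?_ ?_
    · rw [h.pt_eq k (ht k).ne', h'.pt_eq k (ht k).ne']
    · ext a
      rw [h.mem_idx k (ht k).ne', h'.mem_idx k (ht k).ne']
  rw [hF]

end Representatives

/-! ## Sections defined by locally finite families of functions -/

section Sections

variable {X : Type u} [TopologicalSpace X] {ι : Type v} {U : ι → Opens X}

lemma CoverObj.continuous_rng {Y : Type*} [TopologicalSpace Y] {g : Y → CoverObj U}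
    (h₁ : Continuous fun y => (g y).pt) (h₂ : ∀ σ, IsOpen {y | (g y).idx = σ}) : Continuous g :=
  continuous_inf_rng.2 ⟨continuous_induced_rng.2 h₁, continuous_induced_rng.2 <|
    let _ : TopologicalSpace (Finset ι) := ⊥
    have : DiscreteTopology (Finset ι) := ⟨rfl⟩
    continuous_discrete_rng.2 h₂⟩

lemma CoverObj.continuous_pt : Continuous (CoverObj.pt : CoverObj U → X) :=
  continuous_iff_le_induced.2 inf_le_left

lemma CoverObj.isOpen_idx (σ : Finset ι) : IsOpen {p : CoverObj U | p.idx = σ} := by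
  let _ : TopologicalSpace (Finset ι) := ⊥
  have : DiscreteTopology (Finset ι) := ⟨rfl⟩
  have : Continuous (CoverObj.idx : CoverObj U → Finset ι) :=
    continuous_iff_le_induced.2 inf_le_right
  exact (isOpen_discrete {σ}).preimage this

open Classical in
/-- The simplex of the nerve of `X_U` defined by a point `x` and a finite sequence of indices. -/
def chain {n : ℕ} (π : Fin (n + 1) → ι) (x : X) (hx : ∀ j, x ∈ U (π j)) :
    Fin (n + 1) ⥤ CoverObj U :=
  Monotone.functor (f := fun k => (⟨x, (Finset.Ici k).image π,
      ⟨π k, Finset.mem_image_of_mem _ (by simp)⟩, fun a ha => by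
        obtain ⟨j, -, rfl⟩ := Finset.mem_image.1 ha
        exact hx j⟩ : CoverObj U))
    fun _ _ hkl => ⟨rfl, Finset.image_subset_image (Finset.Ici_subset_Ici.2 hkl)⟩

lemma mem_chain_idx {n : ℕ} {π : Fin (n + 1) → ι} {x : X} {hx : ∀ j, x ∈ U (π j)}
    {k : Fin (n + 1)} {a : ι} : a ∈ ((chain π x hx).obj k).idx ↔ ∃ j ≥ k, π j = a := by
  classical
  change a ∈ (Finset.Ici k).image π ↔ _
  simp

/-- The weights proportional to the differences of the successive terms of a sequence. -/
def diffWeight {n : ℕ} (v : Fin (n + 1) → ℝ) (k : Fin (n + 1)) : ℝ :=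
  ((Fin.cons 0 v : Fin (n + 2) → ℝ) k.succ - (Fin.cons 0 v : Fin (n + 2) → ℝ) k.castSucc) /
    v (Fin.last n)

lemma monotone_cons_zero {n : ℕ} {v : Fin (n + 1) → ℝ} (hv : Monotone v) (h0 : ∀ k, 0 ≤ v k) :
    Monotone (Fin.cons 0 v : Fin (n + 2) → ℝ) := by
  intro i j hij
  induction j using Fin.cases with
  | zero => rw [Fin.le_zero_iff.1 hij]
  | succ j =>
    induction i using Fin.cases with
    | zero => simpa using h0 j
    | succ i => simpa using hv (Fin.succ_le_succ_iff.1 hij)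

lemma partialSum_diffWeight {n : ℕ} (v : Fin (n + 1) → ℝ) (k : Fin (n + 1)) :
    partialSum (diffWeight v) k = v k / v (Fin.last n) := by
  simp only [partialSum, diffWeight]
  rw [← Finset.sum_div, Fin.sum_Iic_sub]
  simp

lemma diffWeight_mem {n : ℕ} {v : Fin (n + 1) → ℝ} (hv : Monotone v) (h0 : ∀ k, 0 ≤ v k)
    (h1 : 0 < v (Fin.last n)) : diffWeight v ∈ stdSimplex ℝ (Fin (n + 1)) := by
  refine ⟨fun k => div_nonneg (sub_nonneg.2 ?_) h1.le, ?_⟩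
  · exact monotone_cons_zero hv h0 Fin.castSucc_lt_succ.le
  · have := partialSum_diffWeight v (Fin.last n)
    rw [partialSum, ← Fin.top_eq_last, Finset.Iic_top] at this
    rw [this, div_self]
    rw [Fin.top_eq_last]
    exact h1.ne'

/-- Along an increasing arrangement the tail `{π j | j ≥ k}` is a superlevel set of `φ` precisely
when the value at `k` exceeds the preceding one, that is, when the weight of `k` is nonzero. Ties
produce vertices of weight zero, about which `IsRep` says nothing. -/
lemma isRep_chain {n : ℕ} {π : Fin (n + 1) → ι} {x : X} {hx : ∀ j, x ∈ U (π j)} {φ : ι → ℝ}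
    (hv : Monotone (φ ∘ π)) (h0 : ∀ k, 0 ≤ φ (π k)) (h1 : 0 < φ (π (Fin.last n)))
    (hφ : ∀ a, 0 < φ a → ∃ j, π j = a) :
    IsRep x φ (φ (π (Fin.last n))) (chain π x hx) ⟨_, diffWeight_mem hv h0 h1⟩ := by
  set v := φ ∘ π with hvdef
  have hps : ∀ k, φ (π (Fin.last n)) *
      partialSum (⟨_, diffWeight_mem hv h0 h1⟩ : stdSimplex ℝ (Fin (n + 1))) k = φ (π k) := by
    intro k
    refine (congrArg _ (partialSum_diffWeight v k)).trans ?_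
    simp only [v, Function.comp_apply]
    field_simp
  have mono := monotone_cons_zero hv h0
  have hlt : ∀ k, diffWeight v k ≠ 0 → (Fin.cons 0 v : Fin (n + 2) → ℝ) k.castSucc < v k := by
    intro k hk
    refine lt_of_le_of_ne ?_ fun h => hk ?_
    · simpa using mono (Fin.castSucc_lt_succ (i := k)).le
    · rw [diffWeight, Fin.cons_succ, h, sub_self, zero_div]
  refine ⟨h1, fun _ _ => rfl, fun k hk a => ?_, fun k _ => ⟨π k, (hps k).symm⟩, fun a ha => ?_⟩
  · rw [hps, mem_chain_idx]
    constructor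
    · rintro ⟨j, hj, rfl⟩
      exact hv hj
    · intro ha
      have hk' := hlt k hk
      have h2 : 0 ≤ (Fin.cons 0 v : Fin (n + 2) → ℝ) k.castSucc := by
        simpa using mono (Fin.zero_le k.castSucc)
      obtain ⟨j, rfl⟩ := hφ a (h2.trans_lt (hk'.trans_le ha))
      refine ⟨j, ?_, rfl⟩
      -- An index placed before `k` has a value at most the entry preceding `k`, which is strictly
      -- less than the value at `k`.
      by_contra! hjk
      have h3 := mono (show j.succ ≤ k.castSucc from Fin.succ_le_castSucc_iff.2 hjk)
      rw [Fin.cons_succ] at h3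
      exact absurd (ha.trans h3) (not_le.2 hk')
  · obtain ⟨j, rfl⟩ := hφ a ha
    classical
    have hne : (Finset.univ.filter fun k => v k = v j).Nonempty := ⟨j, by simp⟩
    -- Among the positions sharing a value, the first is the one that carries the weight.
    set k := (Finset.univ.filter fun k => v k = v j).min' hne with hk
    have hkv : v k = v j := by
      simpa using Finset.min'_mem _ hne
    have hmin : ∀ i < k, v i ≠ v j := fun i hi he =>
      absurd (Finset.min'_le (Finset.univ.filter fun k => v k = v j) i (by simpa using he))
        (not_le.2 hi)
    refine ⟨k, ?_, by rw [hps]; exact hkv.symm⟩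
    change diffWeight v k ≠ 0
    rw [diffWeight]
    refine div_ne_zero (sub_ne_zero.2 ?_) h1.ne'
    rw [Fin.cons_succ]
    clear_value k
    induction k using Fin.cases with
    -- The entry before the first position is the prepended `0`, and the value is positive.
    | zero =>
      rw [hkv]
      simpa using (show v j ≠ 0 from ha.ne')
    | succ k =>
      rw [← Fin.succ_castSucc, Fin.cons_succ, hkv]
      exact (hmin _ Fin.castSucc_lt_succ).symm

/-- A family of functions on `Y` which is subordinate to the preimage of the covering `U` under a
map `f : Y → X` in a locally finite way. -/
structure IsSubordinateFamily (U : ι → Opens X) {Y : Type*} [TopologicalSpace Y] (f : Y → X)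
    (φ : ι → Y → ℝ) : Prop where
  continuous_map : Continuous f
  continuous : ∀ a, Continuous (φ a)
  nonneg : ∀ a y, 0 ≤ φ a y
  exists_pos : ∀ y, ∃ a, 0 < φ a y
  locally_finite : ∀ y₀, ∃ (J : Finset ι) (O : Set Y), IsOpen O ∧ y₀ ∈ O ∧
    ∀ y ∈ O, (∀ a, φ a y ≠ 0 → a ∈ J) ∧ ∀ a ∈ J, f y ∈ U a

variable {Y : Type w} [TopologicalSpace Y] {f : Y → X} {φ : ι → Y → ℝ}

/-- With the order of the indices fixed, the simplex varies only through its base point, and the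
weights are quotients of continuous functions with positive denominator. -/
lemma continuous_mk_chain {n : ℕ} (hf : Continuous f) (hφ : ∀ a, Continuous (φ a))
    (π : Fin (n + 1) → ι) (hπ : ∀ y j, f y ∈ U (π j)) (hv : ∀ y, Monotone ((φ · y) ∘ π))
    (h0 : ∀ y k, 0 ≤ φ (π k) y) (h1 : ∀ y, 0 < φ (π (Fin.last n)) y) :
    Continuous fun y => Realization.mk (chain (U := U) π (f y) (hπ y))
      ⟨_, diffWeight_mem (hv y) (h0 y) (h1 y)⟩ := by
  have hobj : ∀ i, Continuous fun y => (chain (U := U) π (f y) (hπ y)).obj i := fun i =>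
    CoverObj.continuous_rng hf fun σ => by
      classical
      exact isOpen_const (p := (Finset.Ici i).image π = σ)
  let c : Y → Nerve (CoverObj U) n := fun y => chain π (f y) (hπ y)
  let d : Y → stdSimplex ℝ (Fin (n + 1)) := fun y => ⟨_, diffWeight_mem (hv y) (h0 y) (h1 y)⟩
  have hc : Continuous c := Nerve.continuous_rng hobj fun i =>
    continuous_induced_rng.2 ((hobj _).prodMk (hobj _))
  have hd : Continuous d := by
    refine Continuous.subtype_mk (continuous_pi fun k => ?_) _
    refine Continuous.div (Continuous.sub ?_ ?_) (hφ _) fun y => (h1 y).ne'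
    · simpa using hφ (π k)
    · induction k using Fin.cases with
      | zero => simpa using continuous_const
      | succ k => simpa [← Fin.succ_castSucc] using hφ (π k.castSucc)
  exact (Realization.continuous_mk n).comp (hc.prodMk hd)

/-- Near a given point finitely many indices matter. Each of their orderings is the correct one on a
closed set, these finitely many closed sets cover the neighborhood, and on each of them the section
is given by a continuous formula. The formulas agree on overlaps because a point of `|X_U|` is
determined by `x` and `φ`. -/
lemma IsSubordinateFamily.exists_section (h : IsSubordinateFamily U f φ) :
    ∃ r : Y → Realization (CoverObj U), Continuous r ∧
      ∀ y, ∃ (m : ℝ) (n : ℕ) (F : Fin (n + 1) ⥤ CoverObj U) (t : stdSimplex ℝ (Fin (n + 1))),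
        IsRep (f y) (φ · y) m F t ∧ r y = Realization.mk F t := by
  have key : ∀ y₀, ∃ (n : ℕ) (π : Equiv.Perm (Fin (n + 1)) → Fin (n + 1) → ι) (O : Set Y),
      IsOpen O ∧ y₀ ∈ O ∧ ∀ y ∈ O, (∀ σ j, f y ∈ U (π σ j)) ∧
        (∀ σ a, 0 < φ a y → ∃ j, π σ j = a) ∧ ∃ σ, Monotone ((φ · y) ∘ π σ) := by
    intro y₀
    obtain ⟨J, O, hO, hy₀, hJ⟩ := h.locally_finite y₀
    obtain ⟨a₀, ha₀⟩ := h.exists_pos y₀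
    have hcard : 0 < J.card := Finset.card_pos.2 ⟨a₀, (hJ y₀ hy₀).1 a₀ ha₀.ne'⟩
    obtain ⟨n, hn⟩ : ∃ n, J.card = n + 1 := ⟨J.card - 1, (Nat.succ_pred_eq_of_pos hcard).symm⟩
    let e : Fin (n + 1) ≃ J := (J.equivFinOfCardEq hn).symm
    -- The arrangements are all permutations of one enumeration of `J`; sorting the values at `y`
    -- selects a monotone one.
    refine ⟨n, fun σ j => e (σ j), O, hO, hy₀, fun y hy => ⟨fun σ j => (hJ y hy).2 _ (e (σ j)).2,
      fun σ a ha => ?_, Tuple.sort fun j => φ (e j) y, ?_⟩⟩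
    · exact ⟨σ.symm (e.symm ⟨a, (hJ y hy).1 a ha.ne'⟩), by simp⟩
    · exact Tuple.monotone_sort fun j => φ (e j) y
  have last_pos : ∀ {n : ℕ} {π : Fin (n + 1) → ι} {y : Y}, Monotone ((φ · y) ∘ π) →
      (∀ a, 0 < φ a y → ∃ j, π j = a) → 0 < φ (π (Fin.last n)) y := by
    intro n π y hv hπ
    obtain ⟨a, ha⟩ := h.exists_pos y
    obtain ⟨j, rfl⟩ := hπ a ha
    exact ha.trans_le (hv (Fin.le_last j))
  have hrep : ∀ y, ∃ x : Realization (CoverObj U),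
      ∃ (m : ℝ) (n : ℕ) (F : Fin (n + 1) ⥤ CoverObj U) (t : stdSimplex ℝ (Fin (n + 1))),
        IsRep (f y) (φ · y) m F t ∧ x = Realization.mk F t := by
    intro y
    obtain ⟨n, π, O, -, hyO, hO⟩ := key y
    obtain ⟨h1, h2, σ, hσ⟩ := hO y hyO
    exact ⟨_, _, _, _, _, isRep_chain (hx := h1 σ) hσ (fun k => h.nonneg _ _)
      (last_pos hσ (h2 σ)) (h2 σ), rfl⟩
  -- The value is chosen separately at every point; continuity is possible because any two
  -- representatives define the same point.
  choose r hr using hrep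
  refine ⟨r, continuous_iff_continuousAt.2 fun y₀ => ?_, hr⟩
  obtain ⟨n, π, O, hO, hyO, hOπ⟩ := key y₀
  refine ContinuousOn.continuousAt (s := O) ?_ (hO.mem_nhds hyO)
  rw [continuousOn_iff_continuous_domRestrict]
  refine (locallyFinite_of_finite fun σ => {y : O | Monotone ((φ · (y : Y)) ∘ π σ)}).continuous
    ?_ (fun σ => ?_) fun σ => ?_
  · exact eq_univ_of_forall fun y => mem_iUnion.2 (hOπ y y.2).2.2
  · simp only [Monotone, ofPred_forall]
    refine isClosed_iInter fun i => isClosed_iInter fun j => isClosed_iInter fun _ => ?_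
    exact isClosed_le ((h.continuous _).comp continuous_subtype_val)
      ((h.continuous _).comp continuous_subtype_val)
  · rw [continuousOn_iff_continuous_domRestrict]
    have hc : Continuous fun y : {y : O | Monotone ((φ · (y : Y)) ∘ π σ)} => (y.1 : Y) :=
      continuous_subtype_val.comp continuous_subtype_val
    have hlast : ∀ y : {y : O | Monotone ((φ · (y : Y)) ∘ π σ)}, 0 < φ (π σ (Fin.last n)) y.1 :=
      fun y => last_pos y.2 ((hOπ _ y.1.2).2.1 σ)
    have := continuous_mk_chain (U := U) (φ := fun a (y : {y : O | Monotone ((φ · (y : Y)) ∘ π σ)}) =>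
        φ a y.1) (h.continuous_map.comp hc) (fun a => (h.continuous a).comp hc) (π σ)
      (fun y => (hOπ _ y.1.2).1 σ) (fun y => y.2) (fun y k => h.nonneg _ _) hlast
    refine this.congr fun y => ?_
    obtain ⟨m', n', F', t', hrep', e⟩ := hr y.1
    refine Eq.trans ?_ e.symm
    exact (isRep_chain (hx := (hOπ _ y.1.2).1 σ) y.2 (fun k => h.nonneg _ _) (hlast y)
      ((hOπ _ y.1.2).2.1 σ)).mk_eq hrep'

end Sections

/-! ### Homotopies of maps, homotopy inverses and sections. -/

section HomotopicMaps

variable {Y Z Z' : Type*} [TopologicalSpace Y] [TopologicalSpace Z] [TopologicalSpace Z']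

lemma HomotopicMaps.symm {f g : Y → Z} (h : HomotopicMaps f g) : HomotopicMaps g f := by
  obtain ⟨hf, hg, h⟩ := h
  exact ⟨hg, hf, h.symm⟩

lemma HomotopicMaps.trans {f g k : Y → Z} (h : HomotopicMaps f g) (h' : HomotopicMaps g k) :
    HomotopicMaps f k := by
  obtain ⟨hf, hg, h⟩ := h
  obtain ⟨hg', hk, h'⟩ := h'
  exact ⟨hf, hk, h.trans h'⟩

lemma HomotopicMaps.comp_left {f g : Y → Z} (h : HomotopicMaps f g) {k : Z → Z'}
    (hk : Continuous k) : HomotopicMaps (k ∘ f) (k ∘ g) := by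
  obtain ⟨hf, hg, h⟩ := h
  exact ⟨hk.comp hf, hk.comp hg, (ContinuousMap.Homotopic.refl ⟨k, hk⟩).comp h⟩

lemma HomotopicMaps.comp_right {f g : Z → Z'} (h : HomotopicMaps f g) {k : Y → Z}
    (hk : Continuous k) : HomotopicMaps (f ∘ k) (g ∘ k) := by
  obtain ⟨hf, hg, h⟩ := h
  exact ⟨hf.comp hk, hg.comp hk, h.comp (ContinuousMap.Homotopic.refl ⟨k, hk⟩)⟩

/-- A homotopy inverse of `p` is homotopic to every section of `p`. -/
lemma IsHomotopyInverse.homotopicMaps {p : Y → Z} {s r : Z → Y} (hs : IsHomotopyInverse p s)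
    (hr : Continuous r) (hpr : p ∘ r = id) : HomotopicMaps s r := by
  have h := hs.2.2.2.comp_right hr
  rwa [Function.comp_assoc, hpr, Function.comp_id, Function.id_comp] at h

end HomotopicMaps

/-! ### Comparison of homotopy inverses for two coverings. -/

section Comparison

variable {X : Type u} [TopologicalSpace X] {ι : Type v} {κ : Type w} {U : ι → Opens X}
  {W : κ → Opens X}

/-- The value of `|pr|` is read off at vertex `0`, whose weight may vanish. Base points are constant
along a simplex, so a vertex of nonzero weight may be used instead. -/
lemma IsRep.pr_mk {x : X} {φ : ι → ℝ} {m : ℝ} {n : ℕ} {F : Fin (n + 1) ⥤ CoverObj U}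
    {t : stdSimplex ℝ (Fin (n + 1))} (h : IsRep x φ m F t) :
    CoverObj.pr U (Realization.mk F t) = x := by
  obtain ⟨k, hk⟩ : ∃ k, t k ≠ 0 := by
    by_contra! h0
    have h2 : ∑ k, t k = 1 := t.2.2
    simp [h0] at h2
  rw [← h.pt_eq k hk]
  exact (leOfHom (F.map (homOfLE (Fin.zero_le k)))).1

/-- The functor `X_U ⥤ X_W` for a covering `U` which is a part of a covering `W`. -/
def CoverObj.incl (e : ι ↪ κ) (h : ∀ a, U a = W (e a)) : CoverObj U ⥤ CoverObj W :=
  Monotone.functor (f := fun p => (⟨p.pt, p.idx.map e, p.nonempty.map, fun b hb => by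
      obtain ⟨a, ha, rfl⟩ := Finset.mem_map.1 hb
      exact h a ▸ p.mem a ha⟩ : CoverObj W))
    fun _ _ hpq => ⟨hpq.1, Finset.map_subset_map.2 hpq.2⟩

lemma CoverObj.continuous_incl_obj (e : ι ↪ κ) (h : ∀ a, U a = W (e a)) :
    Continuous (CoverObj.incl e h).obj := by
  refine CoverObj.continuous_rng CoverObj.continuous_pt fun σ => ?_
  have : {p : CoverObj U | ((CoverObj.incl e h).obj p).idx = σ} =
      ⋃ τ ∈ {τ : Finset ι | τ.map e = σ}, {p | p.idx = τ} := by
    ext p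
    simp [CoverObj.incl, Monotone.functor]
  rw [this]
  exact isOpen_biUnion fun τ _ => CoverObj.isOpen_idx τ

lemma continuous_arrow_of_preorder {C P : Type*} [Category* C] [TopologicalSpace (Arrow C)]
    [Preorder P] [TopologicalSpace P] {Φ : C ⥤ P}
    (h₁ : Continuous fun f : Arrow C => Φ.obj f.left)
    (h₂ : Continuous fun f : Arrow C => Φ.obj f.right) :
    @Continuous _ _ _ (preorderArrowTopology P) Φ.mapArrow.obj :=
  continuous_induced_rng.2 (h₁.prodMk h₂)

lemma continuous_preorder_left (P : Type*) [Preorder P] [TopologicalSpace P] :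
    @Continuous _ _ (preorderArrowTopology P) _ fun f : Arrow P => f.left :=
  letI := preorderArrowTopology P
  continuous_fst.comp (f := fun f : Arrow P => (f.left, f.right)) continuous_induced_dom

lemma continuous_preorder_right (P : Type*) [Preorder P] [TopologicalSpace P] :
    @Continuous _ _ (preorderArrowTopology P) _ fun f : Arrow P => f.right :=
  letI := preorderArrowTopology P
  continuous_snd.comp (f := fun f : Arrow P => (f.left, f.right)) continuous_induced_dom

/-- A functor between preordered spaces which is continuous on objects induces a continuous map of
classifying spaces. -/
lemma Realization.continuous_map_of_preorder {P Q : Type*} [Preorder P] [TopologicalSpace P]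
    [Preorder Q] [TopologicalSpace Q] {Φ : P ⥤ Q} (h : Continuous Φ.obj) :
    letI := preorderArrowTopology P
    letI := preorderArrowTopology Q
    Continuous (Realization.map Φ) :=
  letI := preorderArrowTopology P
  letI := preorderArrowTopology Q
  Realization.continuous_map h (continuous_arrow_of_preorder
    (h.comp (continuous_preorder_left P)) (h.comp (continuous_preorder_right P)))

/-- Since `ψ` vanishes off the range of `e`, its superlevel sets at positive levels are the images
of those of `φ`. -/
lemma IsRep.map_incl {x : X} {φ : ι → ℝ} {m : ℝ} {n : ℕ} {F : Fin (n + 1) ⥤ CoverObj U}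
    {t : stdSimplex ℝ (Fin (n + 1))} (hF : IsRep x φ m F t) (e : ι ↪ κ) (h : ∀ a, U a = W (e a))
    {ψ : κ → ℝ} (hψ : ∀ a, ψ (e a) = φ a) (hψ₀ : ∀ b ∉ range e, ψ b = 0) :
    IsRep x ψ m (F ⋙ CoverObj.incl e h) t := by
  refine ⟨hF.pos, hF.pt_eq, fun k hk b => ?_, fun k hk => ?_, fun b hb => ?_⟩
  · change b ∈ (F.obj k).idx.map e ↔ _
    by_cases hb : b ∈ range e
    · obtain ⟨a, rfl⟩ := hb
      rw [hψ, ← hF.mem_idx k hk, Finset.mem_map' e]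
    · rw [hψ₀ b hb]
      -- The level is positive, because the nonzero weight `t k` is one of the summands of the
      -- partial sum; a function value `0` cannot reach it.
      refine iff_of_false (fun h => hb ?_) (not_le.2 (mul_pos hF.pos ?_))
      · obtain ⟨a, -, rfl⟩ := Finset.mem_map.1 h
        exact ⟨a, rfl⟩
      · exact ((t.2.1 k).lt_of_ne' hk).trans_le
          (Finset.single_le_sum (fun j _ => t.2.1 j) (Finset.mem_Iic.2 le_rfl))
  · obtain ⟨a, ha⟩ := hF.exists_value k hk
    exact ⟨e a, (hψ a).trans ha⟩
  · by_cases hb' : b ∈ range e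
    · obtain ⟨a, rfl⟩ := hb'
      rw [hψ] at hb ⊢
      exact hF.value a hb
    · exact absurd (hψ₀ b hb') hb.ne'

/-- The map `r` is the section of `|pr|` defined by the family of functions `φ`. -/
def IsSectionOf (φ : ι → X → ℝ) (r : X → Realization (CoverObj U)) : Prop :=
  Continuous r ∧ ∀ x, ∃ (m : ℝ) (n : ℕ) (F : Fin (n + 1) ⥤ CoverObj U)
    (t : stdSimplex ℝ (Fin (n + 1))), IsRep x (φ · x) m F t ∧ r x = Realization.mk F t

lemma IsSectionOf.pr_comp {φ : ι → X → ℝ} {r : X → Realization (CoverObj U)}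
    (hr : IsSectionOf φ r) : CoverObj.pr U ∘ r = id := by
  funext x
  obtain ⟨m, n, F, t, h, e⟩ := hr.2 x
  rw [Function.comp_apply, e, h.pr_mk]
  rfl

lemma IsSectionOf.map_incl {φ : ι → X → ℝ} {r : X → Realization (CoverObj U)}
    (hr : IsSectionOf φ r) (e : ι ↪ κ) (h : ∀ a, U a = W (e a))
    {ψ : κ → X → ℝ} (hψ : ∀ a, ψ (e a) = φ a) (hψ₀ : ∀ b ∉ range e, ψ b = 0) :
    IsSectionOf ψ (Realization.map (CoverObj.incl e h) ∘ r) := by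
  refine ⟨(Realization.continuous_map_of_preorder (CoverObj.continuous_incl_obj e h)).comp hr.1,
    fun x => ?_⟩
  obtain ⟨m, n, F, t, hF, hx⟩ := hr.2 x
  refine ⟨m, n, F ⋙ CoverObj.incl e h, t, hF.map_incl e h (fun a => by rw [hψ])
    (fun b hb => by rw [hψ₀ b hb]; rfl), ?_⟩
  rw [Function.comp_apply, hx, Realization.map_mk]

lemma IsSubordinateFamily.map_incl {φ : ι → X → ℝ} (hφ : IsSubordinateFamily U id φ)
    (e : ι ↪ κ) (h : ∀ a, U a = W (e a)) {ψ : κ → X → ℝ} (hψ : ∀ a, ψ (e a) = φ a)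
    (hψ₀ : ∀ b ∉ range e, ψ b = 0) : IsSubordinateFamily W id ψ := by
  have key : ∀ b, (∃ a, e a = b ∧ ψ b = φ a) ∨ ψ b = 0 := fun b => by
    by_cases hb : b ∈ range e
    · obtain ⟨a, rfl⟩ := hb
      exact Or.inl ⟨a, rfl, hψ a⟩
    · exact Or.inr (hψ₀ b hb)
  refine ⟨continuous_id, fun b => ?_, fun b y => ?_, fun y => ?_, fun y₀ => ?_⟩
  · rcases key b with ⟨a, -, hb⟩ | hb <;> rw [hb]
    exacts [hφ.continuous a, continuous_const]
  · rcases key b with ⟨a, -, hb⟩ | hb <;> rw [hb]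
    exacts [hφ.nonneg a y, le_rfl]
  · obtain ⟨a, ha⟩ := hφ.exists_pos y
    exact ⟨e a, by rwa [hψ]⟩
  · obtain ⟨J, O, hO, hy, hJ⟩ := hφ.locally_finite y₀
    refine ⟨J.map e, O, hO, hy, fun y hy => ⟨fun b hb => ?_, fun b hb => ?_⟩⟩
    · rcases key b with ⟨a, rfl, hb'⟩ | hb'
      · rw [hb'] at hb
        exact Finset.mem_map_of_mem e ((hJ y hy).1 a hb)
      · rw [hb'] at hb
        exact absurd rfl hb
    · obtain ⟨a, ha, rfl⟩ := Finset.mem_map.1 hb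
      exact h a ▸ (hJ y hy).2 a ha

/-- The sections defined by two families of functions are homotopic. -/
lemma IsSectionOf.homotopicMaps {φ ψ : ι → X → ℝ} (hφ : IsSubordinateFamily U id φ)
    (hψ : IsSubordinateFamily U id ψ) {r r' : X → Realization (CoverObj U)}
    (hr : IsSectionOf φ r) (hr' : IsSectionOf ψ r') : HomotopicMaps r r' := by
  classical
  -- The linear path between the families. At every time some function is positive at each point,
  -- and near each point the relevant indices lie in the union of the two finite sets.
  let Φ : ι → unitInterval × X → ℝ := fun a p => (1 - p.1) * φ a p.2 + p.1 * ψ a p.2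
  have hΦ : IsSubordinateFamily U (Prod.snd : unitInterval × X → X) Φ := by
    refine ⟨continuous_snd, fun a => ?_, fun a p => ?_, fun p => ?_, fun p₀ => ?_⟩
    · exact ((continuous_const.sub (continuous_subtype_val.comp continuous_fst)).mul
        ((hφ.continuous a).comp continuous_snd)).add
          ((continuous_subtype_val.comp continuous_fst).mul ((hψ.continuous a).comp continuous_snd))
    · exact add_nonneg (mul_nonneg (sub_nonneg.2 p.1.2.2) (hφ.nonneg a _))
        (mul_nonneg p.1.2.1 (hψ.nonneg a _))
    · rcases eq_or_lt_of_le p.1.2.1 with h0 | h0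
      · obtain ⟨a, ha⟩ := hφ.exists_pos p.2
        exact ⟨a, by simpa [Φ, ← h0] using ha⟩
      · obtain ⟨a, ha⟩ := hψ.exists_pos p.2
        exact ⟨a, add_pos_of_nonneg_of_pos (mul_nonneg (sub_nonneg.2 p.1.2.2) (hφ.nonneg a _))
          (mul_pos h0 ha)⟩
    · obtain ⟨J, O, hO, hy, hJ⟩ := hφ.locally_finite p₀.2
      obtain ⟨J', O', hO', hy', hJ'⟩ := hψ.locally_finite p₀.2
      refine ⟨J ∪ J', Prod.snd ⁻¹' (O ∩ O'), (hO.inter hO').preimage continuous_snd, ⟨hy, hy'⟩,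
        fun p hp => ⟨fun a ha => ?_, fun a ha => ?_⟩⟩
      · by_contra hJJ
        rw [Finset.mem_union, not_or] at hJJ
        have h1 := not_imp_comm.1 ((hJ _ hp.1).1 a) hJJ.1
        have h2 := not_imp_comm.1 ((hJ' _ hp.2).1 a) hJJ.2
        exact ha (by simp [Φ, h1, h2])
      · rcases Finset.mem_union.1 ha with h | h
        exacts [(hJ _ hp.1).2 a h, (hJ' _ hp.2).2 a h]
  -- Sections are constructed over the projection `[0, 1] × X → X`, so the homotopy is obtained as
  -- one continuous map and no topology on `[0, 1] × |X_U|` has to be considered.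
  obtain ⟨R, hR, hRr⟩ := hΦ.exists_section
  refine ⟨hr.1, hr'.1, ⟨⟨⟨R, hR⟩, fun x => ?_, fun x => ?_⟩⟩⟩
  · obtain ⟨m, n, F, t, hF, e⟩ := hRr (0, x)
    obtain ⟨m', n', F', t', hF', e'⟩ := hr.2 x
    refine e.trans (Eq.trans ?_ e'.symm)
    refine IsRep.mk_eq (φ := (φ · x)) (m := m) ?_ hF'
    simpa [Φ] using hF
  · obtain ⟨m, n, F, t, hF, e⟩ := hRr (1, x)
    obtain ⟨m', n', F', t', hF', e'⟩ := hr'.2 x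
    refine e.trans (Eq.trans ?_ e'.symm)
    refine IsRep.mk_eq (φ := (ψ · x)) (m := m) ?_ hF'
    simpa [Φ] using hF

/-- Here paracompactness is used, through a partition of unity. The closed supports lie in the
members of the covering, so a small neighborhood of a point is contained in `U a` for every index
`a` whose function is nonzero somewhere on it. -/
lemma exists_isSubordinateFamily [T2Space X] [ParacompactSpace X] (hU : ⨆ a, U a = ⊤) :
    ∃ φ : ι → X → ℝ, IsSubordinateFamily U id φ := by
  obtain ⟨ρ, hρ⟩ := PartitionOfUnity.exists_isSubordinate isClosed_univ (fun a => (U a : Set X))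
    (fun a => (U a).2) (by
      rw [← Opens.coe_iSup, hU]
      exact subset_univ _)
  refine ⟨fun a => ρ a, continuous_id, fun a => (ρ a).continuous, fun a y => ρ.nonneg a y,
    fun y => ρ.exists_pos (mem_univ y), fun y₀ => ?_⟩
  obtain ⟨J, O, hO, hJ, hs⟩ := ρ.exists_finset_nhds_support_subset hρ (fun a => (U a).2) y₀
  refine ⟨J, interior O, isOpen_interior, mem_interior_iff_mem_nhds.2 hO, fun y hy => ⟨fun a ha =>
    hs y (interior_subset hy) ha, fun a ha => mem_iInter₂.1 (hJ (interior_subset hy)) a ha⟩⟩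

variable (U) in
/-- The inclusion `X_U ⥤ X_{U ∪ V}`. -/
def CoverObj.inl (V : κ → Opens X) : CoverObj U ⥤ CoverObj (Sum.elim U V) :=
  CoverObj.incl Function.Embedding.inl fun _ => rfl

/-- The inclusion `X_V ⥤ X_{U ∪ V}`. -/
def CoverObj.inr (U : ι → Opens X) (V : κ → Opens X) : CoverObj V ⥤ CoverObj (Sum.elim U V) :=
  CoverObj.incl Function.Embedding.inr fun _ => rfl

/-- Homotopy inverses of the projections `|X_U| → X` and `|X_V| → X` become homotopic
in `|X_{U ∪ V}|`. -/
theorem homotopicMaps_map_inl_inr [T2Space X] [ParacompactSpace X] {V : κ → Opens X}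
    (hU : ⨆ a, U a = ⊤) (hV : ⨆ b, V b = ⊤) {s : X → Realization (CoverObj U)}
    (hs : IsHomotopyInverse (CoverObj.pr U) s) {t : X → Realization (CoverObj V)}
    (ht : IsHomotopyInverse (CoverObj.pr V) t) :
    HomotopicMaps (Realization.map (CoverObj.inl U V) ∘ s)
      (Realization.map (CoverObj.inr U V) ∘ t) := by
  obtain ⟨φ, hφ⟩ := exists_isSubordinateFamily hU
  obtain ⟨ψ, hψ⟩ := exists_isSubordinateFamily hV
  obtain ⟨r, hr⟩ := hφ.exists_section
  obtain ⟨q, hq⟩ := hψ.exists_section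
  replace hr : IsSectionOf φ r := hr
  replace hq : IsSectionOf ψ q := hq
  have hφ₀ : ∀ b ∉ range (Function.Embedding.inl : ι ↪ ι ⊕ κ),
      (Sum.elim φ (fun _ => 0) : ι ⊕ κ → X → ℝ) b = 0 := by
    rintro (a | b) h
    exacts [absurd ⟨a, rfl⟩ h, rfl]
  have hψ₀ : ∀ b ∉ range (Function.Embedding.inr : κ ↪ ι ⊕ κ),
      (Sum.elim (fun _ => 0) ψ : ι ⊕ κ → X → ℝ) b = 0 := by
    rintro (a | b) h
    exacts [rfl, absurd ⟨b, rfl⟩ h]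
  -- The homotopy inverses may be anything; each is replaced by a section coming from a partition of
  -- unity.
  have h1 := (hs.homotopicMaps hr.1 hr.pr_comp).comp_left
    (Realization.continuous_map_of_preorder
      (CoverObj.continuous_incl_obj (W := Sum.elim U V) Function.Embedding.inl fun _ => rfl))
  have h2 := (ht.homotopicMaps hq.1 hq.pr_comp).comp_left
    (Realization.continuous_map_of_preorder
      (CoverObj.continuous_incl_obj (W := Sum.elim U V) Function.Embedding.inr fun _ => rfl))
  refine h1.trans (HomotopicMaps.trans ?_ h2.symm)
  exact IsSectionOf.homotopicMaps
    (hφ.map_incl (W := Sum.elim U V) _ (fun _ => rfl) (fun _ => rfl) hφ₀)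
    (hψ.map_incl (W := Sum.elim U V) _ (fun _ => rfl) (fun _ => rfl) hψ₀)
    (hr.map_incl _ (fun _ => rfl) (fun _ => rfl) hφ₀)
    (hq.map_incl _ (fun _ => rfl) (fun _ => rfl) hψ₀)

/-- If functors on `X_U` and `X_V` extend to a continuous functor on `X_{U ∪ V}`, then they induce
homotopic maps on `X`. -/
theorem homotopicMaps_of_functor [T2Space X] [ParacompactSpace X] {V : κ → Opens X}
    (hU : ⨆ a, U a = ⊤) (hV : ⨆ b, V b = ⊤) {s : X → Realization (CoverObj U)}
    (hs : IsHomotopyInverse (CoverObj.pr U) s) {t : X → Realization (CoverObj V)}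
    (ht : IsHomotopyInverse (CoverObj.pr V) t) {D : Type*} [Category* D] [TopologicalSpace D]
    [TopologicalSpace (Arrow D)] {Φ : CoverObj (Sum.elim U V) ⥤ D} {ΦU : CoverObj U ⥤ D}
    {ΦV : CoverObj V ⥤ D} (h₁ : Continuous Φ.obj) (h₂ : Continuous Φ.mapArrow.obj)
    (hΦU : CoverObj.inl U V ⋙ Φ = ΦU) (hΦV : CoverObj.inr U V ⋙ Φ = ΦV) :
    HomotopicMaps (Realization.map ΦU ∘ s) (Realization.map ΦV ∘ t) := by
  subst hΦU hΦV
  have := (homotopicMaps_map_inl_inr hU hV hs ht).comp_left (Realization.continuous_map h₁ h₂)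
  rwa [← Function.comp_assoc, ← Function.comp_assoc, ← Realization.map_comp,
    ← Realization.map_comp] at this

end Comparison

/-! ## Spectral projections -/

section SpectralProjections

variable {H : Type u} [NormedAddCommGroup H] [InnerProductSpace ℂ H]

lemma shifted_apply (A : H →ₗ.[ℂ] H) (z : ℂ) (x : A.domain) :
    shifted A z x = A x - z • (x : H) := rfl

lemma mem_opSpectrum_ofBounded [CompleteSpace H] {T : H →L[ℂ] H} {z : ℂ} :
    z ∈ opSpectrum (ofBounded T) ↔ z ∈ spectrum ℂ T := by
  rw [opSpectrum, mem_ofPred_eq, spectrum.mem_iff, not_iff_not, ← IsUnit.neg_iff, neg_sub,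
    ContinuousLinearMap.isUnit_iff_bijective]
  have : ⇑(T - algebraMap ℂ (H →L[ℂ] H) z) ∘ (Submodule.topEquiv : (⊤ : Submodule ℂ H) ≃ₗ[ℂ] H) =
      shifted (ofBounded T) z := by
    funext x
    simp only [Function.comp_apply, Submodule.topEquiv_apply, sub_apply,
      Algebra.algebraMap_eq_smul_one, smul_apply, one_apply_eq_self]
    rfl
  rw [← this]
  exact (Function.Bijective.of_comp_iff _ (Submodule.topEquiv (R := ℂ) (M := H)).bijective)

lemma mem_spectrum_real_iff [CompleteSpace H] {T : H →L[ℂ] H} {μ : ℝ} :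
    μ ∈ spectrum ℝ T ↔ (μ : ℂ) ∈ opSpectrum (ofBounded T) := by
  rw [mem_opSpectrum_ofBounded, ← spectrum.algebraMap_mem_iff ℂ]
  rfl

lemma mem_eig_ofBounded {T : H →L[ℂ] H} {μ : ℝ} {v : H} :
    v ∈ eig (ofBounded T) μ ↔ T v = (μ : ℂ) • v := by
  rw [mem_eig]
  exact ⟨fun ⟨_, h⟩ => h, fun h => ⟨trivial, h⟩⟩

/-- A point of the spectrum of a self-adjoint operator which does not belong to the essential
spectrum is an eigenvalue. -/
lemma notMem_opSpectrum_of_eig_eq_bot [CompleteSpace H] {A : H →ₗ.[ℂ] H} (hA : IsSelfAdjoint A)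
    {μ : ℝ} (hess : (μ : ℂ) ∉ essSpectrum A) (h : eig A μ = ⊥) : (μ : ℂ) ∉ opSpectrum A := by
  simp only [essSpectrum, opSpectrum, mem_ofPred_eq, not_not] at hess ⊢
  constructor
  · rw [← LinearMap.ker_eq_bot]
    refine Submodule.map_injective_of_injective (Submodule.injective_subtype A.domain) ?_
    rw [Submodule.map_bot]
    exact h
  · rw [← LinearMap.range_eq_top]
    have : CompleteSpace (LinearMap.range (shifted A μ)) :=
      IsClosed.completeSpace_coe (hs := hess.isClosed_range)
    -- The range is closed, so surjectivity amounts to triviality of its orthogonal complement. A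
    -- vector orthogonal to the range of `A - μ` lies in the domain of `A* = A` and is an
    -- eigenvector.
    rw [← Submodule.orthogonal_eq_bot_iff, ← h, eq_comm]
    refine le_antisymm (h ▸ bot_le) fun y hy => ?_
    have key : ∀ x : A.domain, inner ℂ ((μ : ℂ) • y) (x : H) = inner ℂ y (A x) := fun x => by
      have := (Submodule.mem_orthogonal' _ _).1 hy _ ⟨x, rfl⟩
      rw [shifted_apply, inner_sub_right, sub_eq_zero] at this
      rw [this, inner_smul_left, inner_smul_right, Complex.conj_ofReal]
    have hdom : y ∈ A.adjoint.domain := LinearPMap.mem_adjoint_domain_of_exists y ⟨_, key⟩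
    have happ := LinearPMap.adjoint_apply_eq hA.dense_domain ⟨y, hdom⟩ key
    have hAA : A.adjoint = A := LinearPMap.isSelfAdjoint_def.1 hA
    have : ∀ B : H →ₗ.[ℂ] H, B = A → ∀ h : y ∈ B.domain, B ⟨y, h⟩ = (μ : ℂ) • y → y ∈ eig A μ := by
      rintro B rfl h h'
      exact mem_eig.2 ⟨h, h'⟩
    exact this _ hAA hdom happ

/-- In the interval the spectrum consists of eigenvalues. Infinitely many of them would accumulate
at a point of the interval, contrary to the gap provided by `exists_gap`. -/
lemma finite_opSpectrum_inter [CompleteSpace H] {A : H →ₗ.[ℂ] H} (hA : IsSelfAdjoint A) {a b : ℝ}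
    (hess : ∀ μ ∈ Icc a b, (μ : ℂ) ∉ essSpectrum A) :
    {μ : ℝ | μ ∈ Icc a b ∧ (μ : ℂ) ∈ opSpectrum A}.Finite := by
  by_contra hinf
  obtain ⟨μ, hμ, hacc⟩ := Set.Infinite.exists_accPt_of_subset_isCompact hinf
    (isCompact_Icc (a := a) (b := b)) (fun x hx => hx.1)
  obtain ⟨c, hc0, hgap⟩ := exists_gap (formalAdjoint_of_isSelfAdjoint hA) hA.isClosed (hess μ hμ)
  rw [accPt_iff_nhds] at hacc
  obtain ⟨ν, ⟨hν₁, hν₂⟩, hν₃⟩ := hacc (Metric.ball μ c) (Metric.ball_mem_nhds _ hc0)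
  exact notMem_opSpectrum_of_eig_eq_bot hA (hess ν hν₂.1)
    (hgap ν hν₃ (by simpa [Real.dist_eq] using hν₁)) hν₂.2

variable [CompleteSpace H]

/-- The functions `g` with `g(T) v = g(μ) v` form a closed subalgebra containing the constants and
the identity, so the Stone–Weierstrass theorem applies. -/
lemma cfc_apply_of_eigenvector {T : H →L[ℂ] H} (hT : IsSelfAdjoint T) {f : ℝ → ℝ}
    (hf : ContinuousOn f (spectrum ℝ T)) {μ : ℝ} {v : H} (hv : T v = (μ : ℂ) • v) :
    cfc f T v = ((f μ : ℝ) : ℂ) • v := by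
  rcases eq_or_ne v 0 with rfl | hv0
  · simp
  -- Evaluation at `μ` makes sense for functions on the spectrum only because `v ≠ 0` makes `μ` a
  -- spectral value.
  have hμ : μ ∈ spectrum ℝ T := by
    rw [mem_spectrum_real_iff]
    by_contra h
    have h1 := eig_eq_bot h
    have h2 : v ∈ eig (ofBounded T) μ := mem_eig_ofBounded.2 hv
    rw [h1] at h2
    exact hv0 ((Submodule.mem_bot ℂ).1 h2)
  rw [cfc_apply f T hT hf]
  have key : ∀ g : C(spectrum ℝ T, ℝ), cfcHom hT g v = ((g ⟨μ, hμ⟩ : ℝ) : ℂ) • v := by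
    intro g
    have hcomp : CompactSpace (spectrum ℝ T) :=
      isCompact_iff_compactSpace.1 (ContinuousFunctionalCalculus.isCompact_spectrum T)
    induction g using ContinuousMap.induction_on_of_compact with
    | const r =>
      have : ContinuousMap.const (spectrum ℝ T) r = algebraMap ℝ C(spectrum ℝ T, ℝ) r := rfl
      rw [this, AlgHomClass.commutes]
      simp [Algebra.algebraMap_eq_smul_one]
    | id =>
      have := cfcHom_id (R := ℝ) hT
      rw [show ContinuousMap.restrict (spectrum ℝ T) (ContinuousMap.id ℝ) =
        (ContinuousMap.id ℝ).restrict (spectrum ℝ T) from rfl, this, hv]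
      rfl
    | star_id =>
      rw [map_star, cfcHom_id (R := ℝ) hT, hT.star_eq, hv]
      rfl
    | add f g hf hg =>
      rw [map_add, add_apply, hf, hg, ← add_smul]
      simp
    | mul f g hf hg =>
      rw [map_mul, mul_apply_eq_comp, hg, map_smul, hf, smul_smul]
      simp [mul_comm]
    | frequently f h =>
      have hcl : IsClosed {g : C(spectrum ℝ T, ℝ) |
          cfcHom hT g v = ((g ⟨μ, hμ⟩ : ℝ) : ℂ) • v} := by
        refine isClosed_eq ?_ ?_
        · exact (ContinuousLinearMap.apply ℂ H v).continuous.comp (cfcHom_continuous hT)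
        · exact (Complex.continuous_ofReal.comp (continuous_eval_const _)).smul
            continuous_const
      exact hcl.mem_of_frequently_of_tendsto h tendsto_id
  exact key _

/-- `T` is a bounded self-adjoint operator whose spectral theory is that of `g(A)`. -/
structure IsTransform (g : ℝ → ℝ) (A : H →ₗ.[ℂ] H) (T : H →L[ℂ] H) : Prop where
  isSelfAdjoint : IsSelfAdjoint T
  strictMono : StrictMono g
  continuous : Continuous g
  eig_eq : ∀ μ, eig A μ = eig (ofBounded T) (g μ)
  notMem_spectrum : ∀ μ : ℝ, (μ : ℂ) ∉ opSpectrum A → g μ ∉ spectrum ℝ T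

lemma isTransform_ofBounded {T : H →L[ℂ] H} (hT : IsSelfAdjoint T) :
    IsTransform id (ofBounded T) T :=
  ⟨hT, strictMono_id, continuous_id, fun _ => rfl, fun _ h => mt mem_spectrum_real_iff.1 h⟩

lemma continuousOn_indicator_Icc (c d : ℝ) :
    ContinuousOn (indicator (Icc c d) (1 : ℝ → ℝ)) {c, d}ᶜ := by
  intro x hx
  simp only [mem_compl_iff, mem_insert_iff, mem_singleton_iff, not_or] at hx
  refine ContinuousAt.continuousWithinAt ?_
  by_cases h : x ∈ Icc c d
  · refine (continuousAt_const (y := (1 : ℝ))).congr ?_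
    filter_upwards [Ioo_mem_nhds (lt_of_le_of_ne h.1 (Ne.symm hx.1)) (lt_of_le_of_ne h.2 hx.2)]
      with y hy
    rw [indicator_of_mem (Ioo_subset_Icc_self hy)]
    rfl
  · refine (continuousAt_const (y := (0 : ℝ))).congr ?_
    filter_upwards [isClosed_Icc.isOpen_compl.mem_nhds h] with y hy
    rw [indicator_of_notMem hy]

lemma specProj_eq_starProjection {A : H →ₗ.[ℂ] H} {a b : ℝ}
    [h : FiniteDimensional ℂ (specSub A a b)] :
    specProj A a b = (specSub A a b).starProjection := by
  have : (specSub A a b).topologicalClosure = specSub A a b :=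
    (Submodule.closed_of_finiteDimensional _).submodule_topologicalClosure_eq
  simp only [specProj]
  congr 1

/-- The spectral projections in terms of the functional calculus. -/
lemma starProjection_specSub_eq_cfc {g : ℝ → ℝ} {A : H →ₗ.[ℂ] H} {T : H →L[ℂ] H}
    (hT : IsTransform g A T) (hA : IsSelfAdjoint A) {a b : ℝ}
    (hess : ∀ μ ∈ Icc a b, (μ : ℂ) ∉ essSpectrum A) (ha : (a : ℂ) ∉ opSpectrum A)
    (hb : (b : ℂ) ∉ opSpectrum A) [FiniteDimensional ℂ (specSub A a b)] :
    (specSub A a b).starProjection = cfc (indicator (Icc (g a) (g b)) (1 : ℝ → ℝ)) T := by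
  classical
  have hfin := finite_opSpectrum_inter hA hess
  -- The spectrum of `T` between `g a` and `g b` is contained in the finite image of the spectrum of
  -- `A` in `[a, b]`; continuity of `g` supplies the preimages by the intermediate value theorem.
  set s : Finset ℝ := (hfin.image g).toFinset with hs
  have hmem : ∀ x ∈ spectrum ℝ T, x ∈ Icc (g a) (g b) → x ∈ s := by
    intro x hx hx'
    obtain ⟨μ, hμ, rfl⟩ := intermediate_value_Icc (hT.strictMono.le_iff_le.1 (hx'.1.trans hx'.2))
      hT.continuous.continuousOn hx'
    rw [hs, Finite.mem_toFinset]
    exact ⟨μ, ⟨hμ, not_imp_comm.1 (hT.notMem_spectrum μ) (by simpa using hx)⟩, rfl⟩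
  have hs' : ∀ x ∈ s, ∃ μ ∈ Icc a b, g μ = x := fun x hx => by
    rw [hs, Finite.mem_toFinset] at hx
    obtain ⟨μ, hμ, rfl⟩ := hx
    exact ⟨μ, hμ.1, rfl⟩
  have hga := hT.notMem_spectrum a ha
  have hgb := hT.notMem_spectrum b hb
  have hcont : ContinuousOn (indicator (Icc (g a) (g b)) (1 : ℝ → ℝ)) (spectrum ℝ T) :=
    (continuousOn_indicator_Icc _ _).mono fun x hx => by
      simp only [mem_compl_iff, mem_insert_iff, mem_singleton_iff, not_or]
      exact ⟨fun h => hga (h ▸ hx), fun h => hgb (h ▸ hx)⟩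
  -- Points of `s` that lie in the spectrum are isolated there: they are interior to the interval,
  -- as its ends are not spectral values, and the interval meets the spectrum in a finite set.
  have hsing : ∀ x ∈ s, ContinuousOn (indicator {x} (1 : ℝ → ℝ)) (spectrum ℝ T) := by
    intro x hx y hy
    by_cases hyx : y = x
    · subst hyx
      refine (continuousWithinAt_const (b := (1 : ℝ))).congr_of_eventuallyEq ?_ (by simp)
      have h1 : Icc (g a) (g b) ∈ 𝓝 y := by
        obtain ⟨μ, hμ, rfl⟩ := hs' y hx
        exact Icc_mem_nhds
          (lt_of_le_of_ne (hT.strictMono.monotone hμ.1) fun h => hga (h ▸ hy))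
          (lt_of_le_of_ne (hT.strictMono.monotone hμ.2) fun h => hgb (h ▸ hy))
      have h2 : ((s.erase y : Finset ℝ) : Set ℝ)ᶜ ∈ 𝓝 y :=
        (s.erase y).finite_toSet.isClosed.isOpen_compl.mem_nhds (by simp)
      filter_upwards [mem_nhdsWithin_of_mem_nhds h1, mem_nhdsWithin_of_mem_nhds h2,
        self_mem_nhdsWithin] with z hz1 hz2 hz3
      have : z = y := by
        by_contra hne
        exact hz2 (Finset.mem_coe.2 (Finset.mem_erase.2 ⟨hne, hmem z hz3 hz1⟩))
      simp [this]
    · refine (continuousWithinAt_const (b := (0 : ℝ))).congr_of_eventuallyEq ?_ (by simp [hyx])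
      filter_upwards [mem_nhdsWithin_of_mem_nhds (isOpen_compl_singleton.mem_nhds hyx)] with z hz
      simp [show z ≠ x from hz]
  set P := cfc (indicator (Icc (g a) (g b)) (1 : ℝ → ℝ)) T with hP
  have hPsa : IsSelfAdjoint P := cfc_predicate _ _
  have hsum : P = ∑ x ∈ s, cfc (indicator {x} (1 : ℝ → ℝ)) T := by
    rw [← cfc_sum _ _ _ hsing]
    refine cfc_congr fun x hx => ?_
    by_cases hx' : x ∈ Icc (g a) (g b)
    · simp [hx', hmem x hx hx']
    · have : x ∉ s := fun h => hx' <| by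
        obtain ⟨μ, hμ, rfl⟩ := hs' x h
        exact ⟨hT.strictMono.monotone hμ.1, hT.strictMono.monotone hμ.2⟩
      simp [this, hx']
  -- Split over the points of `s`: on the range of the indicator of `{g μ}`, applied to `T`, the
  -- operator `T` acts as multiplication by `g μ`, so this range lies in an eigenspace of `T` and
  -- hence of `A`.
  have hrange : ∀ v, P v ∈ specSub A a b := by
    intro v
    rw [hsum, sum_apply]
    refine Submodule.sum_mem _ fun x hx => ?_
    obtain ⟨μ, hμ, rfl⟩ := hs' x hx
    refine eig_le_specSub hμ ?_
    rw [hT.eig_eq, mem_eig_ofBounded]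
    have h1 : T * cfc (indicator {g μ} (1 : ℝ → ℝ)) T =
        (g μ) • cfc (indicator {g μ} (1 : ℝ → ℝ)) T := by
      have h0 : cfc (fun x : ℝ => x) T = T := cfc_id' ℝ T hT.isSelfAdjoint
      nth_rw 1 [← h0]
      rw [← cfc_mul (fun x => x) _ T continuousOn_id (hsing _ hx),
        ← cfc_smul _ _ _ (hsing _ hx)]
      refine cfc_congr fun y _ => ?_
      by_cases hy : y = g μ <;> simp [hy]
    exact congrArg (fun S : H →L[ℂ] H => S v) h1
  have hfix : ∀ v ∈ specSub A a b, P v = v := by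
    have : specSub A a b ≤ LinearMap.eqLocus (P : H →ₗ[ℂ] H) LinearMap.id := by
      refine iSup₂_le fun μ hμ v hv => ?_
      rw [hT.eig_eq, mem_eig_ofBounded] at hv
      have := cfc_apply_of_eigenvector hT.isSelfAdjoint hcont hv
      have hg : g μ ∈ Icc (g a) (g b) :=
        ⟨hT.strictMono.monotone hμ.1, hT.strictMono.monotone hμ.2⟩
      rw [indicator_of_mem hg] at this
      simpa using this
    exact fun v hv => this hv
  ext v
  -- A self-adjoint operator with values in a subspace which fixes every vector of that subspace is
  -- the orthogonal projection onto it.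
  refine Submodule.eq_starProjection_of_mem_of_inner_eq_zero (hrange v) fun w hw => ?_
  have h1 : ContinuousLinearMap.adjoint P = P := ContinuousLinearMap.isSelfAdjoint_iff'.1 hPsa
  rw [inner_sub_left, ← h1, ContinuousLinearMap.adjoint_inner_left, hfix w hw, sub_self]

/-- The indicator is continuous on the open set `{c, d}ᶜ`, which contains all the spectra. -/
lemma continuous_cfc_indicator {Y : Type*} [TopologicalSpace Y] {T : Y → H →L[ℂ] H}
    (hT : Continuous T) (hsa : ∀ y, IsSelfAdjoint (T y)) {c d : ℝ}
    (hc : ∀ y, c ∉ spectrum ℝ (T y)) (hd : ∀ y, d ∉ spectrum ℝ (T y)) :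
    Continuous fun y => cfc (indicator (Icc c d) (1 : ℝ → ℝ)) (T y) := by
  refine Continuous.cfc_of_mem_nhdsSet (s := {c, d}ᶜ) _ ?_ hT hsa (continuousOn_indicator_Icc c d)
  rw [IsOpen.mem_nhdsSet (toFinite _).isClosed.isOpen_compl]
  refine iUnion_subset fun y x hx => ?_
  simp only [mem_compl_iff, mem_insert_iff, mem_singleton_iff, not_or]
  exact ⟨fun h => hc y (h ▸ hx), fun h => hd y (h ▸ hx)⟩

end SpectralProjections

/-! ## The bounded transform -/

section BoundedTransform

variable {H : Type u} [NormedAddCommGroup H] [InnerProductSpace ℂ H] [CompleteSpace H]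

open ContinuousLinearMap (adjoint)

lemma graph_inner_eq {A : H →ₗ.[ℂ] H} (hA : IsSelfAdjoint A) {p q : H × H} (hp : p ∈ A.graph)
    (hq : q ∈ A.graph) : inner ℂ p.2 q.1 = inner ℂ p.1 q.2 := by
  obtain ⟨x, hx₁, hx₂⟩ := (LinearPMap.mem_graph_iff A).1 hp
  obtain ⟨y, hy₁, hy₂⟩ := (LinearPMap.mem_graph_iff A).1 hq
  rw [← hx₁, ← hx₂, ← hy₁, ← hy₂]
  exact formalAdjoint_of_isSelfAdjoint hA x y

/-- The hypothesis says that `y` is in the domain of the adjoint and that the adjoint takes `y` to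
`w`; and the adjoint is `A`. -/
lemma mem_graph_of_inner_eq {A : H →ₗ.[ℂ] H} (hA : IsSelfAdjoint A) {y w : H}
    (h : ∀ p ∈ A.graph, inner ℂ w p.1 = inner ℂ y p.2) : (y, w) ∈ A.graph := by
  have key : ∀ x : A.domain, inner ℂ w (x : H) = inner ℂ y (A x) := fun x =>
    h (x, A x) (A.mem_graph x)
  have hdom : y ∈ A.adjoint.domain := LinearPMap.mem_adjoint_domain_of_exists y ⟨_, key⟩
  have happ := LinearPMap.adjoint_apply_eq hA.dense_domain ⟨y, hdom⟩ key
  rw [← LinearPMap.isSelfAdjoint_def.1 hA]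
  exact (LinearPMap.mem_graph_iff _).2 ⟨⟨y, hdom⟩, rfl, happ⟩

/-- The operators `(1 + A²)⁻¹` and `A (1 + A²)⁻¹`. -/
lemma exists_resolvent {A : H →ₗ.[ℂ] H} (hA : IsSelfAdjoint A) :
    ∃ R C : H →L[ℂ] H, 0 ≤ R ∧ (∀ h, (R h, C h) ∈ A.graph ∧ (C h, h - R h) ∈ A.graph) := by
  let G : Submodule ℂ (WithLp 2 (H × H)) :=
    A.graph.comap (WithLp.linearEquiv 2 ℂ (H × H)).toLinearMap
  have hG : IsClosed (G : Set (WithLp 2 (H × H))) :=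
    hA.isClosed.preimage (WithLp.prodContinuousLinearEquiv 2 ℂ H H).continuous
  have : CompleteSpace G := IsClosed.completeSpace_coe (hs := hG)
  -- The graph is a closed subspace of the Hilbert sum `H ⊕ H`, and `j`, `k` are its coordinate
  -- projections. The adjoint of `j` takes `h` to the orthogonal projection of `(h, 0)` to the
  -- graph, with coordinates `(1 + A²)⁻¹ h` and `A (1 + A²)⁻¹ h`.
  let j : G →L[ℂ] H := WithLp.fstL 2 ℂ H H ∘L G.subtypeL
  let k : G →L[ℂ] H := WithLp.sndL 2 ℂ H H ∘L G.subtypeL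
  refine ⟨j ∘L adjoint j, k ∘L adjoint j, ?_, fun h => ?_⟩
  · rw [ContinuousLinearMap.nonneg_iff_isPositive]
    exact ContinuousLinearMap.isPositive_self_comp_adjoint j
  · set p := adjoint j h with hp
    have hmem : (j p, k p) ∈ A.graph := p.2
    refine ⟨hmem, mem_graph_of_inner_eq hA fun q hq => ?_⟩
    let q' : G := ⟨WithLp.toLp 2 q, hq⟩
    have h1 : inner ℂ p q' = inner ℂ h (j q') := ContinuousLinearMap.adjoint_inner_left j q' h
    have h2 : inner ℂ p q' = inner ℂ (j p) q.1 + inner ℂ (k p) q.2 :=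
      WithLp.prod_inner_apply (p : WithLp 2 (H × H)) (q' : WithLp 2 (H × H))
    have h3 : j q' = q.1 := rfl
    change inner ℂ (h - j p) q.1 = inner ℂ (k p) q.2
    rw [inner_sub_left, ← h3, ← h1, h2, h3]
    ring

/-- The orthogonal complement of the range of a self-adjoint operator is its kernel. -/
lemma dense_range_of_injective {S : H →L[ℂ] H} (hS : IsSelfAdjoint S)
    (h : ∀ v, S v = 0 → v = 0) : DenseRange S := by
  have hd : (LinearMap.range (S : H →ₗ[ℂ] H)).topologicalClosure = ⊤ := by
    rw [Submodule.topologicalClosure_eq_top_iff, eq_bot_iff]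
    intro v hv
    refine h v (ext_inner_right ℂ fun w => ?_)
    have h1 : adjoint S = S := ContinuousLinearMap.isSelfAdjoint_iff'.1 hS
    rw [inner_zero_left, ← h1, ContinuousLinearMap.adjoint_inner_left]
    exact (Submodule.mem_orthogonal' _ _).1 hv _ ⟨w, rfl⟩
  exact Submodule.dense_iff_topologicalClosure_eq_top.2 hd

/-- Every self-adjoint operator has a bounded transform. -/
theorem exists_isBoundedTransform {A : H →ₗ.[ℂ] H} (hA : IsSelfAdjoint A) :
    ∃ T, IsBoundedTransform A T := by
  obtain ⟨R, C, hR, hRC⟩ := exists_resolvent hA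
  have hRsa : IsSelfAdjoint R := hR.isSelfAdjoint
  have inj : ∀ {x y y' : H}, (x, y) ∈ A.graph → (x, y') ∈ A.graph → y = y' := fun h h' =>
    A.mem_graph_snd_inj h h' rfl
  have zero_mem : ((0 : H), (0 : H)) ∈ A.graph := A.graph.zero_mem
  have hRadj : ∀ x y, inner ℂ (R x) y = inner ℂ x (R y) := fun x y => by
    have h1 : adjoint R = R := ContinuousLinearMap.isSelfAdjoint_iff'.1 hRsa
    conv_lhs => rw [← h1, ContinuousLinearMap.adjoint_inner_left]
  -- Uniqueness for `(1 + A²) z = u`: symmetry of `A`, applied to the difference of two solutions,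
  -- gives `‖C u - w‖² = -‖R u - z‖²`.
  have huniq : ∀ {u z w : H}, (z, w) ∈ A.graph → (w, u - z) ∈ A.graph → R u = z ∧ C u = w := by
    intro u z w h1 h2
    have hz : R u - z = 0 := by
      have h3 := A.graph.sub_mem (hRC u).1 h1
      have h4 := A.graph.sub_mem (hRC u).2 h2
      simp only [Prod.mk_sub_mk] at h3 h4
      have h5 : u - R u - (u - z) = -(R u - z) := by abel
      rw [h5] at h4
      have h6 := graph_inner_eq hA h3 h4
      simp only [inner_neg_right] at h6
      have h7 := inner_self_nonneg (𝕜 := ℂ) (x := C u - w)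
      rw [h6, map_neg, inner_self_eq_norm_sq (𝕜 := ℂ)] at h7
      have h8 : ‖R u - z‖ = 0 := by nlinarith [norm_nonneg (R u - z)]
      exact norm_eq_zero.1 h8
    have hz' := sub_eq_zero.1 hz
    exact ⟨hz', inj (hRC u).1 (hz' ▸ h1)⟩
  -- Uniqueness applied with `u = C h` gives both the commutation of `R` and `C` and the relation
  -- `C² = R - R²`.
  have hCC : ∀ h, R (C h) = C (R h) ∧ C (C h) = R h - R (R h) := by
    intro h
    have h1 := hRC (R h)
    refine huniq h1.2 ?_
    have := A.graph.sub_mem (hRC h).1 h1.1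
    exact this
  have hCadj : ∀ x y, inner ℂ (C x) y = inner ℂ x (C y) := fun x y => by
    have h1 := graph_inner_eq hA (hRC x).1 (hRC y).1
    have h2 := graph_inner_eq hA (hRC x).2 (hRC y).2
    simp only at h1 h2
    calc inner ℂ (C x) y = inner ℂ (C x) (R y) + inner ℂ (C x) (y - R y) := by
          rw [← inner_add_right]; simp
      _ = inner ℂ (R x) (C y) + inner ℂ (x - R x) (C y) := by rw [h1, h2]
      _ = inner ℂ x (C y) := by rw [← inner_add_left]; simp
  have hRinj : ∀ v, R v = 0 → v = 0 := fun v hv => by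
    have h1 := (hRC v).1
    rw [hv] at h1
    have h2 := (hRC v).2
    rw [hv, inj h1 zero_mem, sub_zero] at h2
    exact inj h2 zero_mem
  -- Formally `S = (1 + A²)^{-1/2}`, so the bounded transform should be the operator `T` with `T S =
  -- C`.
  set S := CFC.sqrt R with hS
  have hSnn : 0 ≤ S := CFC.sqrt_nonneg R
  have hSsa : IsSelfAdjoint S := hSnn.isSelfAdjoint
  have hSS : S * S = R := CFC.sqrt_mul_sqrt_self R hR
  have hSSv : ∀ v, S (S v) = R v := fun v => congrArg (fun T : H →L[ℂ] H => T v) hSS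
  have hSadj : ∀ x y, inner ℂ (S x) y = inner ℂ x (S y) := fun x y => by
    have h1 : adjoint S = S := ContinuousLinearMap.isSelfAdjoint_iff'.1 hSsa
    conv_lhs => rw [← h1, ContinuousLinearMap.adjoint_inner_left]
  have hSC : ∀ v, S (C v) = C (S v) := by
    have h1 : Commute R C := ContinuousLinearMap.ext fun v => (hCC v).1
    have h2 : Commute S C := by
      rw [hS, CFC.sqrt_eq_cfc]
      exact h1.cfc_nnreal _
    exact fun v => congrArg (fun T : H →L[ℂ] H => T v) h2
  have hSinj : ∀ v, S v = 0 → v = 0 := fun v hv => hRinj v (by rw [← hSSv, hv, map_zero])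
  have hSd : DenseRange (S : H →ₗ[ℂ] H) := dense_range_of_injective hSsa hSinj
  -- From `C² = R - R²` one gets `‖C v‖² ≤ ⟨v, R v⟩ = ‖S v‖²`. Thus `S v ↦ C v` is a well-defined
  -- contraction on the dense range of `S` and extends to `H`.
  have hnorm : ∀ v, ‖(C : H →ₗ[ℂ] H) v‖ ≤ 1 * ‖(S : H →ₗ[ℂ] H) v‖ := fun v => by
    change ‖C v‖ ≤ 1 * ‖S v‖
    rw [one_mul]
    refine le_of_sq_le_sq ?_ (norm_nonneg _)
    rw [← inner_self_eq_norm_sq (𝕜 := ℂ), ← inner_self_eq_norm_sq (𝕜 := ℂ), hCadj, (hCC v).2,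
      hSadj, hSSv, inner_sub_right, map_sub]
    have : 0 ≤ RCLike.re (inner ℂ v (R (R v))) := by
      rw [← hRadj]
      exact inner_self_nonneg
    linarith
  set T : H →L[ℂ] H := (C : H →ₗ[ℂ] H).extendOfNorm (S : H →ₗ[ℂ] H) with hT
  have hTS : ∀ v, T (S v) = C v := LinearMap.extendOfNorm_eq hSd ⟨1, hnorm⟩
  -- Identities between continuous maps need to be checked only on the dense range of `S`, where `T`
  -- is known.
  have ext_of_S : ∀ {f g : H → H}, Continuous f → Continuous g → (∀ v, f (S v) = g (S v)) →
      ∀ v, f v = g v := fun hf hg h v =>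
    congrFun (DenseRange.equalizer hSd hf hg (funext h)) v
  have hST : ∀ v, S (T v) = T (S v) := ext_of_S (by fun_prop) (by fun_prop) fun v => by
    rw [hTS, hSC, hTS]
  have hTadj : ∀ x y, inner ℂ (T x) y = inner ℂ x (T y) := by
    intro x y
    have h1 : ∀ v w, inner ℂ (T (S v)) w = inner ℂ (S v) (T w) := fun v w => by
      rw [hTS, hSadj, hST, hTS, hCadj]
    have hc₁ : Continuous fun x => inner ℂ (T x) y := by fun_prop
    have hc₂ : Continuous fun x => inner ℂ x (T y) := by fun_prop
    exact congrFun (hSd.equalizer hc₁ hc₂ (funext fun v => h1 v y)) x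
  have hTT : ∀ v, T (T v) = v - R v := by
    refine ext_of_S (by fun_prop) (by fun_prop) fun v => sub_eq_zero.1 (hSinj _ ?_)
    rw [map_sub, map_sub, hTS, hST, hTS, (hCC v).2, hSSv, ← hSSv (S v), hSSv v, hSSv]
    abel
  have hTsa : IsSelfAdjoint T :=
    ContinuousLinearMap.isSelfAdjoint_iff_isSymmetric.2 fun x y => hTadj x y
  have hsqrt : CFC.sqrt (1 - T * T) = S := by
    congr 1
    ext v
    change v - T (T v) = R v
    rw [hTT]
    abel
  have hgraph : ∀ v, (S v, T v) ∈ A.graph := by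
    intro v
    have hcl : IsClosed {v | (S v, T v) ∈ A.graph} :=
      hA.isClosed.preimage (f := fun v => (S v, T v)) (by fun_prop)
    refine hSd.induction_on (p := fun v => (S v, T v) ∈ A.graph) v hcl fun v => ?_
    change (S (S v), T (S v)) ∈ A.graph
    rw [hSSv, hTS]
    exact (hRC v).1
  refine ⟨T, hTsa, LinearMap.opNorm_extendOfNorm_le hSd zero_le_one hnorm, fun p => ?_⟩
  rw [hsqrt]
  constructor
  · intro hp
    -- For a point `(x, A x)` of the graph, `S x + T A x` is formally `(1 + A²)^{1/2} x`, which is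
    -- the required preimage of `x` under `S`.
    have h1 : S (S p.1 + T p.2) = p.1 := by
      refine ext_inner_right ℂ fun w => ?_
      rw [map_add, hSSv, hST, hTS, inner_add_left, hRadj, hCadj]
      have h2 := graph_inner_eq hA hp (hRC w).2
      simp only at h2
      rw [h2, ← inner_add_right]
      simp
    refine ⟨S p.1 + T p.2, Prod.ext h1.symm ?_⟩
    have h2 := hgraph (S p.1 + T p.2)
    rw [h1] at h2
    exact inj hp h2
  · rintro ⟨v, rfl⟩
    exact hgraph v

lemma boundedTransform_spec {A : H →ₗ.[ℂ] H} (hA : IsSelfAdjoint A) :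
    IsBoundedTransform A (boundedTransform A) := by
  have h := exists_isBoundedTransform hA
  rw [boundedTransform, dif_pos h]
  exact h.choose_spec

lemma one_add_sq_pos (x : ℝ) : 0 < 1 + x ^ 2 := by positivity

/-- The function `x ↦ x (1 + x²)^{-1/2}`. -/
def rieszFun (x : ℝ) : ℝ := x / √(1 + x ^ 2)

lemma one_sub_rieszFun_sq (x : ℝ) : 1 - rieszFun x ^ 2 = (1 / √(1 + x ^ 2)) ^ 2 := by
  have := one_add_sq_pos x
  rw [rieszFun, div_pow, div_pow, Real.sq_sqrt this.le]
  field_simp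
  ring

lemma sqrt_one_sub_rieszFun_sq (x : ℝ) : √(1 - rieszFun x ^ 2) = 1 / √(1 + x ^ 2) := by
  rw [one_sub_rieszFun_sq, Real.sqrt_sq (by positivity)]

lemma continuous_rieszFun : Continuous rieszFun :=
  continuous_id.div (by fun_prop) fun x => (Real.sqrt_pos.2 (one_add_sq_pos x)).ne'

/-- The value of `1 - g²` determines `1 + x²`, whence injectivity. A continuous injective function
is strictly monotone or antitone, and the values at `0` and `1` exclude the latter. -/
lemma strictMono_rieszFun : StrictMono rieszFun := by
  have hpos : ∀ x, 0 < rieszFun x ↔ 0 < x := fun x =>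
    div_pos_iff_of_pos_right (Real.sqrt_pos.2 (one_add_sq_pos x))
  have hinj : Function.Injective rieszFun := by
    intro x y h
    have h1 := one_sub_rieszFun_sq x
    rw [h, one_sub_rieszFun_sq y] at h1
    have h2 : √(1 + x ^ 2) = √(1 + y ^ 2) := by
      have h3 := (sq_eq_sq₀ (by positivity) (by positivity)).1 h1
      have := (Real.sqrt_pos.2 (one_add_sq_pos x)).ne'
      have := (Real.sqrt_pos.2 (one_add_sq_pos y)).ne'
      field_simp at h3
      exact h3
    rw [rieszFun, rieszFun, h2] at h
    exact (div_left_inj' (Real.sqrt_pos.2 (one_add_sq_pos y)).ne').1 h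
  rcases continuous_rieszFun.strictMono_of_inj hinj with h | h
  · exact h
  · have h1 := h (zero_lt_one)
    simp only [rieszFun] at h1
    norm_num at h1
    exact absurd h1 (not_lt.2 (Real.sqrt_nonneg _))

variable {A : H →ₗ.[ℂ] H} {T : H →L[ℂ] H}

namespace IsBoundedTransform

lemma abs_le_one (h : IsBoundedTransform A T) {x : ℝ} (hx : x ∈ spectrum ℝ T) : |x| ≤ 1 := by
  have h1 := spectrum.norm_le_norm_mul_of_mem hx
  have h2 : ‖(1 : H →L[ℂ] H)‖ ≤ 1 := ContinuousLinearMap.norm_id_le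
  rw [Real.norm_eq_abs] at h1
  nlinarith [h.norm_le, norm_nonneg T, norm_nonneg (1 : H →L[ℂ] H)]

lemma sqrt_eq_cfc (h : IsBoundedTransform A T) :
    CFC.sqrt (1 - T * T) = cfc (fun x : ℝ => √(1 - x ^ 2)) T := by
  have hsa := h.isSelfAdjoint
  have h0 : cfc (fun x : ℝ => x) T = T := cfc_id' ℝ T hsa
  refine CFC.sqrt_unique ?_ (cfc_nonneg fun x _ => Real.sqrt_nonneg _)
  rw [← cfc_mul _ _ T (by fun_prop) (by fun_prop)]
  have h1 : cfc (fun x : ℝ => 1 - x * x) T = 1 - T * T := by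
    rw [cfc_sub _ _ T (by fun_prop) (by fun_prop), cfc_mul _ _ T (by fun_prop) (by fun_prop), h0,
      cfc_const_one ℝ T hsa]
  rw [← h1]
  refine cfc_congr fun x hx => ?_
  have := h.abs_le_one hx
  have h2 : 0 ≤ 1 - x ^ 2 := by
    nlinarith [abs_nonneg x, sq_abs x]
  change √(1 - x ^ 2) * √(1 - x ^ 2) = 1 - x * x
  rw [Real.mul_self_sqrt h2]
  ring

lemma nonneg_one_sub (h : IsBoundedTransform A T) : 0 ≤ 1 - T * T := by
  have hsa := h.isSelfAdjoint
  have h0 : cfc (fun x : ℝ => x) T = T := cfc_id' ℝ T hsa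
  have h1 : cfc (fun x : ℝ => 1 - x * x) T = 1 - T * T := by
    rw [cfc_sub _ _ T (by fun_prop) (by fun_prop), cfc_mul _ _ T (by fun_prop) (by fun_prop), h0,
      cfc_const_one ℝ T hsa]
  rw [← h1]
  refine cfc_nonneg fun x hx => ?_
  have := h.abs_le_one hx
  nlinarith [abs_nonneg x, sq_abs x]

/-- With `S = (1 - T²)^{1/2}`, the map `v ↦ S v` is a bijection onto the domain of `A` and `A S =
T`. Hence `T - μ S` is `A - μ` composed with a bijection. On eigenvectors `S` is the scalar `1 / √(1
+ μ²)`. -/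
lemma isTransform (h : IsBoundedTransform A T) : IsTransform rieszFun A T := by
  have hsa := h.isSelfAdjoint
  set S := CFC.sqrt (1 - T * T) with hS
  have hSS : ∀ v, S (S v) = v - T (T v) := fun v =>
    congrArg (fun T : H →L[ℂ] H => T v) (CFC.sqrt_mul_sqrt_self (1 - T * T) h.nonneg_one_sub)
  have hST : ∀ v, S (T v) = T (S v) := fun v => by
    have h1 : Commute S T := by
      rw [hS, h.sqrt_eq_cfc]
      exact (Commute.refl T).cfc_real _
    exact congrArg (fun T : H →L[ℂ] H => T v) h1
  have hSpos : 0 ≤ S := CFC.sqrt_nonneg _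
  refine ⟨hsa, strictMono_rieszFun, continuous_rieszFun, fun μ => ?_, fun μ hμ hT => ?_⟩
  · set c := √(1 + μ ^ 2) with hc
    have hcpos : 0 < c := Real.sqrt_pos.2 (one_add_sq_pos μ)
    have hcsq : (c : ℂ) * c = 1 + μ * μ := by
      have : c * c = 1 + μ ^ 2 := Real.mul_self_sqrt (one_add_sq_pos μ).le
      exact_mod_cast (by rw [this]; ring : c * c = 1 + μ * μ)
    have hc0 : (c : ℂ) ≠ 0 := by exact_mod_cast hcpos.ne'
    have hg : ((rieszFun μ : ℝ) : ℂ) = μ / c := by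
      rw [rieszFun]
      push_cast
      rfl
    ext v
    rw [mem_eig_ofBounded, hg]
    constructor
    · intro hv
      obtain ⟨hvd, hv⟩ := mem_eig.1 hv
      obtain ⟨w, hw⟩ := (h.mem_graph_iff (v, (μ : ℂ) • v)).1
        ((LinearPMap.mem_graph_iff A).2 ⟨⟨v, hvd⟩, rfl, hv⟩)
      rw [Prod.mk.injEq] at hw
      obtain ⟨hw₁, hw₂⟩ := hw
      have h1 : T v = (μ : ℂ) • S v := by
        rw [hw₁, ← hST, ← hw₂, map_smul, ← hS, hw₁]
      have h2 : S (S v) = v - ((μ : ℂ) * μ) • S (S v) := by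
        conv_lhs => rw [hSS, h1, map_smul, ← hST, h1, map_smul, smul_smul]
      have h3 : ((c : ℂ) * c) • S (S v) = v := by
        rw [hcsq, add_smul, one_smul]
        nth_rw 1 [h2]
        abel
      -- From `c² S² v = v` follows `c S u = -u`. As `S ≥ 0` and `c > 0`, this forces `u = 0`, that
      -- is, `c S v = v`.
      set u := (c : ℂ) • S v - v with hu
      have h4 : (c : ℂ) • S u = -u := by
        rw [hu, map_sub, map_smul, smul_sub, smul_smul, h3]
        abel
      have h5 : 0 ≤ RCLike.re (inner ℂ (S u) u) :=
        ((ContinuousLinearMap.nonneg_iff_isPositive _).1 hSpos).re_inner_nonneg_left u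
      have h6 : RCLike.re (inner ℂ ((c : ℂ) • S u) u) = c * RCLike.re (inner ℂ (S u) u) := by
        rw [inner_smul_left, Complex.conj_ofReal]
        exact Complex.re_ofReal_mul _ _
      rw [h4, inner_neg_left, map_neg, inner_self_eq_norm_sq (𝕜 := ℂ)] at h6
      have h7 : ‖u‖ = 0 := by
        have := mul_nonneg hcpos.le h5
        nlinarith [norm_nonneg u]
      have h8 : (c : ℂ) • S v = v := sub_eq_zero.1 (norm_eq_zero.1 h7)
      rw [h1, div_eq_mul_inv, mul_smul]
      congr 1
      rw [eq_inv_smul_iff₀ hc0, h8]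
    · intro hv
      have h1 : S v = (c : ℂ)⁻¹ • v := by
        have hv' : T v = ((rieszFun μ : ℝ) : ℂ) • v := by rw [hg, hv]
        have := cfc_apply_of_eigenvector hsa (f := fun x => √(1 - x ^ 2)) (by fun_prop) hv'
        rw [← h.sqrt_eq_cfc, sqrt_one_sub_rieszFun_sq] at this
        rw [hS, this]
        simp [hc]
      -- The point `(v, μ v)` of the graph is parametrized by the vector `c v`.
      have h2 := (h.mem_graph_iff (v, (μ : ℂ) • v)).2 ⟨(c : ℂ) • v, by
        rw [← hS, map_smul, map_smul, h1, hv, smul_smul, smul_smul, mul_inv_cancel₀ hc0,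
          mul_div_cancel₀ _ hc0, one_smul]⟩
      obtain ⟨y, hy₁, hy₂⟩ := (LinearPMap.mem_graph_iff A).1 h2
      obtain ⟨y, hy⟩ := y
      simp only at hy₁ hy₂
      subst hy₁
      exact mem_eig.2 ⟨hy, hy₂⟩
  · have hcont : ContinuousOn (fun x : ℝ => x - μ * √(1 - x ^ 2)) (spectrum ℝ T) := by fun_prop
    have h0 : cfc (fun x : ℝ => x) T = T := cfc_id' ℝ T hsa
    have h1 : cfc (fun x : ℝ => x - μ * √(1 - x ^ 2)) T = T - μ • S := by
      rw [cfc_sub _ _ T (by fun_prop) (by fun_prop), cfc_const_mul _ _ T (by fun_prop), h0,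
        hS, h.sqrt_eq_cfc]
    -- The function `x - μ √(1 - x²)` vanishes at `x = g(μ)`, so by spectral mapping `T - μ S` would
    -- not be invertible.
    have h2 : (0 : ℝ) ∈ spectrum ℝ (T - μ • S) := by
      rw [← h1, cfc_map_spectrum _ T]
      refine ⟨_, hT, ?_⟩
      change rieszFun μ - μ * √(1 - rieszFun μ ^ 2) = 0
      rw [sqrt_one_sub_rieszFun_sq, rieszFun]
      ring
    rw [spectrum.zero_mem_iff] at h2
    refine h2 (ContinuousLinearMap.isUnit_iff_bijective.2 ?_)
    have hmem : ∀ v, ∃ hv : S v ∈ A.domain, A ⟨S v, hv⟩ = T v := fun v => by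
      obtain ⟨y, hy₁, hy₂⟩ := (LinearPMap.mem_graph_iff A).1
        ((h.mem_graph_iff (S v, T v)).2 ⟨v, rfl⟩)
      obtain ⟨y, hy⟩ := y
      simp only at hy₁ hy₂
      subst hy₁
      exact ⟨hy, hy₂⟩
    choose hdom hA using hmem
    let e : H → A.domain := fun v => ⟨S v, hdom v⟩
    have he : Function.Bijective e := by
      constructor
      · intro v w hvw
        have h3 : S v = S w := congrArg Subtype.val hvw
        have h4 : T v = T w := by rw [← hA v, ← hA w]; exact congrArg A hvw
        have h5 := hSS v
        rw [h3, hSS w, h4] at h5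
        simpa using h5.symm
      · rintro ⟨x, hx⟩
        obtain ⟨v, hv⟩ := (h.mem_graph_iff (x, A ⟨x, hx⟩)).1 (A.mem_graph ⟨x, hx⟩)
        exact ⟨v, Subtype.ext (congrArg Prod.fst hv).symm⟩
    have h6 : ⇑(T - μ • S) = shifted A μ ∘ e := by
      funext v
      rw [Function.comp_apply, shifted_apply, hA]
      rfl
    rw [h6]
    exact (not_not.1 hμ).comp he

end IsBoundedTransform

end BoundedTransform

/-! ## Enhanced operators in a fixed Hilbert space -/

section MinEps

variable {X : Type u} [TopologicalSpace X] {ι : Type v} {κ : Type w} {U : ι → Opens X}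
  {V : κ → Opens X}

lemma CoverObj.minEps_inl (ε : ι → ℝ) (δ : κ → ℝ) (p : CoverObj U) :
    ((CoverObj.inl U V).obj p).minEps (Sum.elim ε δ) = p.minEps ε :=
  Finset.inf'_map _ _

lemma CoverObj.minEps_inr (ε : ι → ℝ) (δ : κ → ℝ) (p : CoverObj V) :
    ((CoverObj.inr U V).obj p).minEps (Sum.elim ε δ) = p.minEps δ :=
  Finset.inf'_map _ _

lemma CoverObj.isOpen_minEps (ε : ι → ℝ) (c : ℝ) : IsOpen {p : CoverObj U | p.minEps ε = c} := by
  have : {p : CoverObj U | p.minEps ε = c} =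
      ⋃ σ ∈ {σ : Finset ι | ∃ h : σ.Nonempty, σ.inf' h ε = c}, {p | p.idx = σ} := by
    ext p
    simp only [mem_ofPred_eq, mem_iUnion, exists_prop]
    exact ⟨fun h => ⟨p.idx, ⟨p.nonempty, h⟩, rfl⟩, by rintro ⟨σ, ⟨h, h'⟩, rfl⟩; exact h'⟩
  rw [this]
  exact isOpen_biUnion fun σ _ => CoverObj.isOpen_idx σ

end MinEps

section Enhancing

variable {H : Type u} [NormedAddCommGroup H] [InnerProductSpace ℂ H] [CompleteSpace H]
  {T : Type v} {op : T → (H →ₗ.[ℂ] H)}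

omit [CompleteSpace H] in
lemma EnhancedObj.ext' {p q : EnhancedObj op} (h₁ : p.pt = q.pt) (h₂ : p.eps = q.eps) : p = q := by
  cases p; cases q; cases h₁; cases h₂; rfl

variable {X : Type w} [TopologicalSpace X] {ι : Type u'} {κ : Type v'} {A : X → T}
  {U : ι → Opens X} {V : κ → Opens X} {ε : ι → ℝ} {δ : κ → ℝ}
  (hε : ∀ a, ∀ z ∈ U a, IsEnhanced (op (A z)) (ε a))
  (hδ : ∀ b, ∀ z ∈ V b, IsEnhanced (op (A z)) (δ b))

omit [CompleteSpace H] in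
include hε hδ in
lemma forall_sum_elim_isEnhanced : ∀ c, ∀ z ∈ (Sum.elim U V : ι ⊕ κ → Opens X) c,
    IsEnhanced (op (A z)) ((Sum.elim ε δ : ι ⊕ κ → ℝ) c) :=
  Sum.forall.2 ⟨hε, hδ⟩

omit [CompleteSpace H] in
lemma inl_comp_enhancing :
    CoverObj.inl U V ⋙ enhancing op A _ _ (forall_sum_elim_isEnhanced hε hδ) =
      enhancing op A U ε hε :=
  Functor.ext_of_obj fun p => EnhancedObj.ext' rfl (CoverObj.minEps_inl ε δ p)

omit [CompleteSpace H] in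
lemma inr_comp_enhancing :
    CoverObj.inr U V ⋙ enhancing op A _ _ (forall_sum_elim_isEnhanced hε hδ) =
      enhancing op A V δ hδ :=
  Functor.ext_of_obj fun p => EnhancedObj.ext' rfl (CoverObj.minEps_inr ε δ p)

omit [CompleteSpace H] in
lemma forget_comp_map_enhancing :
    EnhancedObj.forget op ∘ Realization.map (enhancing op A U ε hε) = A ∘ CoverObj.pr U := by
  funext x
  obtain ⟨n, F, t, rfl⟩ := x.exists_mk
  rfl

variable [TopologicalSpace T]

omit [CompleteSpace H] in
lemma EnhancedObj.continuous_rng {Y : Type*} [TopologicalSpace Y] {g : Y → EnhancedObj op}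
    (h₁ : Continuous fun y => (g y).pt) (h₂ : ∀ c, IsOpen {y | (g y).eps = c}) : Continuous g :=
  continuous_inf_rng.2 ⟨continuous_induced_rng.2 h₁, continuous_induced_rng.2 <|
    let _ : TopologicalSpace ℝ := ⊥
    have : DiscreteTopology ℝ := ⟨rfl⟩
    continuous_discrete_rng.2 h₂⟩

omit [CompleteSpace H] in
lemma EnhancedObj.continuous_pt : Continuous (EnhancedObj.pt : EnhancedObj op → T) :=
  continuous_iff_le_induced.2 inf_le_left

omit [CompleteSpace H] in
lemma EnhancedObj.isOpen_eps (c : ℝ) : IsOpen {p : EnhancedObj op | p.eps = c} := by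
  let _ : TopologicalSpace ℝ := ⊥
  have : DiscreteTopology ℝ := ⟨rfl⟩
  have : Continuous (EnhancedObj.eps : EnhancedObj op → ℝ) :=
    continuous_iff_le_induced.2 inf_le_right
  exact (isOpen_discrete {c}).preimage this

omit [CompleteSpace H] in
lemma continuous_enhancing_obj (hA : Continuous A) : Continuous (enhancing op A U ε hε).obj :=
  EnhancedObj.continuous_rng (hA.comp CoverObj.continuous_pt) fun c =>
    CoverObj.isOpen_minEps ε c

omit [CompleteSpace H] in
lemma homotopicMaps_enhancing [T2Space X] [ParacompactSpace X] (hU : ⨆ a, U a = ⊤)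
    (hV : ⨆ b, V b = ⊤) {s : X → Realization (CoverObj U)}
    (hs : IsHomotopyInverse (CoverObj.pr U) s) {t : X → Realization (CoverObj V)}
    (ht : IsHomotopyInverse (CoverObj.pr V) t) (hA : Continuous A) :
    HomotopicMaps (Realization.map (enhancing op A U ε hε) ∘ s)
      (Realization.map (enhancing op A V δ hδ) ∘ t) := by
  have h := continuous_enhancing_obj (forall_sum_elim_isEnhanced hε hδ) hA
  exact homotopicMaps_of_functor hU hV hs ht h
    (continuous_arrow_of_preorder (h.comp (continuous_preorder_left _))
      (h.comp (continuous_preorder_right _)))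
    (inl_comp_enhancing hε hδ) (inr_comp_enhancing hε hδ)

/-! ### Continuity of spectral subspaces -/

/-- The same `g` serves all the operators, so the interval to whose indicator function the
functional calculus is applied does not depend on `y`. -/
lemma continuousOn_specProj {Y : Type*} [TopologicalSpace Y] {S : Set Y} {g : ℝ → ℝ}
    {B : Y → H →L[ℂ] H} (hB : ContinuousOn B S) {A : Y → H →ₗ.[ℂ] H}
    (hAB : ∀ y ∈ S, IsTransform g (A y) (B y)) (hA : ∀ y, IsSelfAdjoint (A y)) {a b : ℝ}
    (hess : ∀ y ∈ S, ∀ μ ∈ Icc a b, (μ : ℂ) ∉ essSpectrum (A y))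
    (ha : ∀ y ∈ S, (a : ℂ) ∉ opSpectrum (A y)) (hb : ∀ y ∈ S, (b : ℂ) ∉ opSpectrum (A y)) :
    ContinuousOn (fun y => specProj (A y) a b) S := by
  rw [continuousOn_iff_continuous_domRestrict] at hB ⊢
  refine (continuous_cfc_indicator hB (fun y => (hAB y y.2).isSelfAdjoint)
    (fun y => (hAB y y.2).notMem_spectrum a (ha y y.2))
    (fun y => (hAB y y.2).notMem_spectrum b (hb y y.2))).congr fun y => ?_
  have := finite_specSub (formalAdjoint_of_isSelfAdjoint (hA y)) (hA y).isClosed (hess y y.2)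
  exact (specProj_eq_starProjection.trans <| starProjection_specSub_eq_cfc (hAB y y.2) (hA y) (hess y y.2) (ha y y.2) (hb y y.2)).symm

omit [CompleteSpace H] in
lemma FinSub.continuousOn_rng {Y : Type*} [TopologicalSpace Y] {S : Set Y} {f : Y → FinSub H}
    (h : ContinuousOn (fun y => (f y).carrier.starProjection) S) : ContinuousOn f S := by
  rw [continuousOn_iff_continuous_domRestrict] at h ⊢
  exact continuous_induced_rng.2 h

lemma FinSub.continuousOn_of_specProj {Y : Type*} [TopologicalSpace Y] {S : Set Y}
    {f : Y → FinSub H} {A : Y → H →ₗ.[ℂ] H} {a b : ℝ}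
    (h : ContinuousOn (fun y => specProj (A y) a b) S)
    (hf : ∀ y ∈ S, (f y).carrier = specSub (A y) a b) : ContinuousOn f S := by
  refine FinSub.continuousOn_rng (h.congr fun y hy => ?_)
  have : FiniteDimensional ℂ (specSub (A y) a b) := hf y hy ▸ (f y).finite
  simp only [specProj_eq_starProjection, hf y hy]

omit [CompleteSpace H] in
lemma FinSub.continuous_arrow_rng {Y : Type*} [TopologicalSpace Y] {f : Y → Arrow (FinSub H)}
    (h₁ : Continuous fun y => (f y).left) (h₂ : Continuous fun y => (f y).right)
    (h₃ : Continuous fun y => FinSub.Hom.neg (f y).hom)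
    (h₄ : Continuous fun y => FinSub.Hom.pos (f y).hom) : Continuous f :=
  continuous_induced_rng.2 ((h₁.prodMk h₂).prodMk (h₃.prodMk h₄))

omit [TopologicalSpace T] in
lemma EnhancedObj.neg_spectralHom (hsa : ∀ t, IsSelfAdjoint (op t)) {t t' : T} (ht : t = t')
    {ε ε' : ℝ} (h : IsEnhanced (op t) ε) (h' : IsEnhanced (op t') ε') (hle : ε ≤ ε') :
    (FinSub.Hom.neg (spectralHom hsa ht h h' hle)).carrier = specSub (op t) (-ε') (-ε) := by
  subst ht
  rfl

omit [TopologicalSpace T] in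
lemma EnhancedObj.pos_spectralHom (hsa : ∀ t, IsSelfAdjoint (op t)) {t t' : T} (ht : t = t')
    {ε ε' : ℝ} (h : IsEnhanced (op t) ε) (h' : IsEnhanced (op t') ε') (hle : ε ≤ ε') :
    (FinSub.Hom.pos (spectralHom hsa ht h h' hle)).carrier = specSub (op t) ε ε' := by
  subst ht
  rfl

/-- A map is continuous if its restrictions to the members of an open covering are. -/
lemma continuous_of_continuousOn {Y Z κ : Type*} [TopologicalSpace Y] [TopologicalSpace Z]
    {f : Y → Z} (S : κ → Set Y) (hS : ∀ k, IsOpen (S k)) (hcov : ∀ y, ∃ k, y ∈ S k)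
    (hf : ∀ k, ContinuousOn f (S k)) : Continuous f :=
  continuous_iff_continuousAt.2 fun y => by
    obtain ⟨k, hk⟩ := hcov y
    exact (hf k).continuousAt ((hS k).mem_nhds hk)

/-- The parameter `ε` has the discrete topology, so it may be fixed. -/
lemma EnhancedObj.continuous_spectral_obj (hsa : ∀ t, IsSelfAdjoint (op t)) {g : ℝ → ℝ}
    {B : T → H →L[ℂ] H} (hB : Continuous B) (hg : ∀ t, IsTransform g (op t) (B t)) :
    Continuous (spectral hsa).obj := by
  refine continuous_of_continuousOn (fun c => {p | p.eps = c}) isOpen_eps (fun p => ⟨_, rfl⟩)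
    fun c => ?_
  refine FinSub.continuousOn_of_specProj (A := fun p => op p.pt) (a := -c) (b := c)
    (continuousOn_specProj (hB.comp continuous_pt).continuousOn (fun p _ => hg p.pt)
      (fun p => hsa p.pt) ?_ ?_ ?_) ?_
  all_goals rintro p rfl
  exacts [p.isEnhanced.notMem_ess, p.isEnhanced.neg_notMem, p.isEnhanced.notMem, rfl]

/-- On the open sets where both parameters are fixed, the negative and positive parts are spectral
subspaces for fixed intervals. Their ends `±ε`, `±ε'` avoid the spectrum. -/
lemma EnhancedObj.continuous_spectral_mapArrow (hsa : ∀ t, IsSelfAdjoint (op t)) {g : ℝ → ℝ}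
    {B : T → H →L[ℂ] H} (hB : Continuous B) (hg : ∀ t, IsTransform g (op t) (B t)) :
    Continuous (spectral hsa).mapArrow.obj := by
  have hobj := continuous_spectral_obj hsa hB hg
  have hl := continuous_preorder_left (EnhancedObj op)
  have hr := continuous_preorder_right (EnhancedObj op)
  have hopen : ∀ c : ℝ × ℝ, IsOpen {f : Arrow (EnhancedObj op) | f.left.eps = c.1 ∧
      f.right.eps = c.2} := fun c =>
    ((isOpen_eps c.1).preimage hl).inter ((isOpen_eps c.2).preimage hr)
  refine FinSub.continuous_arrow_rng (hobj.comp hl) (hobj.comp hr) ?_ ?_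
  · refine continuous_of_continuousOn _ hopen (fun f => ⟨(_, _), rfl, rfl⟩) fun c => ?_
    refine FinSub.continuousOn_of_specProj (A := fun f : Arrow (EnhancedObj op) => op f.left.pt)
      (a := -c.2) (b := -c.1)
      (continuousOn_specProj (hB.comp (continuous_pt.comp hl)).continuousOn (fun f _ => hg f.left.pt)
        (fun f => hsa f.left.pt) ?_ ?_ ?_) ?_
    all_goals
      obtain ⟨c, d⟩ := c
      rintro ⟨⟨t, ε, h⟩, ⟨t', ε', h'⟩, f⟩ ⟨rfl, rfl⟩
      obtain ⟨h₁, h₂⟩ := leOfHom f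
      change t = t' at h₁
      subst h₁
    · exact fun μ hμ => h'.notMem_ess μ ⟨hμ.1, by linarith [hμ.2, h.pos, h'.pos]⟩
    · exact h'.neg_notMem
    · exact h.neg_notMem
    · exact neg_spectralHom hsa rfl h h' h₂
  · refine continuous_of_continuousOn _ hopen (fun f => ⟨(_, _), rfl, rfl⟩) fun c => ?_
    refine FinSub.continuousOn_of_specProj (A := fun f : Arrow (EnhancedObj op) => op f.left.pt)
      (a := c.1) (b := c.2)
      (continuousOn_specProj (hB.comp (continuous_pt.comp hl)).continuousOn (fun f _ => hg f.left.pt)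
        (fun f => hsa f.left.pt) ?_ ?_ ?_) ?_
    all_goals
      obtain ⟨c, d⟩ := c
      rintro ⟨⟨t, ε, h⟩, ⟨t', ε', h'⟩, f⟩ ⟨rfl, rfl⟩
      obtain ⟨h₁, h₂⟩ := leOfHom f
      change t = t' at h₁
      subst h₁
    · exact fun μ hμ => h'.notMem_ess μ ⟨by linarith [hμ.1, h.pos, h'.pos], hμ.2⟩
    · exact h.notMem
    · exact h'.notMem
    · exact pos_spectralHom hsa rfl h h' h₂

/-- The statements about a continuous family of self-adjoint operators in a fixed space. -/
theorem enhancing_main [T2Space X] [ParacompactSpace X] (hU : ⨆ a, U a = ⊤)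
    (hV : ⨆ b, V b = ⊤) {s : X → Realization (CoverObj U)}
    (hs : IsHomotopyInverse (CoverObj.pr U) s) {t : X → Realization (CoverObj V)}
    (ht : IsHomotopyInverse (CoverObj.pr V) t) (hA : Continuous A)
    (hsa : ∀ t, IsSelfAdjoint (op t)) {g : ℝ → ℝ}
    {B : T → H →L[ℂ] H} (hB : Continuous B) (hg : ∀ t, IsTransform g (op t) (B t)) :
    HomotopicMaps
      (Realization.map (enhancing op A U ε hε) ∘ s) (Realization.map (enhancing op A V δ hδ) ∘ t) ∧
    (CoverObj.pr U ∘ s = id →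
      EnhancedObj.forget op ∘ Realization.map (enhancing op A U ε hε) ∘ s = A) ∧
    HomotopicMaps
      (Realization.map (EnhancedObj.spectral hsa) ∘
        Realization.map (enhancing op A U ε hε) ∘ s)
      (Realization.map (EnhancedObj.spectral hsa) ∘
        Realization.map (enhancing op A V δ hδ) ∘ t) := by
  have h := homotopicMaps_enhancing hε hδ hU hV hs ht hA
  refine ⟨h, fun hpr => ?_, h.comp_left (Realization.continuous_map
    (EnhancedObj.continuous_spectral_obj hsa hB hg)
    (EnhancedObj.continuous_spectral_mapArrow hsa hB hg))⟩
  rw [← Function.comp_assoc, forget_comp_map_enhancing, Function.comp_assoc, hpr,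
    Function.comp_id]

end Enhancing

/-! ## Families of operators in a Hilbert bundle -/

section Compressions

variable {H : Type u} [NormedAddCommGroup H] [InnerProductSpace ℂ H] [CompleteSpace H]
  {A : H →ₗ.[ℂ] H} {a b : ℝ} {T : H →L[ℂ] H}

/-- `T` is the bounded operator `A ∘ P_{[a, b]}(A)`. -/
def IsCompression (A : H →ₗ.[ℂ] H) (a b : ℝ) (T : H →L[ℂ] H) : Prop :=
  ∀ v, ∃ h : specProj A a b v ∈ A.domain, T v = A ⟨specProj A a b v, h⟩

lemma specProj_apply_of_mem [FiniteDimensional ℂ (specSub A a b)] {v : H}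
    (hv : v ∈ specSub A a b) : specProj A a b v = v := by
  rw [specProj_eq_starProjection]
  exact Submodule.starProjection_eq_self_iff.2 hv

lemma specProj_apply_of_mem_orthogonal [FiniteDimensional ℂ (specSub A a b)] {v : H}
    (hv : v ∈ (specSub A a b)ᗮ) : specProj A a b v = 0 := by
  rw [specProj_eq_starProjection, Submodule.starProjection_apply,
    Submodule.orthogonalProjectionOnto_apply_of_mem_orthogonal hv, Submodule.coe_zero]

namespace IsCompression

variable [FiniteDimensional ℂ (specSub A a b)] (hT : IsCompression A a b T)

include hT

lemma apply_of_mem_eig {μ : ℝ} (hμ : μ ∈ Icc a b) {v : H} (hv : v ∈ eig A μ) :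
    T v = (μ : ℂ) • v := by
  obtain ⟨h, e⟩ := hT v
  obtain ⟨h', e'⟩ := mem_eig.1 hv
  rw [e, ← e']
  congr 2
  exact specProj_apply_of_mem (eig_le_specSub hμ hv)

lemma apply_of_mem_orthogonal {v : H} (hv : v ∈ (specSub A a b)ᗮ) : T v = 0 := by
  obtain ⟨h, e⟩ := hT v
  rw [e]
  have : (⟨specProj A a b v, h⟩ : A.domain) = 0 :=
    Subtype.ext (specProj_apply_of_mem_orthogonal hv)
  rw [this, LinearPMap.map_zero]

lemma apply_specProj (v : H) : T (specProj A a b v) = T v := by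
  have h : v - specProj A a b v ∈ (specSub A a b)ᗮ := by
    rw [specProj_eq_starProjection]
    exact Submodule.sub_starProjection_mem_orthogonal v
  have := hT.apply_of_mem_orthogonal h
  rw [map_sub, sub_eq_zero] at this
  exact this.symm

lemma apply_mem (v : H) : T v ∈ specSub A a b := by
  have hle : specSub A a b ≤ (specSub A a b).comap (T : H →ₗ[ℂ] H) := by
    refine iSup₂_le fun μ hμ w hw => ?_
    change T w ∈ specSub A a b
    rw [hT.apply_of_mem_eig hμ hw]
    exact Submodule.smul_mem _ _ (eig_le_specSub hμ hw)
  rw [← hT.apply_specProj]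
  refine hle ?_
  rw [specProj_eq_starProjection]
  exact Submodule.starProjection_apply_mem _ v

/-- As the values of `T` lie in the spectral subspace, `⟨x, T y⟩ = ⟨P x, A P y⟩`, which is symmetric
in `x` and `y`. -/
lemma isSelfAdjoint (hA : IsSelfAdjoint A) : IsSelfAdjoint T := by
  have key : ∀ x y, inner ℂ x (T y) = inner ℂ (specProj A a b x) (T y) := fun x y => by
    have h : x - specProj A a b x ∈ (specSub A a b)ᗮ := by
      rw [specProj_eq_starProjection]
      exact Submodule.sub_starProjection_mem_orthogonal x
    have := (Submodule.mem_orthogonal' _ _).1 h _ (hT.apply_mem y)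
    rwa [inner_sub_left, sub_eq_zero] at this
  refine ContinuousLinearMap.isSelfAdjoint_iff_isSymmetric.2 fun x y => ?_
  change inner ℂ (T x) y = inner ℂ x (T y)
  rw [key, ← inner_conj_symm, key, inner_conj_symm]
  obtain ⟨hx, ex⟩ := hT x
  obtain ⟨hy, ey⟩ := hT y
  rw [ex, ey]
  exact formalAdjoint_of_isSelfAdjoint hA ⟨_, hx⟩ ⟨_, hy⟩

end IsCompression

omit [CompleteSpace H] in
-- Having two names for one subspace allows `V` to be a sum of spectral subspaces, while finite
-- dimension is known for `W`.
lemma eq_of_eqOn_sup_orthogonal {V W : Submodule ℂ H} [FiniteDimensional ℂ W] (hVW : V = W)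
    {S T : H →L[ℂ] H} (h : ∀ v ∈ V, S v = T v) (h' : ∀ v ∈ Wᗮ, S v = T v) : S = T := by
  subst hVW
  ext x
  have hx : x ∈ V ⊔ Vᗮ := by
    rw [Submodule.sup_orthogonal_of_hasOrthogonalProjection]
    trivial
  obtain ⟨y, hy, z, hz, rfl⟩ := Submodule.mem_sup.1 hx
  rw [map_add, map_add, h y hy, h' z hz]

/-- Let the intervals `[a, b]`, `[c, d]`, `[p, q]` form a partition of the interval `[r, s]`. Then
the spectral projection `P_{[a, b]}(A)` is a function of the operator induced by `A` on the sum of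
the images of `P_{[a, b]}(A)` and `P_{[c, d]}(A)`. -/
lemma specProj_eq_cfc_sub (hA : IsSelfAdjoint A) {a b c d p q r s : ℝ}
    [FiniteDimensional ℂ (specSub A r s)] [FiniteDimensional ℂ (specSub A p q)]
    [FiniteDimensional ℂ (specSub A a b)] (hab : Icc a b ⊆ Icc r s) (hcd : Icc c d ⊆ Icc r s)
    (hpq : Icc p q ⊆ Icc r s)
    (hsup : specSub A a b ⊔ specSub A p q ⊔ specSub A c d = specSub A r s)
    (h₁ : specSub A a b ⟂ specSub A p q) (h₂ : specSub A c d ⟂ specSub A p q)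
    (h₃ : specSub A c d ⟂ specSub A a b) {T T' : H →L[ℂ] H} (hT : IsCompression A p q T)
    (hT' : IsCompression A r s T') {f : ℝ → ℝ} (hf : Continuous f) (hf0 : f 0 = 0)
    (hf1 : ∀ x ∈ Icc a b, f x = 1) (hf2 : ∀ x ∈ Icc c d, f x = 0) :
    specProj A a b = cfc f (T' - T) := by
  have hsa : IsSelfAdjoint (T' - T) := (hT'.isSelfAdjoint hA).sub (hT.isSelfAdjoint hA)
  have key : ∀ {μ : ℝ} {v : H}, (T' - T) v = (μ : ℂ) • v →
      cfc f (T' - T) v = ((f μ : ℝ) : ℂ) • v := fun hv =>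
    cfc_apply_of_eigenvector hsa hf.continuousOn hv
  refine eq_of_eqOn_sup_orthogonal hsup (fun v hv => ?_) fun v hv => ?_
  -- On the summands for `[a, b]`, `[p, q]`, `[c, d]` the operator `T' - T` acts as `A`, `0`, `A`,
  -- and `f` takes there the values `1`, `0`, `0`.
  · have hle : specSub A a b ⊔ specSub A p q ⊔ specSub A c d ≤
        LinearMap.eqLocus (specProj A a b : H →ₗ[ℂ] H) (cfc f (T' - T) : H →L[ℂ] H) := by
      refine sup_le (sup_le ?_ ?_) ?_
      · refine iSup₂_le fun μ hμ v hv => ?_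
        have hv' := eig_le_specSub hμ hv
        have h : (T' - T) v = (μ : ℂ) • v := by
          rw [sub_apply, hT'.apply_of_mem_eig (hab hμ) hv, hT.apply_of_mem_orthogonal (h₁ hv'),
            sub_zero]
        change specProj A a b v = cfc f (T' - T) v
        rw [key h, hf1 μ hμ, specProj_apply_of_mem hv']
        simp
      · refine iSup₂_le fun μ hμ v hv => ?_
        have hv' := eig_le_specSub hμ hv
        have h : (T' - T) v = ((0 : ℝ) : ℂ) • v := by
          rw [sub_apply, hT'.apply_of_mem_eig (hpq hμ) hv, hT.apply_of_mem_eig hμ hv]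
          simp
        change specProj A a b v = cfc f (T' - T) v
        rw [key h, hf0, specProj_apply_of_mem_orthogonal (h₁.symm hv')]
        simp
      · refine iSup₂_le fun μ hμ v hv => ?_
        have hv' := eig_le_specSub hμ hv
        have h : (T' - T) v = (μ : ℂ) • v := by
          rw [sub_apply, hT'.apply_of_mem_eig (hcd hμ) hv, hT.apply_of_mem_orthogonal (h₂ hv'),
            sub_zero]
        change specProj A a b v = cfc f (T' - T) v
        rw [key h, hf2 μ hμ, specProj_apply_of_mem_orthogonal (h₃ hv')]
        simp
    exact hle hv
  -- Both compressions vanish on the complement of the largest spectral subspace; this is another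
  -- use of `f 0 = 0`.
  · have h : (T' - T) v = ((0 : ℝ) : ℂ) • v := by
      rw [sub_apply, hT'.apply_of_mem_orthogonal hv,
        hT.apply_of_mem_orthogonal (Submodule.orthogonal_le (specSub_mono hpq) hv)]
      simp
    rw [key h, hf0,
      specProj_apply_of_mem_orthogonal (Submodule.orthogonal_le (specSub_mono hab) hv)]
    simp

/-- A continuous function which is equal to `0` on `(-∞, 0]` and to `1` on `[ε, ∞)`. -/
def ramp (ε x : ℝ) : ℝ := max 0 (min 1 (x / ε))

lemma continuous_ramp (ε : ℝ) : Continuous (ramp ε) := by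
  unfold ramp
  fun_prop

lemma ramp_of_nonpos {ε x : ℝ} (hε : 0 < ε) (hx : x ≤ 0) : ramp ε x = 0 :=
  max_eq_left ((min_le_right _ _).trans (div_nonpos_of_nonpos_of_nonneg hx hε.le))

lemma ramp_of_le {ε x : ℝ} (hε : 0 < ε) (hx : ε ≤ x) : ramp ε x = 1 := by
  rw [ramp, min_eq_left ((one_le_div hε).2 hx), max_eq_right zero_le_one]

variable {ε ε' : ℝ} {T' : H →L[ℂ] H}

/-- The ramp separates `[ε, ε']` from `0` and from `[-ε', -ε]` continuously, thanks to the gap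
between `0` and `ε`. The reflected ramp does the same for the negative part. -/
lemma specProj_pos_eq_cfc (hA : IsSelfAdjoint A) (h : IsEnhanced A ε) (h' : IsEnhanced A ε')
    (hle : ε ≤ ε') (hT : IsCompression A (-ε) ε T) (hT' : IsCompression A (-ε') ε' T') :
    specProj A ε ε' = cfc (ramp ε) (T' - T) := by
  have hs := formalAdjoint_of_isSelfAdjoint hA
  have h0 := h.pos
  have f₁ := finite_specSub hs hA.isClosed h.notMem_ess
  have f₂ := finite_specSub hs hA.isClosed h'.notMem_ess
  have f₃ : FiniteDimensional ℂ (specSub A ε ε') :=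
    (FinSub.Hom.pos (specHom A hA h h' hle)).finite
  refine specProj_eq_cfc_sub hA (c := -ε') (d := -ε) (Icc_subset_Icc_left (by linarith))
    (Icc_subset_Icc_right (by linarith)) (Icc_subset_Icc (by linarith) hle) ?_
    (specSub_isOrtho hs le_rfl (eig_eq_bot h.notMem)).symm
    (specSub_isOrtho hs le_rfl (eig_eq_bot h.neg_notMem))
    (specSub_isOrtho hs (by linarith) (eig_eq_bot h.neg_notMem)) hT hT' (continuous_ramp ε)
    (ramp_of_nonpos h0 le_rfl) (fun x hx => ramp_of_le h0 hx.1)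
    (fun x hx => ramp_of_nonpos h0 (by linarith [hx.2]))
  rw [sup_comm, ← sup_assoc, sup_right_comm]
  exact FinSub.Hom.sup_eq (specHom A hA h h' hle)

lemma specProj_neg_eq_cfc (hA : IsSelfAdjoint A) (h : IsEnhanced A ε) (h' : IsEnhanced A ε')
    (hle : ε ≤ ε') (hT : IsCompression A (-ε) ε T) (hT' : IsCompression A (-ε') ε' T') :
    specProj A (-ε') (-ε) = cfc (fun x => ramp ε (-x)) (T' - T) := by
  have hs := formalAdjoint_of_isSelfAdjoint hA
  have h0 := h.pos
  have f₁ := finite_specSub hs hA.isClosed h.notMem_ess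
  have f₂ := finite_specSub hs hA.isClosed h'.notMem_ess
  have f₃ : FiniteDimensional ℂ (specSub A (-ε') (-ε)) :=
    (FinSub.Hom.neg (specHom A hA h h' hle)).finite
  exact specProj_eq_cfc_sub hA (c := ε) (d := ε') (Icc_subset_Icc_right (by linarith))
    (Icc_subset_Icc_left (by linarith)) (Icc_subset_Icc (by linarith) hle)
    (FinSub.Hom.sup_eq (specHom A hA h h' hle))
    (specSub_isOrtho hs le_rfl (eig_eq_bot h.neg_notMem))
    (specSub_isOrtho hs le_rfl (eig_eq_bot h.notMem)).symm
    (specSub_isOrtho hs (by linarith) (eig_eq_bot h.neg_notMem)).symm hT hT'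
    ((continuous_ramp ε).comp continuous_neg)
    (by rw [neg_zero]; exact ramp_of_nonpos h0 le_rfl)
    (fun x hx => ramp_of_le h0 (by linarith [hx.2]))
    (fun x hx => ramp_of_nonpos h0 (by linarith [hx.1]))

end Compressions

/-! ### Operations on norm continuous families of operators in a Hilbert bundle. -/

section ContinuousFamilies

variable {X : Type w} [TopologicalSpace X] {E : X → Type u} [∀ x, NormedAddCommGroup (E x)]
  [∀ x, InnerProductSpace ℂ (E x)] {F : Type v} [NormedAddCommGroup F] [InnerProductSpace ℂ F]
  {𝓗 : HilbertBundle E F} {S S' : Set X} {T T' : ∀ x, E x →L[ℂ] E x}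

namespace HilbertBundle.ContinuousFamilyOn

lemma mono (h : 𝓗.ContinuousFamilyOn S T) (hS : S' ⊆ S) : 𝓗.ContinuousFamilyOn S' T :=
  fun i => (h i).mono (inter_subset_inter_left _ hS)

lemma congr (h : 𝓗.ContinuousFamilyOn S T) (hT : ∀ x ∈ S, T' x = T x) :
    𝓗.ContinuousFamilyOn S T' :=
  fun i => (h i).congr fun x hx => by simp only [hT x hx.1]

lemma sub (h : 𝓗.ContinuousFamilyOn S T) (h' : 𝓗.ContinuousFamilyOn S T') :
    𝓗.ContinuousFamilyOn S fun x => T x - T' x :=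
  fun i => ((h i).sub (h' i)).congr fun x _ => by simp

lemma comp (h : 𝓗.ContinuousFamilyOn S T) (h' : 𝓗.ContinuousFamilyOn S T') :
    𝓗.ContinuousFamilyOn S fun x => T x ∘L T' x :=
  fun i => ((h i).clm_comp (h' i)).congr fun x _ => by
    ext
    simp

variable [∀ x, CompleteSpace (E x)] [CompleteSpace F]

lemma adjoint (h : 𝓗.ContinuousFamilyOn S T) :
    𝓗.ContinuousFamilyOn S fun x => ContinuousLinearMap.adjoint (T x) :=
  fun i => (ContinuousLinearMap.adjoint.continuous.comp_continuousOn (h i)).congr fun x _ =>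
    map_star (𝓗.triv i x).conjStarAlgEquiv (T x)

/-- A trivialization conjugates operators by a `*`-isomorphism, which commutes with the functional
calculus; in the model fiber the functional calculus of a continuous function is norm continuous. -/
lemma cfc (h : 𝓗.ContinuousFamilyOn S T) (hT : ∀ x ∈ S, IsSelfAdjoint (T x)) {f : ℝ → ℝ}
    (hf : Continuous f) : 𝓗.ContinuousFamilyOn S fun x => cfc f (T x) := by
  intro i
  have hi := h i
  have hsa : ∀ x ∈ S, IsSelfAdjoint ((𝓗.triv i x).conjStarAlgEquiv (T x)) := fun x hx =>
    (hT x hx).map _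
  have key : ContinuousOn (fun x => _root_.cfc f ((𝓗.triv i x).conjStarAlgEquiv (T x)))
      (S ∩ 𝓗.base i) := by
    rw [continuousOn_iff_continuous_domRestrict] at hi ⊢
    exact Continuous.cfc_of_mem_nhdsSet (s := univ) f Filter.univ_mem hi
      (fun x => hsa x x.2.1) hf.continuousOn
  refine key.congr fun x hx => ?_
  refine StarAlgHomClass.map_cfc (S := ℂ) (𝓗.triv i x).conjStarAlgEquiv f (T x) hf.continuousOn ?_
    (hT x hx.1) (hsa x hx.1)
  change Continuous fun T => ((𝓗.triv i x : E x →L[ℂ] F) ∘L T ∘L ((𝓗.triv i x).symm : F →L[ℂ] E x))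
  fun_prop

end HilbertBundle.ContinuousFamilyOn

end ContinuousFamilies

/-! ### The open sets on which `ε_σ` is attained at a given index. -/

section AttainedMinimum

variable {X : Type u} [TopologicalSpace X] {ι : Type v} {U : ι → Opens X}

/-- The objects `(x, σ)` of `X_U` such that `a ∈ σ` and `ε_σ = ε_a`. -/
def CoverObj.attains (U : ι → Opens X) (ε : ι → ℝ) (a : ι) : Set (CoverObj U) :=
  {p | a ∈ p.idx ∧ p.minEps ε = ε a}

/-- On this set `ε_σ` is the constant `ε a` and base points lie in `U a`, so adaptedness of `ε a`
over `U a` applies directly. Such sets cover `X_U`. -/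
lemma CoverObj.isOpen_attains (ε : ι → ℝ) (a : ι) : IsOpen (CoverObj.attains U ε a) := by
  have : {p : CoverObj U | a ∈ p.idx} = ⋃ σ ∈ {σ : Finset ι | a ∈ σ}, {p | p.idx = σ} := by
    ext p
    simp
  have h : IsOpen {p : CoverObj U | a ∈ p.idx} := by
    rw [this]
    exact isOpen_biUnion fun σ _ => CoverObj.isOpen_idx σ
  exact h.inter (CoverObj.isOpen_minEps ε (ε a))

lemma CoverObj.exists_attains (ε : ι → ℝ) (p : CoverObj U) : ∃ a, p ∈ CoverObj.attains U ε a := by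
  obtain ⟨a, ha, h⟩ := p.minEps_mem ε
  exact ⟨a, ha, h⟩

end AttainedMinimum

/-! ### The topology of `Ŝ(ℍ)` and continuity of the index functor. -/

section SubspaceBundles

section Isometries

variable {H : Type u} [NormedAddCommGroup H] [InnerProductSpace ℂ H] {K : Type v}
  [NormedAddCommGroup K] [InnerProductSpace ℂ K]

lemma FinSub.mapObj_symm_mapObj (e : H ≃ₗᵢ[ℂ] K) (V : FinSub H) :
    (V.mapObj e).mapObj e.symm = V := by
  refine FinSub.ext ?_
  ext v
  simp [FinSub.mapObj]

lemma FinSub.starProjection_mapObj (e : H ≃ₗᵢ[ℂ] K) (V : FinSub H) :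
    (V.mapObj e).carrier.starProjection =
      (e : H →L[ℂ] K) ∘L V.carrier.starProjection ∘L (e.symm : K →L[ℂ] H) := by
  ext x
  exact Submodule.starProjection_map_apply e V.carrier x

lemma FinSub.arrow_ext {f g : Arrow (FinSub H)} (hl : f.left = g.left) (hr : f.right = g.right)
    (hn : FinSub.Hom.neg f.hom = FinSub.Hom.neg g.hom)
    (hp : FinSub.Hom.pos f.hom = FinSub.Hom.pos g.hom) : f = g := by
  obtain ⟨V, W, f⟩ := f
  obtain ⟨V', W', g⟩ := g
  change V = V' at hl
  change W = W' at hr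
  subst hl hr
  exact congrArg Arrow.mk (FinSub.Hom.ext hn hp)

lemma FinSub.mapIso_symm_mapIso (e : H ≃ₗᵢ[ℂ] K) (f : Arrow (FinSub H)) :
    (FinSub.mapIso e.symm).mapArrow.obj ((FinSub.mapIso e).mapArrow.obj f) = f :=
  FinSub.arrow_ext (mapObj_symm_mapObj e _) (mapObj_symm_mapObj e _) (mapObj_symm_mapObj e _)
    (mapObj_symm_mapObj e _)

lemma FinSub.continuousOn_arrow_rng {Y : Type*} [TopologicalSpace Y] {S : Set Y}
    {f : Y → Arrow (FinSub H)} (h₁ : ContinuousOn (fun y => (f y).left) S)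
    (h₂ : ContinuousOn (fun y => (f y).right) S)
    (h₃ : ContinuousOn (fun y => FinSub.Hom.neg (f y).hom) S)
    (h₄ : ContinuousOn (fun y => FinSub.Hom.pos (f y).hom) S) : ContinuousOn f S := by
  rw [continuousOn_iff_continuous_domRestrict] at *
  exact FinSub.continuous_arrow_rng h₁ h₂ h₃ h₄

end Isometries

variable {X : Type w} [TopologicalSpace X] {E : X → Type u} [∀ x, NormedAddCommGroup (E x)]
  [∀ x, InnerProductSpace ℂ (E x)] {F : Type v} [NormedAddCommGroup F] [InnerProductSpace ℂ F]
  (𝓗 : HilbertBundle E F) {Y : Type u'} [TopologicalSpace Y] {π : Y → X} {S : Set Y} (i : 𝓗.ι)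

/-- The topology is coinduced from the charts, so charts are continuous; a family continuous in one
trivialization is a chart composed with a continuous map. -/
lemma SubspaceBundle.continuousOn_obj (hπ : ContinuousOn π S) (hS : ∀ y ∈ S, π y ∈ 𝓗.base i)
    {V : ∀ y, FinSub (E (π y))}
    (hV : ContinuousOn (fun y => (V y).mapObj (𝓗.triv i (π y))) S) :
    ContinuousOn (fun y => (SubspaceBundle.fiber 𝓗 (π y)).obj (V y)) S := by
  rw [continuousOn_iff_continuous_domRestrict] at hπ hV ⊢
  have h : Continuous fun p : 𝓗.base i × FinSub F =>
      (SubspaceBundle.fiber 𝓗 p.1).obj ((FinSub.mapIso (𝓗.triv i p.1).symm).obj p.2) :=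
    continuous_iff_coinduced_le.2
      (le_iSup (fun i : 𝓗.ι => TopologicalSpace.coinduced (fun p : 𝓗.base i × FinSub F =>
        (SubspaceBundle.fiber 𝓗 p.1).obj ((FinSub.mapIso (𝓗.triv i p.1).symm).obj p.2))
        inferInstance) i)
  refine (h.comp ((hπ.subtype_mk fun y => hS y y.2).prodMk hV)).congr fun y => ?_
  exact congrArg (SubspaceBundle.fiber 𝓗 (π y)).obj (FinSub.mapObj_symm_mapObj _ _)

lemma SubspaceBundle.continuousOn_arrow (hπ : ContinuousOn π S) (hS : ∀ y ∈ S, π y ∈ 𝓗.base i)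
    {f : ∀ y, Arrow (FinSub (E (π y)))}
    (hf : ContinuousOn (fun y => (FinSub.mapIso (𝓗.triv i (π y))).mapArrow.obj (f y)) S) :
    ContinuousOn (fun y => (SubspaceBundle.fiber 𝓗 (π y)).mapArrow.obj (f y)) S := by
  rw [continuousOn_iff_continuous_domRestrict] at hπ hf ⊢
  have h : Continuous fun p : 𝓗.base i × Arrow (FinSub F) =>
      (SubspaceBundle.fiber 𝓗 p.1).mapArrow.obj
        ((FinSub.mapIso (𝓗.triv i p.1).symm).mapArrow.obj p.2) :=
    continuous_iff_coinduced_le.2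
      (le_iSup (fun i : 𝓗.ι => TopologicalSpace.coinduced
        (fun p : 𝓗.base i × Arrow (FinSub F) => (SubspaceBundle.fiber 𝓗 p.1).mapArrow.obj
          ((FinSub.mapIso (𝓗.triv i p.1).symm).mapArrow.obj p.2)) inferInstance) i)
  refine (h.comp ((hπ.subtype_mk fun y => hS y y.2).prodMk hf)).congr fun y => ?_
  exact congrArg (SubspaceBundle.fiber 𝓗 (π y)).mapArrow.obj (FinSub.mapIso_symm_mapIso _ _)

variable {𝓗} in
/-- Subspaces of the fibers depend continuously on parameters if the projections do. -/
lemma HilbertBundle.ContinuousFamilyOn.continuousOn_mapObj {Q : Set X} {P : ∀ x, E x →L[ℂ] E x}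
    (hP : 𝓗.ContinuousFamilyOn Q P) (hπ : ContinuousOn π S)
    (hS : ∀ y ∈ S, π y ∈ Q ∧ π y ∈ 𝓗.base i) {V : ∀ y, FinSub (E (π y))}
    (hV : ∀ y ∈ S, (V y).carrier.starProjection = P (π y)) :
    ContinuousOn (fun y => (V y).mapObj (𝓗.triv i (π y))) S :=
  FinSub.continuousOn_rng <| ((hP i).comp hπ hS).congr fun y hy => by
    rw [FinSub.starProjection_mapObj, hV y hy]
    rfl

lemma FinSub.starProjection_eq_specProj {H : Type u} [NormedAddCommGroup H]
    [InnerProductSpace ℂ H] [CompleteSpace H] {A : H →ₗ.[ℂ] H} {a b : ℝ} {V : FinSub H}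
    (hV : V.carrier = specSub A a b) : V.carrier.starProjection = specProj A a b := by
  have : FiniteDimensional ℂ (specSub A a b) := hV ▸ V.finite
  simp only [specProj_eq_starProjection, hV]

variable [∀ x, CompleteSpace (E x)] {A : ∀ x, E x →ₗ.[ℂ] E x}

section Adapted

variable [CompleteSpace F] (hsa : ∀ x, IsSelfAdjoint (A x)) {Q Q' : Set X} {ε ε' : ℝ}

include hsa

/-- Continuity of the subspaces for `ε` and `ε'` controls only the sum of the negative and positive
parts. Continuity of the induced operators is what separates them. -/
lemma IsAdaptedOn.continuous_specProj_pos (h : IsAdaptedOn 𝓗 A Q ε) (h' : IsAdaptedOn 𝓗 A Q' ε')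
    (hle : ε ≤ ε') : 𝓗.ContinuousFamilyOn (Q ∩ Q') fun x => specProj (A x) ε ε' := by
  obtain ⟨T, hT, hTc⟩ := h.continuous_operator
  obtain ⟨T', hT', hTc'⟩ := h'.continuous_operator
  refine HilbertBundle.ContinuousFamilyOn.congr (((hT'.mono inter_subset_right).sub
    (hT.mono inter_subset_left)).cfc (fun x hx => ?_) (continuous_ramp ε)) fun x hx =>
      specProj_pos_eq_cfc (hsa x) (h.isEnhanced x hx.1) (h'.isEnhanced x hx.2) hle (hTc x hx.1)
        (hTc' x hx.2)
  have hs := formalAdjoint_of_isSelfAdjoint (hsa x)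
  have f₁ := finite_specSub hs (hsa x).isClosed (h.isEnhanced x hx.1).notMem_ess
  have f₂ := finite_specSub hs (hsa x).isClosed (h'.isEnhanced x hx.2).notMem_ess
  exact (IsCompression.isSelfAdjoint (hTc' x hx.2) (hsa x)).sub
    (IsCompression.isSelfAdjoint (hTc x hx.1) (hsa x))

lemma IsAdaptedOn.continuous_specProj_neg (h : IsAdaptedOn 𝓗 A Q ε) (h' : IsAdaptedOn 𝓗 A Q' ε')
    (hle : ε ≤ ε') : 𝓗.ContinuousFamilyOn (Q ∩ Q') fun x => specProj (A x) (-ε') (-ε) := by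
  obtain ⟨T, hT, hTc⟩ := h.continuous_operator
  obtain ⟨T', hT', hTc'⟩ := h'.continuous_operator
  refine HilbertBundle.ContinuousFamilyOn.congr (((hT'.mono inter_subset_right).sub
    (hT.mono inter_subset_left)).cfc (fun x hx => ?_) ((continuous_ramp ε).comp continuous_neg))
      fun x hx => specProj_neg_eq_cfc (hsa x) (h.isEnhanced x hx.1) (h'.isEnhanced x hx.2) hle
        (hTc x hx.1) (hTc' x hx.2)
  have hs := formalAdjoint_of_isSelfAdjoint (hsa x)
  have f₁ := finite_specSub hs (hsa x).isClosed (h.isEnhanced x hx.1).notMem_ess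
  have f₂ := finite_specSub hs (hsa x).isClosed (h'.isEnhanced x hx.2).notMem_ess
  exact (IsCompression.isSelfAdjoint (hTc' x hx.2) (hsa x)).sub
    (IsCompression.isSelfAdjoint (hTc x hx.1) (hsa x))

end Adapted

variable (hsa : ∀ x, IsSelfAdjoint (A x))

/-- Moving the target into the fiber over `x` exhibits the arrow as the image of an arrow of one
category of subspaces, where continuity can be tested in a trivialization. -/
lemma mk_indexHom {x y : X} (hxy : x = y) {ε ε' : ℝ} (h : IsEnhanced (A x) ε)
    (h' : IsEnhanced (A y) ε') (hle : ε ≤ ε') :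
    Arrow.mk (indexHom 𝓗 hsa hxy h h' hle) = (SubspaceBundle.fiber 𝓗 x).mapArrow.obj
      (Arrow.mk (specHom (A x) (hsa x) h (hxy ▸ h') hle)) := by
  subst hxy
  rfl

variable {ι : Type*} {κ : Type*} {U : ι → Opens X} {V : κ → Opens X} {ε : ι → ℝ} {δ : κ → ℝ}

omit [∀ x, CompleteSpace (E x)] in
lemma isEnhanced_minEps (h : ∀ a, ∀ x ∈ U a, IsEnhanced (A x) (ε a)) (p : CoverObj U) :
    IsEnhanced (A p.pt) (p.minEps ε) := by
  obtain ⟨a, ha, hε⟩ := p.minEps_mem ε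
  rw [hε]
  exact h a _ (p.mem a ha)

lemma continuous_indexFunctor_obj (hε : ∀ a, IsAdaptedOn 𝓗 A (U a) (ε a)) :
    Continuous (indexFunctor 𝓗 hsa U ε fun a => (hε a).isEnhanced).obj := by
  refine continuous_of_continuousOn
    (fun k : ι × 𝓗.ι => CoverObj.attains U ε k.1 ∩ CoverObj.pt ⁻¹' 𝓗.base k.2)
    (fun k => (CoverObj.isOpen_attains ε k.1).inter
      ((𝓗.base k.2).2.preimage CoverObj.continuous_pt))
    (fun p => ?_) fun k => ?_
  · obtain ⟨a, ha⟩ := p.exists_attains ε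
    obtain ⟨i, hi⟩ := 𝓗.cover p.pt
    exact ⟨(a, i), ha, hi⟩
  · refine SubspaceBundle.continuousOn_obj 𝓗 k.2 CoverObj.continuous_pt.continuousOn
      (fun p hp => hp.2) (V := fun p => specObj (A p.pt) (hsa p.pt)
        (isEnhanced_minEps (fun a => (hε a).isEnhanced) p)) ?_
    refine (hε k.1).continuous_subspace.continuousOn_mapObj k.2
      CoverObj.continuous_pt.continuousOn (fun p hp => ⟨p.mem _ hp.1.1, hp.2⟩) fun p hp => ?_
    exact FinSub.starProjection_eq_specProj (by rw [← hp.1.2]; rfl)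

lemma continuous_indexFunctor_mapArrow [CompleteSpace F]
    (hε : ∀ a, IsAdaptedOn 𝓗 A (U a) (ε a)) :
    Continuous (indexFunctor 𝓗 hsa U ε fun a => (hε a).isEnhanced).mapArrow.obj := by
  have hl := continuous_preorder_left (CoverObj U)
  have hr := continuous_preorder_right (CoverObj U)
  have hpt : Continuous fun f : Arrow (CoverObj U) => f.left.pt := CoverObj.continuous_pt.comp hl
  have hη := isEnhanced_minEps fun a => (hε a).isEnhanced
  have hη' : ∀ f : Arrow (CoverObj U), IsEnhanced (A f.left.pt) (f.right.minEps ε) := fun f =>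
    (leOfHom f.hom).1 ▸ hη f.right
  have hle : ∀ f : Arrow (CoverObj U), f.left.minEps ε ≤ f.right.minEps ε := fun f =>
    CoverObj.minEps_mono ε (leOfHom f.hom)
  refine continuous_of_continuousOn
    (fun k : ι × ι × 𝓗.ι => {f | (f.left ∈ CoverObj.attains U ε k.1 ∧
      f.right ∈ CoverObj.attains U ε k.2.1) ∧ f.left.pt ∈ 𝓗.base k.2.2})
    (fun k => ((((CoverObj.isOpen_attains ε k.1).preimage hl).inter
      ((CoverObj.isOpen_attains ε k.2.1).preimage hr)).inter ((𝓗.base k.2.2).2.preimage hpt)))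
    (fun f => ?_) fun k => ?_
  · obtain ⟨a, ha⟩ := f.left.exists_attains ε
    obtain ⟨b, hb⟩ := f.right.exists_attains ε
    obtain ⟨i, hi⟩ := 𝓗.cover f.left.pt
    exact ⟨(a, b, i), ⟨ha, hb⟩, hi⟩
  · obtain ⟨a, b, i⟩ := k
    refine (SubspaceBundle.continuousOn_arrow 𝓗 i hpt.continuousOn (fun f hf => hf.2)
      (f := fun f => Arrow.mk (specHom (A f.left.pt) (hsa _) (hη f.left) (hη' f) (hle f)))
      ?_).congr fun f _ => mk_indexHom 𝓗 hsa (leOfHom f.hom).1 (hη f.left) (hη f.right) (hle f)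
    have ha : ∀ f : Arrow (CoverObj U), f.left ∈ CoverObj.attains U ε a → f.left.pt ∈ U a :=
      fun f hf => f.left.mem a hf.1
    have hb : ∀ f : Arrow (CoverObj U), f.right ∈ CoverObj.attains U ε b → f.left.pt ∈ U b :=
      fun f hf => (leOfHom f.hom).1 ▸ f.right.mem b hf.1
    -- A morphism has `ε_σ ≤ ε_τ`, so the piece is empty if `ε a > ε b`.
    by_cases hab : ε a ≤ ε b
    swap
    · exact fun f hf => absurd (hf.1.1.2 ▸ hf.1.2.2 ▸ hle f) hab
    refine FinSub.continuousOn_arrow_rng ?_ ?_ ?_ ?_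
    · refine (hε a).continuous_subspace.continuousOn_mapObj i hpt.continuousOn
        (fun f hf => ⟨ha f hf.1.1, hf.2⟩) fun f hf => ?_
      exact FinSub.starProjection_eq_specProj (by rw [← hf.1.1.2]; rfl)
    · refine (hε b).continuous_subspace.continuousOn_mapObj i hpt.continuousOn
        (fun f hf => ⟨hb f hf.1.2, hf.2⟩) fun f hf => ?_
      exact FinSub.starProjection_eq_specProj (by rw [← hf.1.2.2]; rfl)
    · refine ((hε a).continuous_specProj_neg 𝓗 hsa (hε b) hab).continuousOn_mapObj i
        hpt.continuousOn (fun f hf => ⟨⟨ha f hf.1.1, hb f hf.1.2⟩, hf.2⟩) fun f hf => ?_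
      exact FinSub.starProjection_eq_specProj (by rw [← hf.1.1.2, ← hf.1.2.2]; rfl)
    · refine ((hε a).continuous_specProj_pos 𝓗 hsa (hε b) hab).continuousOn_mapObj i
        hpt.continuousOn (fun f hf => ⟨⟨ha f hf.1.1, hb f hf.1.2⟩, hf.2⟩) fun f hf => ?_
      exact FinSub.starProjection_eq_specProj (by rw [← hf.1.1.2, ← hf.1.2.2]; rfl)

/-- The minimum over the image of `σ` in the joint index set equals the minimum over `σ` only
propositionally, so the morphisms of the two functors have to be compared by `HEq`. -/
lemma indexHom_heq {x y : X} (hxy : x = y) {ε ε' η η' : ℝ} (e : ε = η) (e' : ε' = η')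
    (h : IsEnhanced (A x) ε) (h' : IsEnhanced (A y) ε') (hle : ε ≤ ε')
    (k : IsEnhanced (A x) η) (k' : IsEnhanced (A y) η') (kle : η ≤ η') :
    HEq (indexHom 𝓗 hsa hxy h h' hle) (indexHom 𝓗 hsa hxy k k' kle) := by
  subst e e'
  rfl

lemma specObj_congr {H : Type u} [NormedAddCommGroup H] [InnerProductSpace ℂ H] [CompleteSpace H]
    {A : H →ₗ.[ℂ] H} (hA : IsSelfAdjoint A) {ε η : ℝ} (e : ε = η) (h : IsEnhanced A ε)
    (k : IsEnhanced A η) : specObj A hA h = specObj A hA k := by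
  subst e
  rfl

theorem homotopicMaps_indexFunctor [T2Space X] [ParacompactSpace X] [CompleteSpace F]
    (hU : ⨆ a, U a = ⊤) (hV : ⨆ b, V b = ⊤) {s : X → Realization (CoverObj U)}
    (hs : IsHomotopyInverse (CoverObj.pr U) s) {t : X → Realization (CoverObj V)}
    (ht : IsHomotopyInverse (CoverObj.pr V) t)
    (hε : ∀ a, IsAdaptedOn 𝓗 A (U a) (ε a)) (hδ : ∀ b, IsAdaptedOn 𝓗 A (V b) (δ b)) :
    HomotopicMaps
      (Realization.map (indexFunctor 𝓗 hsa U ε fun a => (hε a).isEnhanced) ∘ s)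
      (Realization.map (indexFunctor 𝓗 hsa V δ fun b => (hδ b).isEnhanced) ∘ t) := by
  have hW : ∀ c, IsAdaptedOn 𝓗 A ((Sum.elim U V : ι ⊕ κ → Opens X) c)
    ((Sum.elim ε δ : ι ⊕ κ → ℝ) c) := Sum.forall.2 ⟨hε, hδ⟩
  refine homotopicMaps_of_functor hU hV hs ht (continuous_indexFunctor_obj 𝓗 hsa hW)
    (continuous_indexFunctor_mapArrow 𝓗 hsa hW) ?_ ?_
  · exact CategoryTheory.Functor.hext
      (fun p => congrArg (SubspaceBundle.fiber 𝓗 p.pt).obj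
        (specObj_congr (hsa p.pt) (CoverObj.minEps_inl ε δ p) _ _))
      fun p q f => indexHom_heq 𝓗 hsa _ (CoverObj.minEps_inl ε δ p) (CoverObj.minEps_inl ε δ q)
        _ _ _ _ _ _
  · exact CategoryTheory.Functor.hext
      (fun p => congrArg (SubspaceBundle.fiber 𝓗 p.pt).obj
        (specObj_congr (hsa p.pt) (CoverObj.minEps_inr ε δ p) _ _))
      fun p q f => indexHom_heq 𝓗 hsa _ (CoverObj.minEps_inr ε δ p) (CoverObj.minEps_inr ε δ q)
        _ _ _ _ _ _

end SubspaceBundles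

/-! ## General Fredholm operators in the fibers of a Hilbert bundle -/

section Polar

open ContinuousLinearMap (adjoint)

variable {H : Type u} [NormedAddCommGroup H] [InnerProductSpace ℂ H]

/-- Since morphisms of `S` add one subspace on each side, its projection is a difference of two
continuous projections. Unlike the self-adjoint case, no functional calculus is needed for the
subspaces. -/
lemma FinSub.starProjection_eq_sub {V W V' : FinSub H} (ho : V.carrier ⟂ W.carrier)
    (hsup : V.carrier ⊔ W.carrier = V'.carrier) :
    W.carrier.starProjection = V'.carrier.starProjection - V.carrier.starProjection := by
  have h0 : ∀ {K : FinSub H} {v : H}, v ∈ K.carrierᗮ → K.carrier.starProjection v = 0 :=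
    fun hv => by
      rw [Submodule.starProjection_apply,
        Submodule.orthogonalProjectionOnto_apply_of_mem_orthogonal hv, Submodule.coe_zero]
  have h1 : ∀ {K : FinSub H} {v : H}, v ∈ K.carrier → K.carrier.starProjection v = v :=
    fun hv => Submodule.starProjection_eq_self_iff.2 hv
  have hV : V.carrier ≤ V'.carrier := hsup ▸ le_sup_left
  have hW : W.carrier ≤ V'.carrier := hsup ▸ le_sup_right
  refine eq_of_eqOn_sup_orthogonal (W := V'.carrier) hsup (fun v hv => ?_) fun v hv => ?_
  · obtain ⟨x, hx, y, hy, rfl⟩ := Submodule.mem_sup.1 hv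
    rw [sub_apply, map_add, map_add, map_add, h0 (K := W) (ho hx), h1 hy, h1 (hV hx), h1 (hW hy),
      h1 hx, h0 (K := V) (ho.symm hy)]
    abel
  · rw [sub_apply, h0 hv, h0 (Submodule.orthogonal_le hV hv),
      h0 (Submodule.orthogonal_le hW hv), sub_zero]

variable [CompleteSpace H] {B : H →L[ℂ] H} {ε ε' : ℝ}

namespace IsEnhancedFredholm

lemma starProjection_diffFst (h : IsEnhancedFredholm B ε) (h' : IsEnhancedFredholm B ε')
    (hle : ε ≤ ε') : (h.diffFst h').carrier.starProjection =
      specProj (absOp B) 0 ε' - specProj (absOp B) 0 ε := by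
  refine (FinSub.starProjection_eq_sub (PairSub.Hom.fst_ortho (h.hom h' hle))
    (PairSub.Hom.fst_sup (h.hom h' hle))).trans ?_
  congr 1
  exacts [FinSub.starProjection_eq_specProj rfl, FinSub.starProjection_eq_specProj rfl]

lemma starProjection_diffSnd (h : IsEnhancedFredholm B ε) (h' : IsEnhancedFredholm B ε')
    (hle : ε ≤ ε') : (h.diffSnd h').carrier.starProjection =
      specProj (absOp (adjoint B)) 0 ε' - specProj (absOp (adjoint B)) 0 ε := by
  refine (FinSub.starProjection_eq_sub (PairSub.Hom.snd_ortho (h.hom h' hle))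
    (PairSub.Hom.snd_sup (h.hom h' hle))).trans ?_
  congr 1
  exacts [FinSub.starProjection_eq_specProj rfl, FinSub.starProjection_eq_specProj rfl]

end IsEnhancedFredholm

/-- A continuous function which is equal to `1 / √x` for `x ≥ ε²`. -/
def invSqrtFrom (ε x : ℝ) : ℝ := 1 / √(max x (ε ^ 2))

lemma continuous_invSqrtFrom (hε : 0 < ε) : Continuous (invSqrtFrom ε) :=
  continuous_const.div (by fun_prop) fun x =>
    (Real.sqrt_pos.2 ((by positivity : 0 < ε ^ 2).trans_le (le_max_right _ _))).ne'

lemma invSqrtFrom_sq (hε : 0 < ε) {μ : ℝ} (hμ : ε ≤ μ) : invSqrtFrom ε (μ * μ) = 1 / μ := by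
  rw [invSqrtFrom, max_eq_left (by nlinarith), Real.sqrt_mul_self (hε.le.trans hμ)]

/-- The partial isometry from the polar decomposition, on a spectral subspace of `|B|`, in terms of
the functional calculus. -/
lemma IsEnhancedFredholm.polarPart_eq_cfc (h : IsEnhancedFredholm B ε)
    (h' : IsEnhancedFredholm B ε') {K : H →L[ℂ] H}
    (hK : K = B ∘L (h.diffFst h').carrier.starProjection) :
    polarPart B (h.diffFst h') = K ∘L cfc (invSqrtFrom ε) (adjoint K ∘L K) := by
  have hsa : IsSelfAdjoint (adjoint K ∘L K) := IsSelfAdjoint.star_mul_self K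
  have key : ∀ {μ : ℝ} {v : H}, (adjoint K ∘L K) v = (μ : ℂ) • v →
      cfc (invSqrtFrom ε) (adjoint K ∘L K) v = ((invSqrtFrom ε μ : ℝ) : ℂ) • v := fun hv =>
    cfc_apply_of_eigenvector hsa (continuous_invSqrtFrom h.pos).continuousOn hv
  have hP : ∀ v ∈ (h.diffFst h').carrier, (h.diffFst h').carrier.starProjection v = v :=
    fun v hv => Submodule.starProjection_eq_self_iff.2 hv
  have hKadj : ∀ v, adjoint K v = (h.diffFst h').carrier.starProjection (adjoint B v) := fun v => by
    rw [hK, ContinuousLinearMap.adjoint_comp, ContinuousLinearMap.comp_apply,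
      ContinuousLinearMap.isSelfAdjoint_iff'.1 (isSelfAdjoint_starProjection _)]
  refine eq_of_eqOn_sup_orthogonal (W := (h.diffFst h').carrier) rfl (fun v hv => ?_)
    fun v hv => ?_
  -- On the eigenspace of `|B|` for `μ ≥ ε`, `K` is `B` and `K* K` is `μ²`, so the right side is `B
  -- / μ`, the same as `B |B|⁻¹`.
  · have hle : specSub (absOp B) ε ε' ≤ LinearMap.eqLocus (polarPart B (h.diffFst h') : H →ₗ[ℂ] H)
        (K ∘L cfc (invSqrtFrom ε) (adjoint K ∘L K) : H →L[ℂ] H) := by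
      refine iSup₂_le fun μ hμ v hv => ?_
      have hv' : v ∈ (h.diffFst h').carrier := eig_le_specSub hμ hv
      have hμ0 : 0 < μ := h.pos.trans_le hμ.1
      have hKv : K v = B v := by
        rw [hK, ContinuousLinearMap.comp_apply, hP v hv']
      have h1 : (adjoint K ∘L K) v = ((μ * μ : ℝ) : ℂ) • v := by
        rw [ContinuousLinearMap.comp_apply, hKv, hKadj, (mem_eig_absOp_iff hμ0).1 hv, map_smul,
          hP v hv', Complex.ofReal_mul]
      change polarPart B (h.diffFst h') v = K (cfc (invSqrtFrom ε) (adjoint K ∘L K) v)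
      rw [key h1, invSqrtFrom_sq h.pos hμ.1, map_smul, hKv]
      have h2 := ((h.polarPart_diffFst h').1 v hv').2
      rw [mem_eig_absOp.1 hv, map_smul] at h2
      rw [← h2, smul_smul, ← Complex.ofReal_mul, one_div_mul_cancel hμ0.ne', Complex.ofReal_one,
        one_smul]
    exact hle hv
  -- On the complement the function `invSqrtFrom ε` contributes its value at `0`, which does not
  -- vanish; the factor `K` on the left annihilates the result.
  · have hKv : K v = 0 := by
      rw [hK, ContinuousLinearMap.comp_apply, Submodule.starProjection_apply,
        Submodule.orthogonalProjectionOnto_apply_of_mem_orthogonal hv, Submodule.coe_zero, map_zero]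
    have h1 : (adjoint K ∘L K) v = ((0 : ℝ) : ℂ) • v := by
      rw [ContinuousLinearMap.comp_apply, hKv]
      simp
    rw [polarPart_eq_zero _ _ hv, ContinuousLinearMap.comp_apply, key h1, map_smul, hKv, smul_zero]

end Polar

/-! ### The topology of `S(ℍ)` and continuity of the index functor for general operators. -/

section PairBundleTopology

section Isometries

variable {H : Type u} [NormedAddCommGroup H] [InnerProductSpace ℂ H] {K : Type v}
  [NormedAddCommGroup K] [InnerProductSpace ℂ K]

lemma PairSub.arrow_ext {f g : Arrow (PairSub H)} (hl : f.left = g.left) (hr : f.right = g.right)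
    (h₁ : PairSub.Hom.fst f.hom = PairSub.Hom.fst g.hom)
    (h₂ : PairSub.Hom.snd f.hom = PairSub.Hom.snd g.hom)
    (hu : PairSub.Hom.u f.hom = PairSub.Hom.u g.hom) : f = g := by
  obtain ⟨V, W, f⟩ := f
  obtain ⟨V', W', g⟩ := g
  change V = V' at hl
  change W = W' at hr
  subst hl hr
  exact congrArg Arrow.mk (PairSub.Hom.ext h₁ h₂ hu)

lemma PairSub.mapIso_symm_mapIso_obj (e : H ≃ₗᵢ[ℂ] K) (V : PairSub H) :
    (PairSub.mapIso e.symm).obj ((PairSub.mapIso e).obj V) = V :=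
  PairSub.ext (FinSub.mapObj_symm_mapObj e _) (FinSub.mapObj_symm_mapObj e _)

lemma PairSub.mapIso_symm_mapIso (e : H ≃ₗᵢ[ℂ] K) (f : Arrow (PairSub H)) :
    (PairSub.mapIso e.symm).mapArrow.obj ((PairSub.mapIso e).mapArrow.obj f) = f :=
  PairSub.arrow_ext (mapIso_symm_mapIso_obj e _) (mapIso_symm_mapIso_obj e _)
    (FinSub.mapObj_symm_mapObj e _) (FinSub.mapObj_symm_mapObj e _) (by
      ext x
      change e.symm (e (PairSub.Hom.u f.hom (e.symm (e x)))) = _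
      simp)

lemma PairSub.continuousOn_rng {Y : Type*} [TopologicalSpace Y] {S : Set Y} {f : Y → PairSub H}
    (h₁ : ContinuousOn (fun y => (f y).fst) S) (h₂ : ContinuousOn (fun y => (f y).snd) S) :
    ContinuousOn f S := by
  rw [continuousOn_iff_continuous_domRestrict] at *
  exact continuous_induced_rng.2 (h₁.prodMk h₂)

lemma PairSub.continuousOn_arrow_rng {Y : Type*} [TopologicalSpace Y] {S : Set Y}
    {f : Y → Arrow (PairSub H)} (h₁ : ContinuousOn (fun y => (f y).left) S)
    (h₂ : ContinuousOn (fun y => (f y).right) S)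
    (h₃ : ContinuousOn (fun y => PairSub.Hom.fst (f y).hom) S)
    (h₄ : ContinuousOn (fun y => PairSub.Hom.snd (f y).hom) S)
    (h₅ : ContinuousOn (fun y => PairSub.Hom.u (f y).hom) S) : ContinuousOn f S := by
  rw [continuousOn_iff_continuous_domRestrict] at *
  exact continuous_induced_rng.2 ((h₁.prodMk h₂).prodMk (h₃.prodMk (h₄.prodMk h₅)))

end Isometries

open ContinuousLinearMap (adjoint)

variable {X : Type w} [TopologicalSpace X] {E : X → Type u} [∀ x, NormedAddCommGroup (E x)]
  [∀ x, InnerProductSpace ℂ (E x)] {F : Type v} [NormedAddCommGroup F] [InnerProductSpace ℂ F]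
  (𝓗 : HilbertBundle E F) {Y : Type u'} [TopologicalSpace Y] {π : Y → X} {S : Set Y} (i : 𝓗.ι)

lemma PairBundle.continuousOn_obj (hπ : ContinuousOn π S) (hS : ∀ y ∈ S, π y ∈ 𝓗.base i)
    {V : ∀ y, PairSub (E (π y))}
    (hV : ContinuousOn (fun y => (PairSub.mapIso (𝓗.triv i (π y))).obj (V y)) S) :
    ContinuousOn (fun y => (PairBundle.fiber 𝓗 (π y)).obj (V y)) S := by
  rw [continuousOn_iff_continuous_domRestrict] at hπ hV ⊢
  have h : Continuous fun p : 𝓗.base i × PairSub F =>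
      (PairBundle.fiber 𝓗 p.1).obj ((PairSub.mapIso (𝓗.triv i p.1).symm).obj p.2) :=
    continuous_iff_coinduced_le.2
      (le_iSup (fun i : 𝓗.ι => TopologicalSpace.coinduced (fun p : 𝓗.base i × PairSub F =>
        (PairBundle.fiber 𝓗 p.1).obj ((PairSub.mapIso (𝓗.triv i p.1).symm).obj p.2))
        inferInstance) i)
  refine (h.comp ((hπ.subtype_mk fun y => hS y y.2).prodMk hV)).congr fun y => ?_
  exact congrArg (PairBundle.fiber 𝓗 (π y)).obj (PairSub.mapIso_symm_mapIso_obj _ _)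

lemma PairBundle.continuousOn_arrow (hπ : ContinuousOn π S) (hS : ∀ y ∈ S, π y ∈ 𝓗.base i)
    {f : ∀ y, Arrow (PairSub (E (π y)))}
    (hf : ContinuousOn (fun y => (PairSub.mapIso (𝓗.triv i (π y))).mapArrow.obj (f y)) S) :
    ContinuousOn (fun y => (PairBundle.fiber 𝓗 (π y)).mapArrow.obj (f y)) S := by
  rw [continuousOn_iff_continuous_domRestrict] at hπ hf ⊢
  have h : Continuous fun p : 𝓗.base i × Arrow (PairSub F) =>
      (PairBundle.fiber 𝓗 p.1).mapArrow.obj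
        ((PairSub.mapIso (𝓗.triv i p.1).symm).mapArrow.obj p.2) :=
    continuous_iff_coinduced_le.2
      (le_iSup (fun i : 𝓗.ι => TopologicalSpace.coinduced
        (fun p : 𝓗.base i × Arrow (PairSub F) => (PairBundle.fiber 𝓗 p.1).mapArrow.obj
          ((PairSub.mapIso (𝓗.triv i p.1).symm).mapArrow.obj p.2)) inferInstance) i)
  refine (h.comp ((hπ.subtype_mk fun y => hS y y.2).prodMk hf)).congr fun y => ?_
  exact congrArg (PairBundle.fiber 𝓗 (π y)).mapArrow.obj (PairSub.mapIso_symm_mapIso _ _)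

variable [∀ x, CompleteSpace (E x)] {B : ∀ x, E x →L[ℂ] E x}

section Adapted

variable {Q Q' : Set X} {ε ε' : ℝ}

lemma IsGeneralAdaptedOn.continuous_diffFst (h : IsGeneralAdaptedOn 𝓗 B Q ε)
    (h' : IsGeneralAdaptedOn 𝓗 B Q' ε') : 𝓗.ContinuousFamilyOn (Q ∩ Q') fun x =>
      specProj (absOp (B x)) 0 ε' - specProj (absOp (B x)) 0 ε :=
  (h'.continuous_fst.mono inter_subset_right).sub (h.continuous_fst.mono inter_subset_left)

lemma IsGeneralAdaptedOn.continuous_diffSnd (h : IsGeneralAdaptedOn 𝓗 B Q ε)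
    (h' : IsGeneralAdaptedOn 𝓗 B Q' ε') : 𝓗.ContinuousFamilyOn (Q ∩ Q') fun x =>
      specProj (absOp (adjoint (B x))) 0 ε' - specProj (absOp (adjoint (B x))) 0 ε :=
  (h'.continuous_snd.mono inter_subset_right).sub (h.continuous_snd.mono inter_subset_left)

/-- The operator induced by `B` on the difference of two spectral subspaces of `|B|`. -/
def diffPart {H : Type u} [NormedAddCommGroup H] [InnerProductSpace ℂ H] [CompleteSpace H]
    (B : H →L[ℂ] H) (ε ε' : ℝ) : H →L[ℂ] H :=
  B ∘L specProj (absOp B) 0 ε' - B ∘L specProj (absOp B) 0 ε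

/-- The part `K` of `B` is a difference of two continuous families, and adjoints, products and the
functional calculus preserve continuity. -/
lemma IsGeneralAdaptedOn.continuous_isometry [CompleteSpace F] (h : IsGeneralAdaptedOn 𝓗 B Q ε)
    (h' : IsGeneralAdaptedOn 𝓗 B Q' ε') (hε : 0 < ε) : 𝓗.ContinuousFamilyOn (Q ∩ Q') fun x =>
      diffPart (B x) ε ε' ∘L
        cfc (invSqrtFrom ε) (adjoint (diffPart (B x) ε ε') ∘L diffPart (B x) ε ε') := by
  have hK : 𝓗.ContinuousFamilyOn (Q ∩ Q') fun x => diffPart (B x) ε ε' :=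
    (h'.continuous_operator.mono inter_subset_right).sub
      (h.continuous_operator.mono inter_subset_left)
  exact hK.comp ((hK.adjoint.comp hK).cfc (fun x _ => IsSelfAdjoint.star_mul_self _)
    (continuous_invSqrtFrom hε))

lemma IsEnhancedFredholm.u_hom {H : Type u} [NormedAddCommGroup H] [InnerProductSpace ℂ H]
    [CompleteSpace H] {B : H →L[ℂ] H} {ε ε' : ℝ} (h : IsEnhancedFredholm B ε)
    (h' : IsEnhancedFredholm B ε') (hle : ε ≤ ε') : PairSub.Hom.u (h.hom h' hle) =
      diffPart B ε ε' ∘L cfc (invSqrtFrom ε) (adjoint (diffPart B ε ε') ∘L diffPart B ε ε') :=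
  h.polarPart_eq_cfc h' (by
    rw [h.starProjection_diffFst h' hle, ContinuousLinearMap.comp_sub]
    rfl)

end Adapted

lemma mk_generalIndexHom {x y : X} (hxy : x = y) {ε ε' : ℝ} (h : IsEnhancedFredholm (B x) ε)
    (h' : IsEnhancedFredholm (B y) ε') (hle : ε ≤ ε') :
    Arrow.mk (generalIndexHom 𝓗 hxy h h' hle) = (PairBundle.fiber 𝓗 x).mapArrow.obj
      (Arrow.mk (IsEnhancedFredholm.hom h (hxy ▸ h' : IsEnhancedFredholm (B x) ε') hle)) := by
  subst hxy
  rfl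

variable {ι : Type*} {κ : Type*} {U : ι → Opens X} {V : κ → Opens X} {ε : ι → ℝ} {δ : κ → ℝ}

lemma isEnhancedFredholm_minEps (h : ∀ a, ∀ x ∈ U a, IsEnhancedFredholm (B x) (ε a))
    (p : CoverObj U) : IsEnhancedFredholm (B p.pt) (p.minEps ε) := by
  obtain ⟨a, ha, hε⟩ := p.minEps_mem ε
  rw [hε]
  exact h a _ (p.mem a ha)

lemma continuous_generalIndexFunctor_obj (hε : ∀ a, IsGeneralAdaptedOn 𝓗 B (U a) (ε a)) :
    Continuous (generalIndexFunctor 𝓗 U ε fun a => (hε a).isEnhanced).obj := by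
  refine continuous_of_continuousOn
    (fun k : ι × 𝓗.ι => CoverObj.attains U ε k.1 ∩ CoverObj.pt ⁻¹' 𝓗.base k.2)
    (fun k => (CoverObj.isOpen_attains ε k.1).inter
      ((𝓗.base k.2).2.preimage CoverObj.continuous_pt))
    (fun p => ?_) fun k => ?_
  · obtain ⟨a, ha⟩ := p.exists_attains ε
    obtain ⟨i, hi⟩ := 𝓗.cover p.pt
    exact ⟨(a, i), ha, hi⟩
  · refine PairBundle.continuousOn_obj 𝓗 k.2 CoverObj.continuous_pt.continuousOn
      (fun p hp => hp.2) (V := fun p =>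
        (isEnhancedFredholm_minEps (fun a => (hε a).isEnhanced) p).obj) ?_
    refine PairSub.continuousOn_rng
      ((hε k.1).continuous_fst.continuousOn_mapObj k.2
        CoverObj.continuous_pt.continuousOn (fun p hp => ⟨p.mem _ hp.1.1, hp.2⟩) fun p hp => ?_)
      ((hε k.1).continuous_snd.continuousOn_mapObj k.2
        CoverObj.continuous_pt.continuousOn (fun p hp => ⟨p.mem _ hp.1.1, hp.2⟩) fun p hp => ?_)
    · exact FinSub.starProjection_eq_specProj (by rw [← hp.1.2]; rfl)
    · exact FinSub.starProjection_eq_specProj (by rw [← hp.1.2]; rfl)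

lemma continuous_generalIndexFunctor_mapArrow [CompleteSpace F]
    (hε : ∀ a, IsGeneralAdaptedOn 𝓗 B (U a) (ε a)) :
    Continuous (generalIndexFunctor 𝓗 U ε fun a => (hε a).isEnhanced).mapArrow.obj := by
  have hl := continuous_preorder_left (CoverObj U)
  have hr := continuous_preorder_right (CoverObj U)
  have hpt : Continuous fun f : Arrow (CoverObj U) => f.left.pt := CoverObj.continuous_pt.comp hl
  have hη := isEnhancedFredholm_minEps fun a => (hε a).isEnhanced
  have hη' : ∀ f : Arrow (CoverObj U), IsEnhancedFredholm (B f.left.pt) (f.right.minEps ε) :=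
    fun f => (leOfHom f.hom).1 ▸ hη f.right
  have hle : ∀ f : Arrow (CoverObj U), f.left.minEps ε ≤ f.right.minEps ε := fun f =>
    CoverObj.minEps_mono ε (leOfHom f.hom)
  refine continuous_of_continuousOn
    (fun k : ι × ι × 𝓗.ι => {f | (f.left ∈ CoverObj.attains U ε k.1 ∧
      f.right ∈ CoverObj.attains U ε k.2.1) ∧ f.left.pt ∈ 𝓗.base k.2.2})
    (fun k => ((((CoverObj.isOpen_attains ε k.1).preimage hl).inter
      ((CoverObj.isOpen_attains ε k.2.1).preimage hr)).inter ((𝓗.base k.2.2).2.preimage hpt)))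
    (fun f => ?_) fun k => ?_
  · obtain ⟨a, ha⟩ := f.left.exists_attains ε
    obtain ⟨b, hb⟩ := f.right.exists_attains ε
    obtain ⟨i, hi⟩ := 𝓗.cover f.left.pt
    exact ⟨(a, b, i), ⟨ha, hb⟩, hi⟩
  · obtain ⟨a, b, i⟩ := k
    refine (PairBundle.continuousOn_arrow 𝓗 i hpt.continuousOn (fun f hf => hf.2)
      (f := fun f => Arrow.mk (IsEnhancedFredholm.hom (hη f.left) (hη' f) (hle f)))
      ?_).congr fun f _ =>
        mk_generalIndexHom 𝓗 (leOfHom f.hom).1 (hη f.left) (hη f.right) (hle f)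
    have ha : ∀ f : Arrow (CoverObj U), f.left ∈ CoverObj.attains U ε a → f.left.pt ∈ U a :=
      fun f hf => f.left.mem a hf.1
    have hb : ∀ f : Arrow (CoverObj U), f.right ∈ CoverObj.attains U ε b → f.left.pt ∈ U b :=
      fun f hf => (leOfHom f.hom).1 ▸ f.right.mem b hf.1
    -- Positivity is part of being enhanced at some point, so it is unavailable when `U a` is empty;
    -- in the absence of positivity the piece is empty.
    by_cases hpos : 0 < ε a
    swap
    · exact fun f hf => absurd (hf.1.1.2 ▸ (hη f.left).pos) hpos
    refine PairSub.continuousOn_arrow_rng (PairSub.continuousOn_rng ?_ ?_)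
      (PairSub.continuousOn_rng ?_ ?_) ?_ ?_ ?_
    · refine (hε a).continuous_fst.continuousOn_mapObj i hpt.continuousOn
        (fun f hf => ⟨ha f hf.1.1, hf.2⟩) fun f hf => ?_
      exact FinSub.starProjection_eq_specProj (by rw [← hf.1.1.2]; rfl)
    · refine (hε a).continuous_snd.continuousOn_mapObj i hpt.continuousOn
        (fun f hf => ⟨ha f hf.1.1, hf.2⟩) fun f hf => ?_
      exact FinSub.starProjection_eq_specProj (by rw [← hf.1.1.2]; rfl)
    · refine (hε b).continuous_fst.continuousOn_mapObj i hpt.continuousOn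
        (fun f hf => ⟨hb f hf.1.2, hf.2⟩) fun f hf => ?_
      exact FinSub.starProjection_eq_specProj (by rw [← hf.1.2.2]; rfl)
    · refine (hε b).continuous_snd.continuousOn_mapObj i hpt.continuousOn
        (fun f hf => ⟨hb f hf.1.2, hf.2⟩) fun f hf => ?_
      exact FinSub.starProjection_eq_specProj (by rw [← hf.1.2.2]; rfl)
    · refine ((hε a).continuous_diffFst 𝓗 (hε b)).continuousOn_mapObj i
        hpt.continuousOn (fun f hf => ⟨⟨ha f hf.1.1, hb f hf.1.2⟩, hf.2⟩) fun f hf => ?_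
      rw [← hf.1.1.2, ← hf.1.2.2]
      exact (hη f.left).starProjection_diffFst (hη' f) (hle f)
    · refine ((hε a).continuous_diffSnd 𝓗 (hε b)).continuousOn_mapObj i
        hpt.continuousOn (fun f hf => ⟨⟨ha f hf.1.1, hb f hf.1.2⟩, hf.2⟩) fun f hf => ?_
      rw [← hf.1.1.2, ← hf.1.2.2]
      exact (hη f.left).starProjection_diffSnd (hη' f) (hle f)
    · refine (((hε a).continuous_isometry 𝓗 (hε b) hpos i).comp hpt.continuousOn
        (fun f hf => ⟨⟨ha f hf.1.1, hb f hf.1.2⟩, hf.2⟩)).congr fun f hf => ?_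
      rw [Function.comp_apply, ← hf.1.1.2, ← hf.1.2.2]
      change _ ∘L PairSub.Hom.u ((hη f.left).hom (hη' f) (hle f)) ∘L _ = _
      rw [(hη f.left).u_hom (hη' f) (hle f)]

lemma generalIndexHom_heq {x y : X} (hxy : x = y) {ε ε' η η' : ℝ} (e : ε = η) (e' : ε' = η')
    (h : IsEnhancedFredholm (B x) ε) (h' : IsEnhancedFredholm (B y) ε') (hle : ε ≤ ε')
    (k : IsEnhancedFredholm (B x) η) (k' : IsEnhancedFredholm (B y) η') (kle : η ≤ η') :
    HEq (generalIndexHom 𝓗 hxy h h' hle) (generalIndexHom 𝓗 hxy k k' kle) := by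
  subst e e'
  rfl

lemma IsEnhancedFredholm.obj_congr {H : Type u} [NormedAddCommGroup H] [InnerProductSpace ℂ H]
    [CompleteSpace H] {B : H →L[ℂ] H} {ε η : ℝ} (e : ε = η) (h : IsEnhancedFredholm B ε)
    (k : IsEnhancedFredholm B η) : h.obj = k.obj := by
  subst e
  rfl

theorem homotopicMaps_generalIndexFunctor [T2Space X] [ParacompactSpace X] [CompleteSpace F]
    (hU : ⨆ a, U a = ⊤) (hV : ⨆ b, V b = ⊤) {s : X → Realization (CoverObj U)}
    (hs : IsHomotopyInverse (CoverObj.pr U) s) {t : X → Realization (CoverObj V)}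
    (ht : IsHomotopyInverse (CoverObj.pr V) t)
    (hε : ∀ a, IsGeneralAdaptedOn 𝓗 B (U a) (ε a)) (hδ : ∀ b, IsGeneralAdaptedOn 𝓗 B (V b) (δ b)) :
    HomotopicMaps
      (Realization.map (generalIndexFunctor 𝓗 U ε fun a => (hε a).isEnhanced) ∘ s)
      (Realization.map (generalIndexFunctor 𝓗 V δ fun b => (hδ b).isEnhanced) ∘ t) := by
  have hW : ∀ c, IsGeneralAdaptedOn 𝓗 B ((Sum.elim U V : ι ⊕ κ → Opens X) c)
    ((Sum.elim ε δ : ι ⊕ κ → ℝ) c) := Sum.forall.2 ⟨hε, hδ⟩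
  refine homotopicMaps_of_functor hU hV hs ht (continuous_generalIndexFunctor_obj 𝓗 hW)
    (continuous_generalIndexFunctor_mapArrow 𝓗 hW) ?_ ?_
  · exact CategoryTheory.Functor.hext
      (fun p => congrArg (PairBundle.fiber 𝓗 p.pt).obj
        (IsEnhancedFredholm.obj_congr (CoverObj.minEps_inl ε δ p) _ _))
      fun p q f => generalIndexHom_heq 𝓗 _ (CoverObj.minEps_inl ε δ p) (CoverObj.minEps_inl ε δ q)
        _ _ _ _ _ _
  · exact CategoryTheory.Functor.hext
      (fun p => congrArg (PairBundle.fiber 𝓗 p.pt).obj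
        (IsEnhancedFredholm.obj_congr (CoverObj.minEps_inr ε δ p) _ _))
      fun p q f => generalIndexHom_heq 𝓗 _ (CoverObj.minEps_inr ε δ p) (CoverObj.minEps_inr ε δ q)
        _ _ _ _ _ _

end PairBundleTopology

end AnalyticIndex

end

/-! ### The main theorem. -/

open AnalyticIndex

theorem mainTheorem12
    {X : Type*} [TopologicalSpace X] [T2Space X] [ParacompactSpace X]
    {H : Type*} [NormedAddCommGroup H] [InnerProductSpace ℂ H] [CompleteSpace H]
    [SeparableSpace H] (hH : ¬ FiniteDimensional ℂ H)
    {ι ι' : Type*} (U : ι → Opens X) (V : ι' → Opens X)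
    (hU : ⨆ a, U a = ⊤) (hV : ⨆ b, V b = ⊤) (ε : ι → ℝ) (δ : ι' → ℝ)
    (s : X → Realization (CoverObj U)) (hs : IsHomotopyInverse (CoverObj.pr U) s)
    (t : X → Realization (CoverObj V)) (ht : IsHomotopyInverse (CoverObj.pr V) t) :
    -- Families of bounded self-adjoint Fredholm operators, continuous in the norm topology.
    (∀ (A : C(X, BoundedSAFredholm H))
      (hε : ∀ a, ∀ z ∈ U a, IsEnhanced (A z).toPMap (ε a))
      (hδ : ∀ b, ∀ z ∈ V b, IsEnhanced (A z).toPMap (δ b)),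
      HomotopicMaps
        (Realization.map (enhancing BoundedSAFredholm.toPMap A U ε hε) ∘ s)
        (Realization.map (enhancing BoundedSAFredholm.toPMap A V δ hδ) ∘ t) ∧
      (CoverObj.pr U ∘ s = id →
        EnhancedObj.forget BoundedSAFredholm.toPMap ∘
          Realization.map (enhancing BoundedSAFredholm.toPMap A U ε hε) ∘ s = A) ∧
      HomotopicMaps
        (Realization.map (EnhancedObj.spectral BoundedSAFredholm.isSelfAdjoint_toPMap) ∘
          Realization.map (enhancing BoundedSAFredholm.toPMap A U ε hε) ∘ s)
        (Realization.map (EnhancedObj.spectral BoundedSAFredholm.isSelfAdjoint_toPMap) ∘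
          Realization.map (enhancing BoundedSAFredholm.toPMap A V δ hδ) ∘ t)) ∧
    -- Families of closed densely defined self-adjoint Fredholm operators, continuous in the Riesz
    -- topology.
    (∀ (A : C(X, SAFredholm H))
      (hε : ∀ a, ∀ z ∈ U a, IsEnhanced (A z).toPMap (ε a))
      (hδ : ∀ b, ∀ z ∈ V b, IsEnhanced (A z).toPMap (δ b)),
      HomotopicMaps
        (Realization.map (enhancing SAFredholm.toPMap A U ε hε) ∘ s)
        (Realization.map (enhancing SAFredholm.toPMap A V δ hδ) ∘ t) ∧
      (CoverObj.pr U ∘ s = id →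
        EnhancedObj.forget SAFredholm.toPMap ∘
          Realization.map (enhancing SAFredholm.toPMap A U ε hε) ∘ s = A) ∧
      HomotopicMaps
        (Realization.map (EnhancedObj.spectral SAFredholm.isSelfAdjoint) ∘
          Realization.map (enhancing SAFredholm.toPMap A U ε hε) ∘ s)
        (Realization.map (EnhancedObj.spectral SAFredholm.isSelfAdjoint) ∘
          Realization.map (enhancing SAFredholm.toPMap A V δ hδ) ∘ t)) ∧
    -- Fredholm families of self-adjoint operators in the fibers of a Hilbert bundle.
    (∀ {E : X → Type*} [∀ x, NormedAddCommGroup (E x)] [∀ x, InnerProductSpace ℂ (E x)]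
      [∀ x, CompleteSpace (E x)] (𝓗 : HilbertBundle E H)
      (A : ∀ x, E x →ₗ.[ℂ] E x) (hA : IsFredholmFamily 𝓗 A)
      (hε : ∀ a, IsAdaptedOn 𝓗 A (U a) (ε a)) (hδ : ∀ b, IsAdaptedOn 𝓗 A (V b) (δ b)),
      HomotopicMaps
        (Realization.map
          (indexFunctor 𝓗 hA.isSelfAdjoint U ε fun a => (hε a).isEnhanced) ∘ s)
        (Realization.map
          (indexFunctor 𝓗 hA.isSelfAdjoint V δ fun b => (hδ b).isEnhanced) ∘ t)) ∧
    -- Fredholm families of bounded, not necessarily self-adjoint, operators in the fibers of a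
    -- Hilbert bundle.
    (∀ {E : X → Type*} [∀ x, NormedAddCommGroup (E x)] [∀ x, InnerProductSpace ℂ (E x)]
      [∀ x, CompleteSpace (E x)] (𝓗 : HilbertBundle E H)
      (B : ∀ x, E x →L[ℂ] E x) (_hB : IsGeneralFredholmFamily 𝓗 B)
      (hε : ∀ a, IsGeneralAdaptedOn 𝓗 B (U a) (ε a)) (hδ : ∀ b, IsGeneralAdaptedOn 𝓗 B (V b) (δ b)),
      HomotopicMaps
        (Realization.map (generalIndexFunctor 𝓗 U ε fun a => (hε a).isEnhanced) ∘ s)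
        (Realization.map (generalIndexFunctor 𝓗 V δ fun b => (hδ b).isEnhanced) ∘ t)) := by
  refine ⟨fun A hε hδ => ?_, fun A hε hδ => ?_, fun 𝓗 A hA hε hδ => ?_, fun 𝓗 B _ hε hδ => ?_⟩
  -- For the norm topology the transform is the operator itself, with `g = id`.
  · exact enhancing_main hε hδ hU hV hs ht A.continuous BoundedSAFredholm.isSelfAdjoint_toPMap
      (B := BoundedSAFredholm.op) continuous_induced_dom fun A => isTransform_ofBounded A.isSelfAdjoint
  -- The Riesz topology is induced by the bounded transforms, so the same argument applies with `g =
  -- rieszFun`.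
  · exact enhancing_main hε hδ hU hV hs ht A.continuous SAFredholm.isSelfAdjoint
      (B := fun A => boundedTransform A.toPMap) continuous_induced_dom
      fun A => (boundedTransform_spec A.isSelfAdjoint).isTransform
  · exact homotopicMaps_indexFunctor 𝓗 hA.isSelfAdjoint hU hV hs ht hε hδ
  · exact homotopicMaps_generalIndexFunctor 𝓗 hU hV hs ht hε hδ
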